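/- Let $F$ be a quadratic number field with discriminant $\Delta_F$ and non-trivial automorphism $c$, and let $p$ be a prime number that is ramified in $F$. Put $F_p=F\otimes_{\mathbf Q}\mathbf Q_p$ (a ramified quadratic extension field of $\mathbf Q_p$), with ring of integers $\mathcal O=\mathcal O_F\otimes\mathbf Z_p$, normalized absolute value $|x|=|\mathrm N_{F_p/\mathbf Q_p}(x)|_p$ and norm $\mathrm N=\mathrm N_{F_p/\mathbf Q_p}$. For a $2\times2$ matrix $x$ let $x^*$ be its adjugate. Let $$V_p=\{x\in \mathrm M_2(F_p)\mid x^*=x^c\},\qquad \mathrm n(x)=xx^*=\det x\in\mathbf Q_p,\qquad (x,y)=\mathrm n(x+y)-\mathrm n(x)-\mathrm n(y),$$ and let $$H^0(\mathbf Q_p)=(\mathrm{GL}_2(F_p)\times\mathbf Q_p^\times)/F_p^\times,\qquad F_p^\times\ni z\mapsto (z,\mathrm N(z)),$$ act on $V_p$ by $\varrho(a,\alpha)x=\alpha^{-1}ax(a^c)^*$. Let $H^0_1(\mathbf Q_p)=\{(a,\alpha)\in H^0(\mathbf Q_p)\mid \alpha^{-2}\mathrm N(\det a)=1\}$, let $\mathrm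 dh$ be a Haar measure on it, and let $\mathcal U_p=H^0_1(\mathbf Q_p)\cap(\mathrm{GL}_2(\mathcal O)\times\mathbf Z_p^\times)/\mathcal O^\times$. Let $\psi_p$ be the $p$-component of the additive character of $\mathbf A/\mathbf Q$ whose archimedean component is $x\mapsto e^{2\pi i x}$. Let $L_p=V_p\cap\mathrm M_2(\mathcal O)$ and let $\varphi^\star$ be the characteristic function of $L_p\oplus L_p$ on $\mathbf X_p=V_p\oplus V_p$. For $h\in H^0_1(\mathbf Q_p)$ put $(\omega(h)\varphi)(x)=\varphi(h^{-1}x)$, and let $\mathcal B_\omega(\varphi_1,\varphi_2)=\int_{\mathbf X_p}\varphi_1(x)\overline{\varphi_2(x)}\,\mathrm dx$, where $\mathrm dx$ is the Haar measure on $\mathbf X_p$ that is self-dual with respect to $\psi_p$ and the bilinear form $(x_1,y_1)+(x_2,y_2)$. Let $\pi=\pi(\mu,\nu)$ be a unitary unramified principal series representation of $\mathrm{PGL}_2(F_p)$, where $\mu,\nu$ are unramified characters of $F_p^\times$ with $\mu\nu^{-1}\ne|\cdot|^{\pm1}$. Let $\sigma=\pi\boxtimes\mathbf 1$, a representation of $H^0(\mathbf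 Q_p)$, let $f^\dagger$ be a non-zero $\mathrm{GL}_2(\mathcal O)$-invariant vector of $\pi$, and let $\mathcal B_\sigma$ be the $H^0(\mathbf Q_p)$-invariant sesquilinear pairing on $\pi$ with $\mathcal B_\sigma(f^\dagger,f^\dagger)=1$. Then the integral $$\mathcal Z_p(\varphi^\star,f^\dagger)=\int_{H^0_1(\mathbf Q_p)}\mathcal B_\omega(\omega(h)\varphi^\star,\varphi^\star)\,\mathcal B_\sigma(\sigma(h)f^\dagger,f^\dagger)\,\mathrm dh$$ converges absolutely and $$\mathcal Z_p(\varphi^\star,f^\dagger)=\mathrm{vol}(\mathcal U_p)\cdot|2^{-4}\Delta_F^3|_p\,(1+p^{-1})\cdot\frac{L(1,\mathrm{As}^+(\pi))}{\zeta_p(1)\zeta_p(2)}.$$ Here $\zeta_p(s)=(1-p^{-s})^{-1}$ and $L(s,\mathrm{As}^+(\pi))=L(s,\mu|_{\mathbf Q_p^\times})\,L(s,\mu\nu)\,L(s,\nu|_{\mathbf Q_p^\times})$, where $L(s,\mu\nu)$ is the Hecke $L$-factor of the character $\mu\nu$ of $F_p^\times$ and the other two are the Hecke $L$-factors of characters of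 $\mathbf Q_p^\times$. -/

import Mathlib

open scoped TensorProduct ComplexConjugate NumberField MatrixGroups

noncomputable section

namespace RamifiedZeta

/-! ### The additive character of `ℚ_p` -/

section AddCharacter

variable (p : ℕ) [Fact p.Prime]

theorem exists_principalPart (x : ℚ_[p]) :
    ∃ r : ℚ, (∃ (a : ℤ) (n : ℕ), r = a / (p : ℚ) ^ n) ∧ ‖x - (r : ℚ_[p])‖ ≤ 1 := by
  have hp : (p : ℚ_[p]) ≠ 0 := by
    exact_mod_cast (Fact.out : p.Prime).ne_zero
  obtain ⟨n, hn⟩ : ∃ n : ℕ, ‖x * (p : ℚ_[p]) ^ n‖ ≤ 1 := by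
    have h1 : (1 : ℝ) < p := by exact_mod_cast (Fact.out : p.Prime).one_lt
    obtain ⟨n, hn⟩ := pow_unbounded_of_one_lt ‖x‖ h1
    refine ⟨n, ?_⟩
    rw [norm_mul, norm_pow, Padic.norm_p, inv_pow]
    have h2 : (0 : ℝ) < (p : ℝ) ^ n := by positivity
    rw [← div_eq_mul_inv, div_le_one h2]
    exact hn.le
  let y : ℤ_[p] := ⟨x * (p : ℚ_[p]) ^ n, hn⟩
  refine ⟨((y.appr n : ℤ) : ℚ) / (p : ℚ) ^ n, ⟨_, n, rfl⟩, ?_⟩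
  have h3 := PadicInt.appr_spec n y
  rw [← PadicInt.norm_le_pow_iff_mem_span_pow, PadicInt.norm_def] at h3
  have h4 : x - ((((y.appr n : ℤ) : ℚ) / (p : ℚ) ^ n : ℚ) : ℚ_[p])
      = ((y - (y.appr n : ℤ_[p]) : ℤ_[p]) : ℚ_[p]) * ((p : ℚ_[p]) ^ n)⁻¹ := by
    push_cast
    simp only [y]
    field_simp
  rw [h4, norm_mul, norm_inv, norm_pow, Padic.norm_p]
  have h2 : (0 : ℝ) < (p : ℝ) ^ n := by
    have : (0 : ℝ) < p := by exact_mod_cast (Fact.out : p.Prime).pos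
    positivity
  calc _ ≤ (p : ℝ) ^ (-n : ℤ) * ((p : ℝ)⁻¹ ^ n)⁻¹ := by gcongr
    _ = 1 := by
      rw [zpow_neg, zpow_natCast, inv_pow, inv_inv, inv_mul_cancel₀ h2.ne']
    _ ≤ 1 := le_rfl

/-- A rational number `a / p ^ n` which is congruent to `x` modulo `ℤ_p`. -/
def principalPart (x : ℚ_[p]) : ℚ := (exists_principalPart p x).choose

theorem int_of_norm_le_one {r : ℚ} (h : ∃ (a : ℤ) (n : ℕ), r = a / (p : ℚ) ^ n)
    (hr : ‖(r : ℚ_[p])‖ ≤ 1) : ∃ k : ℤ, r = k := by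
  obtain ⟨a, n, rfl⟩ := h
  have hp : (p : ℚ) ≠ 0 := by exact_mod_cast (Fact.out : p.Prime).ne_zero
  have h2 : (0 : ℝ) < (p : ℝ) ^ n := by
    have : (0 : ℝ) < p := by exact_mod_cast (Fact.out : p.Prime).pos
    positivity
  have h3 : ‖(a : ℚ_[p])‖ ≤ (p : ℝ) ^ (-n : ℤ) := by
    push_cast at hr
    rw [norm_div, norm_pow, Padic.norm_p, inv_pow, div_inv_eq_mul] at hr
    rw [zpow_neg, zpow_natCast, ← one_div, le_div_iff₀ h2]
    exact hr
  rw [Padic.norm_int_le_pow_iff_dvd] at h3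
  obtain ⟨k, rfl⟩ := h3
  refine ⟨k, ?_⟩
  push_cast
  field_simp

theorem principalPart_add (x y : ℚ_[p]) :
    ∃ k : ℤ, principalPart p (x + y) = principalPart p x + principalPart p y + k := by
  obtain ⟨⟨a, n, h1⟩, h1'⟩ := (exists_principalPart p x).choose_spec
  obtain ⟨⟨b, m, h2⟩, h2'⟩ := (exists_principalPart p y).choose_spec
  obtain ⟨⟨d, l, h3⟩, h3'⟩ := (exists_principalPart p (x + y)).choose_spec
  have hp : (p : ℚ) ≠ 0 := by exact_mod_cast (Fact.out : p.Prime).ne_zero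
  have key : ∃ k : ℤ, principalPart p (x + y) - principalPart p x - principalPart p y = k := by
    apply int_of_norm_le_one p
    · refine ⟨d * p ^ n * p ^ m - a * p ^ l * p ^ m - b * p ^ l * p ^ n, l + n + m, ?_⟩
      unfold principalPart
      rw [h1, h2, h3]
      push_cast
      field_simp
      ring
    · have e : ((principalPart p (x + y) - principalPart p x - principalPart p y : ℚ) : ℚ_[p])
          = (-(x + y - (principalPart p (x + y) : ℚ_[p]))) +
            ((x - (principalPart p x : ℚ_[p])) + (y - (principalPart p y : ℚ_[p]))) := by
        push_cast
        ring
      rw [e]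
      refine (Padic.nonarchimedean _ _).trans (max_le ?_
        ((Padic.nonarchimedean _ _).trans (max_le h1' h2')))
      rw [norm_neg]
      exact h3'
  obtain ⟨k, hk⟩ := key
  exact ⟨k, by linarith⟩

/-- The local component at `p` of the additive character `ψ` of `𝔸 / ℚ` whose archimedean component
is `x ↦ exp (2 π i x)`: it is `x ↦ exp (-2 π i r)`, where `r` is any element of
`ℤ[1/p]` with `x - r ∈ ℤ_p`. -/
def psi : AddChar ℚ_[p] ℂ where
  toFun x := Complex.exp (-(2 * Real.pi * Complex.I * (principalPart p x : ℂ)))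
  map_zero_eq_one' := by
    obtain ⟨k, hk⟩ := principalPart_add p 0 0
    rw [Complex.exp_eq_one_iff]
    refine ⟨k, ?_⟩
    have h0 : principalPart p 0 = -k := by
      rw [add_zero] at hk; linarith
    rw [h0]; push_cast; ring
  map_add_eq_mul' x y := by
    obtain ⟨k, hk⟩ := principalPart_add p x y
    rw [← Complex.exp_add, Complex.exp_eq_exp_iff_exists_int]
    refine ⟨-k, ?_⟩
    rw [hk]; push_cast; ring

end AddCharacter

/-! ### The local quadratic algebra `F_p = F ⊗ ℚ_p` -/

section LocalAlgebra

/-- The prime `p` ramifies in the number field `F`: the ideal `p 𝓞_F` is divisible by the square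
of a prime ideal. -/
def IsRamifiedIn (p : ℕ) (F : Type*) [Field F] [NumberField F] : Prop :=
  ∃ P : Ideal (𝓞 F), P.IsPrime ∧ P ^ 2 ∣ Ideal.span {(p : 𝓞 F)}

variable (p : ℕ) [Fact p.Prime] (F : Type*) [Field F] [NumberField F]

/-- The `ℚ_p`-algebra `F_p = ℚ_p ⊗ F`. -/
def LocAlg : Type _ := ℚ_[p] ⊗[ℚ] F

instance : CommRing (LocAlg p F) := inferInstanceAs (CommRing (ℚ_[p] ⊗[ℚ] F))

instance : Algebra ℚ_[p] (LocAlg p F) := inferInstanceAs (Algebra ℚ_[p] (ℚ_[p] ⊗[ℚ] F))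

instance : Module.Finite ℚ_[p] (LocAlg p F) :=
  inferInstanceAs (Module.Finite ℚ_[p] (ℚ_[p] ⊗[ℚ] F))

/-- The topology of a finite-dimensional `ℚ_p`-vector space. -/
instance : TopologicalSpace (LocAlg p F) := moduleTopology ℚ_[p] (LocAlg p F)

instance : IsModuleTopology ℚ_[p] (LocAlg p F) := ⟨rfl⟩

instance : IsTopologicalRing (LocAlg p F) := IsModuleTopology.isTopologicalRing ℚ_[p] _

/-- The embedding of `F` in `F_p`. -/
def ofGlobal : F →+* LocAlg p F :=
  (Algebra.TensorProduct.includeRight : F →ₐ[ℚ] ℚ_[p] ⊗[ℚ] F).toRingHom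

variable {F}

/-- The automorphism of `F_p` over `ℚ_p` which extends the automorphism `c` of `F`. -/
def galConj (c : F ≃ₐ[ℚ] F) : LocAlg p F ≃ₐ[ℚ_[p]] LocAlg p F :=
  (Algebra.TensorProduct.congr AlgEquiv.refl c : ℚ_[p] ⊗[ℚ] F ≃ₐ[ℚ_[p]] ℚ_[p] ⊗[ℚ] F)

variable (F)

/-- The order `𝒪 = 𝓞_F ⊗ ℤ_p` of `F_p`, the set of `ℤ_p`-linear combinations of elements
of `𝓞_F`. -/
def localOrder : Subring (LocAlg p F) :=
  Subring.closure
    (Set.range (fun a : ℤ_[p] => algebraMap ℚ_[p] (LocAlg p F) (a : ℚ_[p])) ∪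
      Set.range (fun x : 𝓞 F => ofGlobal p F (x : F)))

/-- `ϖ` is a uniformizer of `F_p`: it lies in `𝒪`, and the elements of `𝒪` which are not units of
`𝒪` are exactly the multiples of `ϖ` in `𝒪`. -/
def IsUniformizer (ϖ : (LocAlg p F)ˣ) : Prop :=
  (ϖ : LocAlg p F) ∈ localOrder p F ∧
    ∀ x : localOrder p F, ¬ IsUnit x ↔
      ∃ y : localOrder p F, (x : LocAlg p F) = (ϖ : LocAlg p F) * (y : LocAlg p F)

/-- The norm homomorphism `F_pˣ → ℚ_pˣ`. -/
def normUnits : (LocAlg p F)ˣ →* ℚ_[p]ˣ := Units.map (Algebra.norm ℚ_[p])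

variable {F}

/-- The normalized absolute value of `F_p`. -/
def absLoc (x : LocAlg p F) : ℝ := ‖Algebra.norm ℚ_[p] x‖

theorem exists_neg (c : F ≃ₐ[ℚ] F) (hc : c ≠ 1) (hF : Module.finrank ℚ F = 2) :
    ∃ y : F, y ≠ 0 ∧ c y = -y := by
  have hcc : ∀ x, c (c x) = x := by
    have : Algebra.IsQuadraticExtension ℚ F := ⟨hF⟩
    have h1 : Nat.card (F ≃ₐ[ℚ] F) = 2 := by
      rw [IsGalois.card_aut_eq_finrank, hF]
    have h2 : c ^ 2 = 1 := by
      rw [← h1]; exact pow_card_eq_one'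
    intro x
    have := DFunLike.congr_fun h2 x
    simpa [pow_two] using this
  obtain ⟨x, hx⟩ : ∃ x, c x ≠ x := by
    by_contra! h
    exact hc (AlgEquiv.ext h)
  refine ⟨x - c x, sub_ne_zero.mpr (Ne.symm hx), ?_⟩
  rw [map_sub, hcc]; ring

/-- The norm from `F_p` to `ℚ_p` is `z ↦ z z^c`. -/
theorem algebraMap_norm (c : F ≃ₐ[ℚ] F) (hc : c ≠ 1) (hF : Module.finrank ℚ F = 2)
    (z : LocAlg p F) :
    algebraMap ℚ_[p] (LocAlg p F) (Algebra.norm ℚ_[p] z) = z * galConj p c z := by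
  obtain ⟨y, hy, hcy⟩ := exists_neg c hc hF
  obtain ⟨d, hd⟩ : ∃ d : ℚ, y * y = algebraMap ℚ F d := by
    have : Algebra.IsQuadraticExtension ℚ F := ⟨hF⟩
    have h1 : Nat.card (F ≃ₐ[ℚ] F) = 2 := by
      rw [IsGalois.card_aut_eq_finrank, hF]
    have : y * y ∈ (⊥ : IntermediateField ℚ F) := by
      rw [IsGalois.mem_bot_iff_fixed]
      intro f
      rw [Nat.card_eq_two_iff' (1 : F ≃ₐ[ℚ] F)] at h1
      obtain ⟨g, -, hg⟩ := h1
      by_cases hf : f = 1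
      · simp [hf]
      · have : f = c := (hg f hf).trans (hg c hc).symm
        simp [this, hcy]
    obtain ⟨d, hd⟩ := IntermediateField.mem_bot.mp this
    exact ⟨d, hd.symm⟩
  have hli : LinearIndependent ℚ ![(1 : F), y] := by
    rw [LinearIndependent.pair_iff]
    intro s t h
    rw [Algebra.smul_def, Algebra.smul_def, mul_one] at h
    have h' := congrArg c h
    rw [map_add, map_mul, AlgEquiv.commutes, AlgEquiv.commutes, hcy, map_zero] at h'
    have hs : s = 0 := by
      have : (2 : F) * algebraMap ℚ F s = 0 := by linear_combination h + h'
      simpa using this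
    subst hs
    simpa [hy] using h
  let b : Module.Basis (Fin 2) ℚ F := basisOfLinearIndependentOfCardEqFinrank hli (by simp [hF])
  let B : Module.Basis (Fin 2) ℚ_[p] (LocAlg p F) :=
    (Algebra.TensorProduct.basis ℚ_[p] b : Module.Basis (Fin 2) ℚ_[p] (ℚ_[p] ⊗[ℚ] F))
  have hB0 : B 0 = 1 := by
    refine (Algebra.TensorProduct.basis_apply b 0).trans ?_
    simp [b]
    rfl
  have hB1 : B 1 = ofGlobal p F y := by
    refine (Algebra.TensorProduct.basis_apply b 1).trans ?_
    simp [b]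
    rfl
  have hBB : B 1 * B 1 = (d : ℚ_[p]) • B 0 := by
    rw [hB0, hB1, ← map_mul, hd, ← Algebra.algebraMap_eq_smul_one]
    change (1 : ℚ_[p]) ⊗ₜ[ℚ] (algebraMap ℚ F d) = (d : ℚ_[p]) ⊗ₜ[ℚ] (1 : F)
    rw [Algebra.algebraMap_eq_smul_one, ← TensorProduct.smul_tmul, Rat.smul_def, mul_one]
  have hc1 : galConj p c (B 1) = - B 1 := by
    rw [hB1]
    change (1 : ℚ_[p]) ⊗ₜ[ℚ] (c y) = -((1 : ℚ_[p]) ⊗ₜ[ℚ] y)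
    rw [hcy, TensorProduct.tmul_neg]
  obtain ⟨u, v, hz⟩ : ∃ u v : ℚ_[p], z = u • B 0 + v • B 1 := by
    refine ⟨B.repr z 0, B.repr z 1, ?_⟩
    conv_lhs => rw [← B.sum_repr z]
    rw [Fin.sum_univ_two]
  have e0 : z * B 0 = u • B 0 + v • B 1 := by rw [hB0, mul_one, ← hB0, hz]
  have e1 : z * B 1 = (v * d) • B 0 + u • B 1 := by
    rw [hz, add_mul, smul_mul_assoc, smul_mul_assoc, hBB, hB0, one_mul, ← hB0, smul_smul, add_comm]
  have hM : Algebra.norm ℚ_[p] z = u * u - (v * d) * v := by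
    rw [Algebra.norm_eq_matrix_det B, Matrix.det_fin_two]
    simp only [Algebra.leftMulMatrix_eq_repr_mul, e0, e1]
    simp
  rw [hM]
  have hcz : galConj p c z = u • B 0 - v • B 1 := by
    rw [hz, map_add, map_smul, map_smul, hc1, hB0, map_one, smul_neg, sub_eq_add_neg]
  rw [hcz, hz]
  have : (u • B 0 + v • B 1) * (u • B 0 - v • B 1)
      = (u * u) • (B 0 * B 0) - (v * v) • (B 1 * B 1) := by
    simp only [Algebra.smul_def, map_mul]
    ring
  rw [this, hBB, hB0, mul_one, smul_smul, ← sub_smul, ← Algebra.algebraMap_eq_smul_one]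
  congr 1
  ring

end LocalAlgebra

/-! ### The quadratic space `V` and the group `H⁰` over `ℚ_p` -/

section QuadraticSpace

variable (p : ℕ) [Fact p.Prime] {F : Type*} [Field F] [NumberField F]

/-- `V_p = {x ∈ M₂(F_p) | x^* = x^c}`, where `x^*` is the main involution (the adjugate). -/
def quadSpace (c : F ≃ₐ[ℚ] F) : Submodule ℚ_[p] (Matrix (Fin 2) (Fin 2) (LocAlg p F)) where
  carrier := {x | x.adjugate = x.map (galConj p c)}
  zero_mem' := by
    ext i j
    fin_cases i <;> fin_cases j <;> simp
  add_mem' {x y} hx hy := by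
    simp only [Set.mem_ofPred_eq, Matrix.adjugate_fin_two, ← Matrix.ext_iff, Fin.forall_fin_two,
      Matrix.map_apply, Matrix.add_apply, map_add, Matrix.of_apply, Matrix.cons_val_zero,
      Matrix.cons_val_one, Matrix.cons_val_fin_one] at hx hy ⊢
    obtain ⟨⟨h1, h2⟩, h3, h4⟩ := hx
    obtain ⟨⟨k1, k2⟩, k3, k4⟩ := hy
    rw [← h1, ← h2, ← h3, ← h4, ← k1, ← k2, ← k3, ← k4]
    refine ⟨⟨rfl, ?_⟩, ?_, rfl⟩ <;> ring
  smul_mem' r x hx := by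
    simp only [Set.mem_ofPred_eq, Matrix.adjugate_fin_two, ← Matrix.ext_iff, Fin.forall_fin_two,
      Matrix.map_apply, Matrix.smul_apply, map_smul, Matrix.of_apply, Matrix.cons_val_zero,
      Matrix.cons_val_one, Matrix.cons_val_fin_one] at hx ⊢
    obtain ⟨⟨h1, h2⟩, h3, h4⟩ := hx
    rw [← h1, ← h2, ← h3, ← h4]
    refine ⟨⟨rfl, ?_⟩, ?_, rfl⟩ <;> simp

instance (c : F ≃ₐ[ℚ] F) : MeasurableSpace (quadSpace p c) := borel _

instance (c : F ≃ₐ[ℚ] F) : BorelSpace (quadSpace p c) := ⟨rfl⟩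

/-- The quadratic form `n(x) = x x^* = det x` on `V_p`. Since `n(x)` lies in `ℚ_p`, it is half of
its trace from `F_p` to `ℚ_p`. -/
def quadForm (c : F ≃ₐ[ℚ] F) (x : quadSpace p c) : ℚ_[p] :=
  Algebra.trace ℚ_[p] (LocAlg p F) (x : Matrix (Fin 2) (Fin 2) (LocAlg p F)).det / 2

/-- The bilinear form `(x, y) = n(x + y) - n(x) - n(y)` on `V_p`. -/
def bilin (c : F ≃ₐ[ℚ] F) (x y : quadSpace p c) : ℚ_[p] :=
  quadForm p c (x + y) - quadForm p c x - quadForm p c y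

/-- The lattice `L_p = V_p ∩ M₂(𝒪)`. -/
def latticeL (c : F ≃ₐ[ℚ] F) : Set (quadSpace p c) :=
  {x | ∀ i j, (x : Matrix (Fin 2) (Fin 2) (LocAlg p F)) i j ∈ localOrder p F}

/-- The Fourier transform on `X_p = V_p ⊕ V_p` with respect to the measure `dx`, the bilinear form
`(x₁, y₁) + (x₂, y₂)` and the character `ψ_p`. -/
def fourier (c : F ≃ₐ[ℚ] F) (dx : MeasureTheory.Measure (quadSpace p c × quadSpace p c))
    (φ : quadSpace p c × quadSpace p c → ℂ) (x : quadSpace p c × quadSpace p c) : ℂ :=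
  ∫ y, φ y * psi p (bilin p c x.1 y.1 + bilin p c x.2 y.2) ∂dx

/-- A measure on `X_p` is self-dual if Fourier inversion holds for it on all
Bruhat–Schwartz functions. -/
def IsSelfDual (c : F ≃ₐ[ℚ] F)
    (dx : MeasureTheory.Measure (quadSpace p c × quadSpace p c)) : Prop :=
  ∀ φ : quadSpace p c × quadSpace p c → ℂ, IsLocallyConstant φ → HasCompactSupport φ →
    ∀ x, fourier p c dx (fourier p c dx φ) x = φ (-x)

/-- The Hermitian pairing `ℬ_ω` on Bruhat–Schwartz functions on `X_p`. -/
def pairingOmega (c : F ≃ₐ[ℚ] F) (dx : MeasureTheory.Measure (quadSpace p c × quadSpace p c))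
    (φ₁ φ₂ : quadSpace p c × quadSpace p c → ℂ) : ℂ :=
  ∫ x, φ₁ x * conj (φ₂ x) ∂dx

/-- The test function `φ^⋆`, the characteristic function of `L_p ⊕ L_p`. -/
def phiStar (c : F ≃ₐ[ℚ] F) : quadSpace p c × quadSpace p c → ℂ :=
  (latticeL p c ×ˢ latticeL p c).indicator 1

variable (F)

/-- The embedding `z ↦ (z, N(z))` of `F_pˣ` in `GL₂(F_p) × ℚ_pˣ`. -/
def centralEmb : (LocAlg p F)ˣ →* GL (Fin 2) (LocAlg p F) × ℚ_[p]ˣ :=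
  (Units.map (Matrix.scalar (Fin 2) :
    LocAlg p F →+* Matrix (Fin 2) (Fin 2) (LocAlg p F)).toMonoidHom).prod (normUnits p F)

instance : (centralEmb p F).range.Normal where
  conj_mem := by
    rintro _ ⟨z, rfl⟩ ⟨a, α⟩
    refine ⟨z, ?_⟩
    ext1
    · apply Units.ext
      change Matrix.scalar (Fin 2) (z : LocAlg p F) =
        (a : Matrix (Fin 2) (Fin 2) (LocAlg p F)) * Matrix.scalar (Fin 2) (z : LocAlg p F) *
          ((a⁻¹ : GL (Fin 2) (LocAlg p F)) : Matrix (Fin 2) (Fin 2) (LocAlg p F))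
      rw [(Matrix.scalar_commute (z : LocAlg p F) (fun r => Commute.all _ r) _).symm.eq, mul_assoc,
        ← Units.val_mul, mul_inv_cancel, Units.val_one, mul_one]
    · change normUnits p F z = α * normUnits p F z * α⁻¹
      rw [mul_comm α, mul_inv_cancel_right]

/-- `H⁰(ℚ_p) = (GL₂(F_p) × ℚ_pˣ) / F_pˣ`. -/
abbrev H0 : Type _ := (GL (Fin 2) (LocAlg p F) × ℚ_[p]ˣ) ⧸ (centralEmb p F).range

/-- The similitude character `(a, α) ↦ α⁻² N(det a)` of `H⁰(ℚ_p)`. -/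
def similitude : H0 p F →* ℚ_[p]ˣ :=
  QuotientGroup.lift (centralEmb p F).range
    { toFun := fun h => (h.2 ^ 2)⁻¹ * normUnits p F (Matrix.GeneralLinearGroup.det h.1)
      map_one' := by simp
      map_mul' := fun g h => by
        simp only [Prod.fst_mul, Prod.snd_mul, map_mul, mul_pow, mul_inv]
        exact mul_mul_mul_comm _ _ _ _ }
    (by
      rintro _ ⟨z, rfl⟩
      have h : Matrix.GeneralLinearGroup.det ((centralEmb p F z).1) = z ^ 2 := by
        apply Units.ext
        change (Matrix.scalar (Fin 2) (z : LocAlg p F)).det = ((z ^ 2 : (LocAlg p F)ˣ) : LocAlg p F)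
        simp
      rw [MonoidHom.mem_ker]
      change (normUnits p F z ^ 2)⁻¹ * normUnits p F
        (Matrix.GeneralLinearGroup.det ((centralEmb p F z).1)) = 1
      rw [h, map_pow, inv_mul_cancel])

/-- `H⁰₁(ℚ_p)`, the kernel of the similitude character. -/
def H01 : Subgroup (H0 p F) := (similitude p F).ker

instance : MeasurableSpace (H01 p F) := borel _

instance : BorelSpace (H01 p F) := ⟨rfl⟩

variable {F}

/-- `r` lies in `GL₂(𝒪)`. -/
def IsIntegralGL (r : GL (Fin 2) (LocAlg p F)) : Prop :=
  (∀ i j, (r : Matrix (Fin 2) (Fin 2) (LocAlg p F)) i j ∈ localOrder p F) ∧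
    ∀ i j, ((r⁻¹ : GL (Fin 2) (LocAlg p F)) : Matrix (Fin 2) (Fin 2) (LocAlg p F)) i j
      ∈ localOrder p F

variable (F)

/-- `𝒰_p`, the intersection of `H⁰₁(ℚ_p)` with the image of `GL₂(𝒪) × ℤ_pˣ` in `H⁰(ℚ_p)`. -/
def openCompact : Set (H01 p F) :=
  {h | ∃ (r : GL (Fin 2) (LocAlg p F)) (β : ℚ_[p]ˣ), IsIntegralGL p r ∧ ‖(β : ℚ_[p])‖ = 1 ∧
    (h : H0 p F) = QuotientGroup.mk (r, β)}

variable {F}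

/-- The linear map `x ↦ α⁻¹ a x (a^c)^*` of `M₂(F_p)`. -/
def rhoMat (c : F ≃ₐ[ℚ] F) (h : GL (Fin 2) (LocAlg p F) × ℚ_[p]ˣ) :
    Matrix (Fin 2) (Fin 2) (LocAlg p F) →ₗ[ℚ_[p]] Matrix (Fin 2) (Fin 2) (LocAlg p F) where
  toFun x := ((h.2⁻¹ : ℚ_[p]ˣ) : ℚ_[p]) • ((h.1 : Matrix (Fin 2) (Fin 2) (LocAlg p F)) * x *
    ((h.1 : Matrix (Fin 2) (Fin 2) (LocAlg p F)).map (galConj p c)).adjugate)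
  map_add' x y := by rw [mul_add, add_mul, smul_add]
  map_smul' r x := by
    rw [Matrix.mul_smul, Matrix.smul_mul, smul_comm]
    rfl

theorem galConj_galConj (c : F ≃ₐ[ℚ] F) (hF : Module.finrank ℚ F = 2) (z : LocAlg p F) :
    galConj p c (galConj p c z) = z := by
  have hcc : c * c = 1 := by
    have : Algebra.IsQuadraticExtension ℚ F := ⟨hF⟩
    have h1 : Nat.card (F ≃ₐ[ℚ] F) = 2 := by
      rw [IsGalois.card_aut_eq_finrank, hF]
    rw [← pow_two, ← h1]
    exact pow_card_eq_one'
  have h2 : ∀ w : ℚ_[p] ⊗[ℚ] F, galConj p c (galConj p c (w : LocAlg p F)) = (w : LocAlg p F) := by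
    intro w
    refine TensorProduct.induction_on w ?_ (fun a y => ?_) (fun x y hx hy => ?_)
    · exact ((galConj p c).trans (galConj p c)).map_zero
    · change a ⊗ₜ[ℚ] (c * c) y = a ⊗ₜ[ℚ] y
      rw [hcc]
      rfl
    · refine (((galConj p c).trans (galConj p c)).map_add x y).trans ?_
      exact congrArg₂ (· + ·) hx hy
  exact h2 z

theorem rhoMat_mem (c : F ≃ₐ[ℚ] F) (hF : Module.finrank ℚ F = 2)
    (h : GL (Fin 2) (LocAlg p F) × ℚ_[p]ˣ)
    (x : Matrix (Fin 2) (Fin 2) (LocAlg p F)) (hx : x ∈ quadSpace p c) :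
    rhoMat p c h x ∈ quadSpace p c := by
  apply (quadSpace p c).smul_mem
  have hx' : x.adjugate = x.map (galConj p c) := hx
  change Matrix.adjugate _ = Matrix.map _ _
  have hadj : ∀ M : Matrix (Fin 2) (Fin 2) (LocAlg p F), M.adjugate.adjugate = M := fun M => by
    ext i j
    fin_cases i <;> fin_cases j <;> simp [Matrix.adjugate_fin_two]
  have hmap : ∀ M : Matrix (Fin 2) (Fin 2) (LocAlg p F),
      M.adjugate.map (galConj p c) = (M.map (galConj p c)).adjugate := fun M => by
    ext i j
    fin_cases i <;> fin_cases j <;> simp [Matrix.adjugate_fin_two]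
  have hcc : ∀ M : Matrix (Fin 2) (Fin 2) (LocAlg p F),
      (M.map (galConj p c)).map (galConj p c) = M := fun M => by
    ext i j
    exact galConj_galConj p c hF _
  rw [Matrix.adjugate_mul_distrib, Matrix.adjugate_mul_distrib, hadj, hx', Matrix.map_mul,
    Matrix.map_mul, hmap, hcc, mul_assoc]

/-- The action `ϱ` of `H⁰(ℚ_p)` on `V_p`, given by `ϱ(a, α) x = α⁻¹ a x (a^c)^*`. -/
def rho (c : F ≃ₐ[ℚ] F) (hc : c ≠ 1) (hF : Module.finrank ℚ F = 2) :
    H0 p F →* Module.End ℚ_[p] (quadSpace p c) :=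
  QuotientGroup.lift (centralEmb p F).range
    { toFun := fun h => (rhoMat p c h).restrict (rhoMat_mem p c hF h)
      map_one' := by
        ext1 x
        apply Subtype.ext
        change ((1 : ℚ_[p]ˣ)⁻¹ : ℚ_[p]ˣ).val • ((1 : Matrix (Fin 2) (Fin 2) (LocAlg p F)) * x.1 *
          ((1 : Matrix (Fin 2) (Fin 2) (LocAlg p F)).map (galConj p c)).adjugate) = x.1
        rw [Matrix.map_one _ (map_zero _) (map_one _), Matrix.adjugate_one]
        simp
      map_mul' := fun g h => by
        ext1 x
        apply Subtype.ext
        change ((g.2 * h.2)⁻¹ : ℚ_[p]ˣ).val • ((g.1.val * h.1.val) * x.1 *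
          ((g.1.val * h.1.val).map (galConj p c)).adjugate) =
          (g.2⁻¹ : ℚ_[p]ˣ).val • (g.1.val * ((h.2⁻¹ : ℚ_[p]ˣ).val • (h.1.val * x.1 *
            (h.1.val.map (galConj p c)).adjugate)) * (g.1.val.map (galConj p c)).adjugate)
        rw [Matrix.map_mul, Matrix.adjugate_mul_distrib, mul_inv, Units.val_mul, Matrix.mul_smul,
          Matrix.smul_mul, smul_smul]
        simp only [mul_assoc] }
    (by
      rintro _ ⟨z, rfl⟩
      rw [MonoidHom.mem_ker]
      ext1 x
      apply Subtype.ext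
      change ((normUnits p F z)⁻¹ : ℚ_[p]ˣ).val • (Matrix.scalar (Fin 2) (z : LocAlg p F) * x.1 *
          ((Matrix.scalar (Fin 2) (z : LocAlg p F)).map (galConj p c)).adjugate) = x.1
      have h1 : ((Matrix.scalar (Fin 2) (z : LocAlg p F)).map (galConj p c)).adjugate
          = Matrix.scalar (Fin 2) (galConj p c z) := by
        ext i j
        fin_cases i <;> fin_cases j <;> simp
      have h2 : Matrix.scalar (Fin 2) (z : LocAlg p F) * x.1 *
          Matrix.scalar (Fin 2) (galConj p c z) =
          ((normUnits p F z : ℚ_[p]ˣ) : ℚ_[p]) • x.1 := by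
        ext i j
        change _ = ((Algebra.norm ℚ_[p] (z : LocAlg p F)) : ℚ_[p]) • x.1 i j
        rw [Algebra.smul_def, algebraMap_norm p c hc hF]
        simp
        ring
      rw [h1, h2, smul_smul, Units.inv_mul, one_smul])

/-- The Weil representation restricted to `H⁰₁(ℚ_p)`: `(ω(h) φ)(x) = φ(h⁻¹ x)`. -/
def weilAction (c : F ≃ₐ[ℚ] F) (hc : c ≠ 1) (hF : Module.finrank ℚ F = 2) (h : H01 p F)
    (φ : quadSpace p c × quadSpace p c → ℂ) : quadSpace p c × quadSpace p c → ℂ :=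
  fun x => φ (rho p c hc hF (h⁻¹ : H01 p F) x.1, rho p c hc hF (h⁻¹ : H01 p F) x.2)

end QuadraticSpace

/-! ### Representations of `GL₂(F_p)` -/

section Representations

variable (p : ℕ) [Fact p.Prime] {F : Type*} [Field F] [NumberField F]

/-- The upper triangular matrix with diagonal `(a, d)` and upper right entry `x`. -/
def upper (a d : (LocAlg p F)ˣ) (x : LocAlg p F) : GL (Fin 2) (LocAlg p F) where
  val := !![(a : LocAlg p F), x; 0, (d : LocAlg p F)]
  inv := !![((a⁻¹ : (LocAlg p F)ˣ) : LocAlg p F),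
    -(((a⁻¹ : (LocAlg p F)ˣ) : LocAlg p F) * x * ((d⁻¹ : (LocAlg p F)ˣ) : LocAlg p F));
    0, ((d⁻¹ : (LocAlg p F)ˣ) : LocAlg p F)]
  val_inv := by
    rw [Matrix.mul_fin_two, Matrix.one_fin_two]
    simp [← mul_assoc]
  inv_val := by
    rw [Matrix.mul_fin_two, Matrix.one_fin_two]
    simp [mul_assoc]

/-- A character of `F_pˣ` is unramified if it is trivial on `𝒪ˣ`. -/
def IsUnramified (μ : (LocAlg p F)ˣ →* ℂˣ) : Prop :=
  ∀ u : (LocAlg p F)ˣ, (u : LocAlg p F) ∈ localOrder p F →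
    ((u⁻¹ : (LocAlg p F)ˣ) : LocAlg p F) ∈ localOrder p F → μ u = 1

/-- The space of the normalized induced representation `π(μ, ν)`: the functions `φ` on `GL₂(F_p)`
which are right invariant under an open subgroup and satisfy
`φ((a x; 0 d) g) = μ(a) ν(d) |a / d|^{1/2} φ(g)`. -/
def principalSeriesSpace (μ ν : (LocAlg p F)ˣ →* ℂˣ) :
    Submodule ℂ (GL (Fin 2) (LocAlg p F) → ℂ) where
  carrier := {φ | (∀ (a d : (LocAlg p F)ˣ) (x : LocAlg p F) (g : GL (Fin 2) (LocAlg p F)),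
      φ (upper p a d x * g) = (μ a : ℂ) * (ν d : ℂ) *
        (Real.sqrt (absLoc p (a : LocAlg p F) / absLoc p (d : LocAlg p F)) : ℂ) * φ g) ∧
    ∃ U : Subgroup (GL (Fin 2) (LocAlg p F)), IsOpen (U : Set (GL (Fin 2) (LocAlg p F))) ∧
      ∀ u ∈ U, ∀ g, φ (g * u) = φ g}
  zero_mem' := ⟨fun a d x g => by simp, ⊤, isOpen_univ, fun u _ g => rfl⟩
  add_mem' := by
    rintro φ φ' ⟨h1, U, hU, h2⟩ ⟨h1', U', hU', h2'⟩
    refine ⟨fun a d x g => ?_, U ⊓ U', hU.inter hU', fun u hu g => ?_⟩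
    · rw [Pi.add_apply, Pi.add_apply, h1, h1', mul_add]
    · rw [Pi.add_apply, Pi.add_apply, h2 u hu.1, h2' u hu.2]
  smul_mem' := by
    rintro r φ ⟨h1, U, hU, h2⟩
    refine ⟨fun a d x g => ?_, U, hU, fun u hu g => ?_⟩
    · rw [Pi.smul_apply, Pi.smul_apply, h1, smul_eq_mul, smul_eq_mul, mul_left_comm]
    · rw [Pi.smul_apply, Pi.smul_apply, h2 u hu]

/-- The representation `π(μ, ν)` of `GL₂(F_p)`, acting by right translation. -/
def principalSeries (μ ν : (LocAlg p F)ˣ →* ℂˣ) :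
    Representation ℂ (GL (Fin 2) (LocAlg p F)) (principalSeriesSpace p μ ν) where
  toFun k :=
    { toFun := fun φ => ⟨fun g => φ.1 (g * k), by
        obtain ⟨h1, U, hU, h2⟩ := φ.2
        refine ⟨fun a d x g => ?_, U.comap (MulAut.conj k⁻¹).toMonoidHom, ?_, fun u hu g => ?_⟩
        · change φ.1 (upper p a d x * g * k) = _ * φ.1 (g * k)
          rw [mul_assoc, h1]
        · refine hU.preimage ?_
          change Continuous fun g => k⁻¹ * g * (k⁻¹)⁻¹
          fun_prop
        · have := h2 (k⁻¹ * u * (k⁻¹)⁻¹) hu (g * k)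
          change φ.1 (g * u * k) = φ.1 (g * k)
          rw [← this]
          group⟩
      map_add' := fun _ _ => rfl
      map_smul' := fun _ _ => rfl }
  map_one' := by
    ext φ g
    change φ.1 (g * 1) = φ.1 g
    rw [mul_one]
  map_mul' k l := by
    ext φ g
    change φ.1 (g * (k * l)) = φ.1 (g * k * l)
    rw [mul_assoc]

/-- `μ ν⁻¹ ≠ |·|` and `μ ν⁻¹ ≠ |·|⁻¹`. -/
def IsRegularPair (μ ν : (LocAlg p F)ˣ →* ℂˣ) : Prop :=
  (¬ ∀ z : (LocAlg p F)ˣ, (μ z : ℂ) / (ν z : ℂ) = (absLoc p (z : LocAlg p F) : ℂ)) ∧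
    ¬ ∀ z : (LocAlg p F)ˣ, (μ z : ℂ) / (ν z : ℂ) = ((absLoc p (z : LocAlg p F))⁻¹ : ℂ)

variable {V : Type*} [AddCommGroup V] [Module ℂ V]

/-- `π` is trivial on the center of `GL₂(F_p)`, i.e. it is a representation of `PGL₂(F_p)`. -/
def TrivialCentralChar (π : Representation ℂ (GL (Fin 2) (LocAlg p F)) V) : Prop :=
  ∀ z : (LocAlg p F)ˣ, π (centralEmb p F z).1 = 1

/-- `π` is unitary: there is an invariant positive definite Hermitian form on its space. -/
def IsUnitary (π : Representation ℂ (GL (Fin 2) (LocAlg p F)) V) : Prop :=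
  ∃ B : V →ₗ[ℂ] V →ₗ⋆[ℂ] ℂ, (∀ g v w, B (π g v) (π g w) = B v w) ∧
    (∀ v w, conj (B v w) = B w v) ∧ ∀ v, v ≠ 0 → 0 < (B v v).re

/-- The representation `σ = π ⊠ 1` of `H⁰(ℚ_p)`. -/
def sigma (π : Representation ℂ (GL (Fin 2) (LocAlg p F)) V) (hπ : TrivialCentralChar p π) :
    H0 p F →* Module.End ℂ V :=
  QuotientGroup.lift (centralEmb p F).range
    ((π : GL (Fin 2) (LocAlg p F) →* (V →ₗ[ℂ] V)).comp (MonoidHom.fst _ _))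
    (by
      rintro _ ⟨z, rfl⟩
      exact hπ z)

end Representations

/-! ### Local zeta integral and local `L`-factors -/

section Zeta

variable (p : ℕ) [Fact p.Prime] {F : Type*} [Field F] [NumberField F]

/-- The integrand `h ↦ ℬ_ω(ω(h) φ^⋆, φ^⋆) ℬ_σ(σ(h) f, f)` of the local zeta integral. -/
def zetaIntegrand (c : F ≃ₐ[ℚ] F) (hc : c ≠ 1) (hF : Module.finrank ℚ F = 2)
    (dx : MeasureTheory.Measure (quadSpace p c × quadSpace p c))
    {V : Type*} [AddCommGroup V] [Module ℂ V]
    (π : Representation ℂ (GL (Fin 2) (LocAlg p F)) V) (hπ : TrivialCentralChar p π)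
    (B : V →ₗ[ℂ] V →ₗ⋆[ℂ] ℂ) (f : V) (h : H01 p F) : ℂ :=
  pairingOmega p c dx (weilAction p c hc hF h (phiStar p c)) (phiStar p c) *
    B (sigma p π hπ (h : H0 p F) f) f

/-- `ζ_p(s) = (1 - p^{-s})⁻¹`. -/
def zetaP (s : ℂ) : ℂ := (1 - (p : ℂ) ^ (-s))⁻¹

/-- The element `p` of `F_pˣ`. -/
def pUnit : (LocAlg p F)ˣ :=
  Units.map (algebraMap ℚ_[p] (LocAlg p F)).toMonoidHom
    (Units.mk0 (p : ℚ_[p]) (by exact_mod_cast (Fact.out : p.Prime).ne_zero))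

/-- The Hecke `L`-factor `L(s, μ|_{ℚ_pˣ}) = (1 - μ(p) p^{-s})⁻¹` of the restriction to `ℚ_pˣ` of an
unramified character `μ` of `F_pˣ`. -/
def heckeLQ (μ : (LocAlg p F)ˣ →* ℂˣ) (s : ℂ) : ℂ :=
  (1 - (μ (pUnit p) : ℂ) * (p : ℂ) ^ (-s))⁻¹

/-- The Hecke `L`-factor `L(s, χ) = (1 - χ(ϖ) |ϖ|^s)⁻¹` of an unramified character `χ` of `F_pˣ`,
where `ϖ` is a uniformizer of the field `F_p`. -/
def heckeLF (ϖ : (LocAlg p F)ˣ) (χ : (LocAlg p F)ˣ →* ℂˣ) (s : ℂ) : ℂ :=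
  (1 - (χ ϖ : ℂ) * (absLoc p (ϖ : LocAlg p F) : ℂ) ^ s)⁻¹

/-- The Asai `L`-factor `L(s, As⁺(π)) = L(s, μ|_{ℚ_pˣ}) L(s, μν) L(s, ν|_{ℚ_pˣ})` of an unramified
principal series `π = π(μ, ν)` of `GL₂(F_p)`, for `p` non-split in `F`. -/
def asaiL (ϖ : (LocAlg p F)ˣ) (μ ν : (LocAlg p F)ˣ →* ℂˣ) (s : ℂ) : ℂ :=
  heckeLQ p μ s * heckeLF p ϖ (μ * ν) s * heckeLQ p ν s

end Zeta

end RamifiedZeta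

end

/-!
The group `H⁰₁(ℚ_p)` is the disjoint union of the double cosets `U τ_n U`, for `n ≥ 0`, where `U`
is the group of integral points and `τ_n` is the class of `(diag(1, θ^{2n}), N(θ)^n)` for a
uniformizer `θ`. Both factors of the integrand are constant on each double coset, so the zeta
integral is a series over `n`.

*The Weil factor.* Its value at `h` is the volume of the square of the lattice `L ∩ h L`. For
`h = τ_n` this lattice has index `p^n` in `L = L_p`, so the value is `p^{-2n}` times the volume of
`L ⊕ L` (`EisensteinGenerator.pairingOmega_eq`). That volume is the inverse of the index of `L` in
its dual, which follows from Fourier inversion for the characteristic function of `L ⊕ L` at the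
origin. If `1, δ` is an orthogonal basis of `𝒪` with `δ² = D`, then `‖4 D‖ = ‖Δ_F‖` and the index
is `‖4 D³‖⁻¹ = ‖2⁻⁴ Δ_F³‖⁻¹` (`EisensteinGenerator.measureReal_latticeL`). Such a basis exists
also for `p = 2`, because `𝒪` is generated by a root `θ` of an Eisenstein polynomial
`X² - t X + n`, and `δ = θ - t / 2`.

*The spherical factor.* The union of the first `n + 1` double cosets consists of the classes
`(a, α)` with `a` integral and `α` of valuation `n`. It is a finite disjoint union of left cosets
of `U`, represented by the upper triangular matrices which define the Hecke operator of degree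
`2 n`. Hence the integral of the matrix coefficient over this union is `vol(U)` times the Hecke
eigenvalue `Λ_{2n}` of the spherical vector (`EisensteinGenerator.setIntegral_heckeBall`). The
eigenvalue is read off from the transformation law of the functions in the principal series, since
spherical vectors are unique up to scalars by the Iwasawa decomposition (`hecke_eigenvector`).

*The series.* With `α = μ(θ)`, `β = ν(θ)` and `X = p⁻¹`, the central character gives `α β = 1`, and
`∑ X^{2n} (Λ_{2n} - Λ_{2n-2})` is `(1 - X²) (1 + X) / ((1 - α² X) (1 - β² X))`
(`hasSum_heckeEigenvalue`), which is the claimed quotient of `L`-factors: the factor `L(1, μν)`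
cancels against `ζ_p(1)`. Absolute convergence is equivalent to `|α|, |β| < √p`. Unitarity makes the
Hecke operator of degree one self-adjoint with eigenvalue at most its number `p + 1` of cosets, which
gives `|α|, |β| ≤ √p`, and the hypothesis `μ ν⁻¹ ≠ |·|^{±1}` excludes equality (`norm_satake_lt`).
-/

open scoped TensorProduct ComplexConjugate NumberField MatrixGroups

noncomputable section

namespace RamifiedZeta

/-! ### The global quadratic field -/

section Global

variable {F : Type*} [Field F] [NumberField F]

theorem aut_eq_one_or (c : F ≃ₐ[ℚ] F) (hc : c ≠ 1) (hF : Module.finrank ℚ F = 2)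
    (g : F ≃ₐ[ℚ] F) : g = 1 ∨ g = c := by
  have : Algebra.IsQuadraticExtension ℚ F := ⟨hF⟩
  have h1 : Nat.card (F ≃ₐ[ℚ] F) = 2 := by rw [IsGalois.card_aut_eq_finrank, hF]
  rw [Nat.card_eq_two_iff' (1 : F ≃ₐ[ℚ] F)] at h1
  obtain ⟨g', -, hg⟩ := h1
  by_cases h : g = 1
  · exact Or.inl h
  · exact Or.inr ((hg g h).trans (hg c hc).symm)

theorem conj_conj (c : F ≃ₐ[ℚ] F) (hc : c ≠ 1) (hF : Module.finrank ℚ F = 2) (x : F) :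
    c (c x) = x := by
  have h := aut_eq_one_or c hc hF (c * c)
  rcases h with h | h
  · exact DFunLike.congr_fun h x
  · exact absurd (mul_eq_left.mp h) hc

theorem exists_int_of_fixed (c : F ≃ₐ[ℚ] F) (hc : c ≠ 1) (hF : Module.finrank ℚ F = 2)
    {x : F} (hx : IsIntegral ℤ x) (hcx : c x = x) : ∃ m : ℤ, x = m := by
  have : Algebra.IsQuadraticExtension ℚ F := ⟨hF⟩
  have hbot : x ∈ (⊥ : IntermediateField ℚ F) := by
    rw [IsGalois.mem_bot_iff_fixed]
    intro g
    rcases aut_eq_one_or c hc hF g with rfl | rfl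
    · rfl
    · exact hcx
  obtain ⟨r, rfl⟩ := IntermediateField.mem_bot.mp hbot
  have hr : IsIntegral ℤ r := (isIntegral_algebraMap_iff (algebraMap ℚ F).injective).mp hx
  obtain ⟨m, rfl⟩ := IsIntegrallyClosed.isIntegral_iff.mp hr
  exact ⟨m, by simp⟩

/-- An integer `z` of a quadratic field is a root of `X² - t X + n`, where `t` and `n` are its trace
and norm. -/
theorem exists_trace_norm (c : F ≃ₐ[ℚ] F) (hc : c ≠ 1) (hF : Module.finrank ℚ F = 2)
    (z : 𝓞 F) : ∃ t n : ℤ, c (z : F) = t - z ∧ z * z = (t : 𝓞 F) * z - (n : 𝓞 F) := by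
  have hz : IsIntegral ℤ (z : F) := z.isIntegral_coe
  have hcz : IsIntegral ℤ (c (z : F)) := hz.map (c.toAlgHom.restrictScalars ℤ)
  obtain ⟨t, ht⟩ := exists_int_of_fixed c hc hF (hz.add hcz)
    (by rw [map_add, conj_conj c hc hF, add_comm])
  obtain ⟨n, hn⟩ := exists_int_of_fixed c hc hF (hz.mul hcz)
    (by rw [map_mul, conj_conj c hc hF, mul_comm])
  refine ⟨t, n, by rw [← ht]; ring, ?_⟩
  apply NumberField.RingOfIntegers.ext
  change algebraMap (𝓞 F) F _ = algebraMap (𝓞 F) F _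
  rw [map_mul, map_sub, map_mul, map_intCast, map_intCast, ← ht, ← hn]
  ring

/-- In a ramified quadratic field the prime above `p` contains an element `θ` which is a root of an
Eisenstein polynomial `X² - t X + n`, and whose powers span an order of index `k` prime to `p`. -/
theorem exists_eisenstein (p : ℕ) [hp : Fact p.Prime] (c : F ≃ₐ[ℚ] F) (hc : c ≠ 1)
    (hF : Module.finrank ℚ F = 2) (hram : IsRamifiedIn p F) :
    ∃ (θ : 𝓞 F) (t n k : ℤ), c (θ : F) = t - θ ∧ θ * θ = (t : 𝓞 F) * θ - (n : 𝓞 F) ∧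
      (p : ℤ) ∣ t ∧ (p : ℤ) ∣ n ∧ ¬ (p : ℤ) ^ 2 ∣ n ∧ ¬ (p : ℤ) ∣ k ∧
      k ^ 2 * NumberField.discr F = t ^ 2 - 4 * n ∧
      ∀ x : 𝓞 F, ∃ a b : ℤ, (k : 𝓞 F) * x = a + b * θ := by
  obtain ⟨P, hP, hdvd⟩ := hram
  have hp0 : (p : 𝓞 F) ≠ 0 := by exact_mod_cast hp.out.ne_zero
  have hpP2 : (p : 𝓞 F) ∈ P ^ 2 := by
    rw [Ideal.dvd_span_singleton] at hdvd; exact hdvd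
  have hpP : (p : 𝓞 F) ∈ P := Ideal.pow_le_self two_ne_zero hpP2
  have hPbot : P ≠ ⊥ := by
    rintro rfl
    exact hp0 (by simpa using hpP)
  have hPint : ∀ m : ℤ, (m : 𝓞 F) ∈ P → (p : ℤ) ∣ m := by
    intro m hm
    by_contra h
    have hcop : IsCoprime (p : ℤ) m := (Nat.prime_iff_prime_int.mp hp.out).coprime_iff_not_dvd.mpr h
    obtain ⟨a, b, hab⟩ := hcop
    apply hP.ne_top
    rw [Ideal.eq_top_iff_one]
    have : (1 : 𝓞 F) = a * p + b * m := by exact_mod_cast hab.symm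
    rw [this]
    exact P.add_mem (P.mul_mem_left _ hpP) (P.mul_mem_left _ hm)
  have hintP2 : ∀ m : ℤ, (p : ℤ) ∣ m → (m : 𝓞 F) ∈ P ^ 2 := by
    rintro m ⟨l, rfl⟩
    push_cast
    exact Ideal.mul_mem_right _ _ hpP2
  obtain ⟨θ, hθ1, hθ2⟩ := Ideal.exists_mem_pow_notMem_pow_succ P hPbot hP.ne_top 1
  rw [pow_one] at hθ1
  rw [one_add_one_eq_two] at hθ2
  obtain ⟨t, n, hct, hsq⟩ := exists_trace_norm c hc hF θ
  have hn : (p : ℤ) ∣ n := by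
    apply hPint
    have : (n : 𝓞 F) = t * θ - θ * θ := by rw [hsq]; ring
    rw [this]
    exact P.sub_mem (P.mul_mem_left _ hθ1) (P.mul_mem_left _ hθ1)
  have hmul : ∀ m : ℤ, (m : 𝓞 F) * θ ∈ P ^ 2 → (p : ℤ) ∣ m := by
    intro m hm
    rcases Ideal.IsPrime.mul_mem_pow P hm with h | h
    · exact hPint m h
    · exact absurd h hθ2
  have ht : (p : ℤ) ∣ t := by
    apply hmul
    have : (t : 𝓞 F) * θ = θ * θ + n := by rw [hsq]; ring
    rw [this, pow_two]
    refine Ideal.add_mem _ (Ideal.mul_mem_mul hθ1 hθ1) ?_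
    rw [← pow_two]
    exact hintP2 n hn
  -- If `p² ∣ n` then `θ / p` is integral, so that `θ ∈ (p) ⊆ P²`.
  have hn2 : ¬ (p : ℤ) ^ 2 ∣ n := by
    rintro ⟨n', rfl⟩
    obtain ⟨t', rfl⟩ := ht
    have hpF : (p : F) ≠ 0 := by exact_mod_cast hp.out.ne_zero
    have hint : IsIntegral ℤ ((θ : F) / p) := by
      refine ⟨Polynomial.X ^ 2 - Polynomial.C t' * Polynomial.X + Polynomial.C n', by monicity!, ?_⟩
      have h := congrArg (algebraMap (𝓞 F) F) hsq
      rw [map_mul, map_sub, map_mul, map_intCast, map_intCast] at h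
      push_cast at h
      simp only [Polynomial.eval₂_add, Polynomial.eval₂_sub, Polynomial.eval₂_pow,
        Polynomial.eval₂_X, Polynomial.eval₂_mul, Polynomial.eval₂_C]
      simp only [algebraMap_int_eq, eq_intCast]
      field_simp
      linear_combination h
    obtain ⟨y, hy⟩ : ∃ y : 𝓞 F, algebraMap (𝓞 F) F y = (θ : F) / p := ⟨⟨_, hint⟩, rfl⟩
    apply hθ2
    have : θ = p * y := by
      apply NumberField.RingOfIntegers.ext
      change _ = algebraMap (𝓞 F) F _
      rw [map_mul, map_natCast, hy]; field_simp
    rw [this]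
    exact Ideal.mul_mem_right _ _ hpP2
  have hrank : Module.finrank ℤ (𝓞 F) = 2 := by rw [NumberField.RingOfIntegers.rank, hF]
  let b : Module.Basis (Fin 2) ℤ (𝓞 F) := Module.finBasisOfFinrankEq ℤ (𝓞 F) hrank
  set M : Matrix (Fin 2) (Fin 2) ℤ := !![b.repr 1 0, b.repr θ 0; b.repr 1 1, b.repr θ 1] with hM
  have h1 : (1 : 𝓞 F) = M 0 0 * b 0 + M 1 0 * b 1 := by
    have := (b.sum_repr 1).symm
    rwa [Fin.sum_univ_two, zsmul_eq_mul, zsmul_eq_mul] at this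
  have h2 : θ = M 0 1 * b 0 + M 1 1 * b 1 := by
    have := (b.sum_repr θ).symm
    rwa [Fin.sum_univ_two, zsmul_eq_mul, zsmul_eq_mul] at this
  have hk : (M.det : 𝓞 F) = M 0 0 * M 1 1 - M 0 1 * M 1 0 := by
    rw [Matrix.det_fin_two]; push_cast; ring
  have e0 : (M.det : 𝓞 F) * b 0 = M 1 1 - M 1 0 * θ := by
    rw [hk]
    linear_combination - (M 1 1 : 𝓞 F) * h1 + (M 1 0 : 𝓞 F) * h2
  have e1 : (M.det : 𝓞 F) * b 1 = - M 0 1 + M 0 0 * θ := by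
    rw [hk]
    linear_combination (M 0 1 : 𝓞 F) * h1 - (M 0 0 : 𝓞 F) * h2
  refine ⟨θ, t, n, M.det, hct, hsq, ht, hn, hn2, ?_, ?_, ?_⟩
  · -- Modulo `P²` the elements `1` and `θ` are independent.
    intro hdet
    have key : ∀ x y : ℤ, (x : 𝓞 F) + y * θ ∈ P ^ 2 → (p : ℤ) ∣ x ∧ (p : ℤ) ∣ y := by
      intro x y hxy
      have hx : (p : ℤ) ∣ x := by
        apply hPint
        have : (x : 𝓞 F) = (x + y * θ) - y * θ := by ring
        rw [this]
        exact P.sub_mem (Ideal.pow_le_self two_ne_zero hxy) (P.mul_mem_left _ hθ1)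
      refine ⟨hx, hmul y ?_⟩
      have : (y : 𝓞 F) * θ = (x + y * θ) - x := by ring
      rw [this]
      exact Ideal.sub_mem _ hxy (hintP2 x hx)
    obtain ⟨-, k2⟩ := key (-M 0 1) (M 0 0) (by
      push_cast; rw [← e1]; exact Ideal.mul_mem_right _ _ (hintP2 _ hdet))
    obtain ⟨-, k4⟩ := key (M 1 1) (-M 1 0) (by
      push_cast; rw [neg_mul, ← sub_eq_add_neg, ← e0]
      exact Ideal.mul_mem_right _ _ (hintP2 _ hdet))
    rw [dvd_neg] at k4
    apply hP.ne_top
    rw [Ideal.eq_top_iff_one]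
    rw [h1]
    exact P.add_mem (P.mul_mem_right _ (Ideal.pow_le_self two_ne_zero (hintP2 _ k2)))
      (P.mul_mem_right _ (Ideal.pow_le_self two_ne_zero (hintP2 _ k4)))
  · have hd : Algebra.discr ℤ ![(1 : 𝓞 F), θ] = M.det ^ 2 * NumberField.discr F := by
      have hv : ![(1 : 𝓞 F), θ] = Matrix.vecMul b (M.map (algebraMap ℤ (𝓞 F))) := by
        ext i
        fin_cases i
        · simp only [Fin.zero_eta, Matrix.cons_val_zero, Matrix.vecMul, dotProduct,
            Fin.sum_univ_two, Matrix.map_apply, algebraMap_int_eq, eq_intCast]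
          conv_lhs => rw [h1]
          push_cast; ring
        · simp only [Fin.mk_one, Matrix.cons_val_one, Matrix.cons_val_fin_one, Matrix.vecMul,
            dotProduct, Fin.sum_univ_two, Matrix.map_apply, algebraMap_int_eq, eq_intCast]
          conv_lhs => rw [h2]
          push_cast; ring
      rw [hv, Algebra.discr_of_matrix_vecMul, NumberField.discr_eq_discr F b]
    have htr : ∀ (z : 𝓞 F) (m : ℤ) (w : F),
        algebraMap (𝓞 F) F z = w → w + c w = m → Algebra.trace ℤ (𝓞 F) z = m := by
      rintro z m w rfl hz
      have : Algebra.IsQuadraticExtension ℚ F := ⟨hF⟩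
      apply Int.cast_injective (α := ℚ)
      apply (algebraMap ℚ F).injective
      rw [Algebra.coe_trace_int, trace_eq_sum_automorphisms, map_intCast, ← hz]
      classical
      have hu : (Finset.univ : Finset (F ≃ₐ[ℚ] F)) = {1, c} := by
        ext g
        simpa using aut_eq_one_or c hc hF g
      rw [hu, Finset.sum_pair hc.symm]
      rfl
    have hsqF : (θ : F) * θ = t * θ - n := by
      have h := congrArg (algebraMap (𝓞 F) F) hsq
      rwa [map_mul, map_sub, map_mul, map_intCast, map_intCast] at h
    have t1 : Algebra.trace ℤ (𝓞 F) 1 = 2 := htr _ _ 1 (map_one _) (by rw [map_one]; norm_num)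
    have t2 : Algebra.trace ℤ (𝓞 F) θ = t := htr _ _ _ rfl (by rw [hct]; ring)
    have t3 : Algebra.trace ℤ (𝓞 F) (θ * θ) = t ^ 2 - 2 * n := by
      apply htr _ _ _ (map_mul _ _ _)
      rw [map_mul, hct]
      push_cast
      linear_combination 2 * hsqF
    rw [← hd, Algebra.discr_def, Matrix.det_fin_two]
    simp only [Algebra.traceMatrix_apply, Algebra.traceForm_apply, Matrix.cons_val_zero,
      Matrix.cons_val_one, Matrix.cons_val_fin_one, one_mul, mul_one, t1, t2, t3]
    ring
  · intro x
    refine ⟨b.repr x 0 * M 1 1 - b.repr x 1 * M 0 1, b.repr x 1 * M 0 0 - b.repr x 0 * M 1 0, ?_⟩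
    conv_lhs => rw [← b.sum_repr x, Fin.sum_univ_two, zsmul_eq_mul, zsmul_eq_mul]
    rw [Int.cast_sub, Int.cast_sub, Int.cast_mul, Int.cast_mul, Int.cast_mul, Int.cast_mul]
    linear_combination (b.repr x 0 : 𝓞 F) * e0 + (b.repr x 1 : 𝓞 F) * e1

end Global

/-! ### Eisenstein generators of the local algebra -/

section LocalField

variable (p : ℕ) [hp : Fact p.Prime] {F : Type*} [Field F] [NumberField F]

/-- A generator `θ` of the order `𝒪` over `ℤ_p` which is a root of the Eisenstein polynomial
`X² - t X + n`, together with the coordinates of `F_p` in the basis `1, θ`. -/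
structure EisensteinGenerator (c : F ≃ₐ[ℚ] F) where
  ne_one : c ≠ 1
  finrank_eq : Module.finrank ℚ F = 2
  /-- The generator. -/
  θ : LocAlg p F
  /-- The trace of the generator. -/
  t : ℚ_[p]
  /-- The norm of the generator. -/
  n : ℚ_[p]
  /-- The coordinates in the basis `1, θ`. -/
  coord : LocAlg p F ≃ₗ[ℚ_[p]] ℚ_[p] × ℚ_[p]
  coord_symm : ∀ a b, coord.symm (a, b) = algebraMap _ _ a + algebraMap _ _ b * θ
  sq : θ * θ = algebraMap _ _ t * θ - algebraMap _ _ n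
  galConj_θ : galConj p c θ = algebraMap _ _ t - θ
  norm_t : ‖t‖ ≤ (p : ℝ)⁻¹
  norm_n : ‖n‖ = (p : ℝ)⁻¹
  mem_order : ∀ z, z ∈ localOrder p F ↔ ‖(coord z).1‖ ≤ 1 ∧ ‖(coord z).2‖ ≤ 1
  norm_discr : ‖(NumberField.discr F : ℚ_[p])‖ = ‖t ^ 2 - 4 * n‖

/-- The Eisenstein generator of the global field at the ramified prime generates `𝒪` over `ℤ_p`, since
the index of the order it spans is prime to `p`. -/
theorem nonempty_eisensteinGenerator (c : F ≃ₐ[ℚ] F) (hc : c ≠ 1)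
    (hF : Module.finrank ℚ F = 2) (hram : IsRamifiedIn p F) :
    Nonempty (EisensteinGenerator p c) := by
  obtain ⟨θ, t, n, k, hct, hsq, ht, hn, hn2, hk, hdisc, hspan⟩ := exists_eisenstein p c hc hF hram
  have hk0 : k ≠ 0 := by rintro rfl; simp at hk
  have hsqF : (θ : F) * θ = t * θ - n := by
    have h := congrArg (algebraMap (𝓞 F) F) hsq
    rwa [map_mul, map_sub, map_mul, map_intCast, map_intCast] at h
  have hD : ((t : F) - 2 * θ) ≠ 0 := by
    intro h
    have h1 : ((t ^ 2 - 4 * n : ℤ) : F) = 0 := by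
      push_cast
      linear_combination (t - 2 * (θ : F)) * h - 4 * hsqF
    rw [← hdisc] at h1
    have h2 := Int.cast_eq_zero.mp h1
    rcases mul_eq_zero.mp h2 with h3 | h3
    · exact hk0 (pow_eq_zero_iff two_ne_zero |>.mp h3)
    · exact NumberField.discr_ne_zero F h3
  have hli : LinearIndependent ℚ ![(1 : F), θ] := by
    rw [LinearIndependent.pair_iff]
    intro s r h
    rw [Algebra.smul_def, Algebra.smul_def, mul_one] at h
    have h' := congrArg c h
    rw [map_add, map_mul, AlgEquiv.commutes, AlgEquiv.commutes, hct, map_zero] at h'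
    have hr : r = 0 := by
      have : algebraMap ℚ F r * ((t : F) - 2 * θ) = 0 := by linear_combination h' - h
      simpa [hD] using this
    subst hr
    simpa using h
  let b : Module.Basis (Fin 2) ℚ F := basisOfLinearIndependentOfCardEqFinrank hli (by simp [hF])
  let B : Module.Basis (Fin 2) ℚ_[p] (LocAlg p F) :=
    (Algebra.TensorProduct.basis ℚ_[p] b : Module.Basis (Fin 2) ℚ_[p] (ℚ_[p] ⊗[ℚ] F))
  have hB0 : B 0 = 1 := by
    refine (Algebra.TensorProduct.basis_apply b 0).trans ?_
    simp [b]
    rfl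
  have hB1 : B 1 = ofGlobal p F θ := by
    refine (Algebra.TensorProduct.basis_apply b 1).trans ?_
    simp [b]
    rfl
  let e : LocAlg p F ≃ₗ[ℚ_[p]] ℚ_[p] × ℚ_[p] :=
    B.equivFun.trans (LinearEquiv.finTwoArrow ℚ_[p] ℚ_[p])
  have he : ∀ a b, e.symm (a, b) = algebraMap _ _ a + algebraMap _ _ b * ofGlobal p F θ := by
    intro a b
    change B.equivFun.symm ![a, b] = _
    rw [Module.Basis.equivFun_symm_apply, Fin.sum_univ_two, hB0, hB1, Algebra.smul_def,
      Algebra.smul_def, mul_one]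
    rfl
  have hsqL : ofGlobal p F θ * ofGlobal p F θ = algebraMap ℚ_[p] _ (t : ℚ_[p]) * ofGlobal p F θ
      - algebraMap ℚ_[p] _ (n : ℚ_[p]) := by
    rw [← map_mul, hsqF, map_sub, map_mul, map_intCast, map_intCast, map_intCast, map_intCast]
  have hpQ : (p : ℚ_[p]) ≠ 0 := by exact_mod_cast hp.out.ne_zero
  have hkn : ‖(k : ℚ_[p])‖ = 1 := by
    refine le_antisymm (Padic.norm_int_le_one k) ?_
    by_contra! h
    exact hk (Padic.norm_intCast_lt_one_iff.mp h)
  have hkQ : (k : ℚ_[p]) ≠ 0 := by exact_mod_cast hk0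
  have hkL : (k : LocAlg p F) * algebraMap ℚ_[p] _ ((k : ℚ_[p])⁻¹) = 1 := by
    rw [← map_intCast (algebraMap ℚ_[p] (LocAlg p F)), ← map_mul, mul_inv_cancel₀ hkQ, map_one]
  have htn : ‖(t : ℚ_[p])‖ ≤ (p : ℝ)⁻¹ := by
    simpa using (Padic.norm_int_le_pow_iff_dvd t 1).mpr (by simpa using ht)
  have hnn : ‖(n : ℚ_[p])‖ ≤ (p : ℝ)⁻¹ := by
    simpa using (Padic.norm_int_le_pow_iff_dvd n 1).mpr (by simpa using hn)
  have hp1 : (p : ℝ)⁻¹ ≤ 1 := inv_le_one_of_one_le₀ (by exact_mod_cast hp.out.one_lt.le)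
  have hna : ∀ x y : ℚ_[p], ‖x‖ ≤ 1 → ‖y‖ ≤ 1 → ‖x + y‖ ≤ 1 := fun x y hx hy =>
    (Padic.nonarchimedean x y).trans (max_le hx hy)
  have hnm : ∀ x y : ℚ_[p], ‖x‖ ≤ 1 → ‖y‖ ≤ 1 → ‖x * y‖ ≤ 1 := fun x y hx hy => by
    rw [norm_mul]; exact mul_le_one₀ hx (norm_nonneg _) hy
  refine ⟨⟨hc, hF, ofGlobal p F θ, t, n, e, he, hsqL, ?_, htn, ?_, fun z => ⟨fun hz => ?_, fun hz => ?_⟩,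
    ?_⟩⟩
  · change (1 : ℚ_[p]) ⊗ₜ[ℚ] (c θ) = _
    rw [hct]
    change ofGlobal p F _ = _
    rw [map_sub, map_intCast, map_intCast]
  · obtain ⟨m, rfl⟩ := hn
    have hm : ‖(m : ℚ_[p])‖ = 1 := by
      refine le_antisymm (Padic.norm_int_le_one m) ?_
      by_contra! h
      obtain ⟨l, rfl⟩ := Padic.norm_intCast_lt_one_iff.mp h
      exact hn2 ⟨l, by ring⟩
    push_cast
    rw [norm_mul, hm, mul_one, Padic.norm_p]
  · have hadd : ∀ x y : LocAlg p F, e (x + y) = e x + e y := map_add e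
    have hee : ∀ a b, e (algebraMap _ _ a + algebraMap _ _ b * ofGlobal p F θ) = (a, b) := by
      intro a b
      rw [← he, LinearEquiv.apply_symm_apply]
    unfold localOrder at hz
    induction hz using Subring.closure_induction with
    | mem x hx =>
      rcases hx with ⟨a, rfl⟩ | ⟨x, rfl⟩
      · have := hee a 0
        rw [map_zero, zero_mul, add_zero] at this
        change ‖(e (algebraMap _ _ (a : ℚ_[p]))).1‖ ≤ 1 ∧ ‖(e (algebraMap _ _ (a : ℚ_[p]))).2‖ ≤ 1
        rw [this]
        exact ⟨a.2, by simp⟩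
      · obtain ⟨u, v, huv⟩ := hspan x
        have h := congrArg (algebraMap (𝓞 F) F) huv
        rw [map_mul, map_add, map_mul, map_intCast, map_intCast, map_intCast] at h
        have h2 := congrArg (ofGlobal p F) h
        rw [map_mul, map_add, map_mul, map_intCast, map_intCast, map_intCast] at h2
        have h3 : ofGlobal p F x = algebraMap ℚ_[p] _ ((k : ℚ_[p])⁻¹ * u) +
            algebraMap ℚ_[p] _ ((k : ℚ_[p])⁻¹ * v) * ofGlobal p F θ := by
          rw [map_mul, map_mul, map_intCast, map_intCast]
          calc ofGlobal p F x = ((k : LocAlg p F) * algebraMap ℚ_[p] _ ((k : ℚ_[p])⁻¹)) *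
                ofGlobal p F x := by rw [hkL, one_mul]
            _ = algebraMap ℚ_[p] _ ((k : ℚ_[p])⁻¹) * ((k : LocAlg p F) * ofGlobal p F x) := by ring
            _ = _ := by rw [h2]; ring
        change ‖(e (ofGlobal p F x)).1‖ ≤ 1 ∧ ‖(e (ofGlobal p F x)).2‖ ≤ 1
        rw [h3, hee]
        constructor <;>
        · rw [norm_mul, norm_inv, hkn, inv_one, one_mul]
          exact Padic.norm_int_le_one _
    | zero => rw [map_zero]; simp
    | one =>
      have := hee 1 0
      rw [map_zero, zero_mul, add_zero, map_one] at this
      rw [this]; simp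
    | add x y _ _ hx hy =>
      rw [hadd]
      exact ⟨hna _ _ hx.1 hy.1, hna _ _ hx.2 hy.2⟩
    | neg x _ hx => rw [map_neg]; simpa using hx
    | mul x y _ _ hx hy =>
      obtain ⟨⟨a, b⟩, rfl⟩ := e.symm.surjective x
      obtain ⟨⟨a', b'⟩, rfl⟩ := e.symm.surjective y
      rw [LinearEquiv.apply_symm_apply] at hx hy
      have : e.symm (a, b) * e.symm (a', b') =
          algebraMap ℚ_[p] _ (a * a' + -n * (b * b')) +
          algebraMap ℚ_[p] _ (a * b' + b * a' + t * (b * b')) * ofGlobal p F θ := by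
        rw [he, he]
        simp only [map_mul, map_add, map_neg]
        linear_combination (algebraMap ℚ_[p] (LocAlg p F) b * algebraMap _ _ b') * hsqL
      rw [this, hee]
      have h1 := hnm _ _ hx.1 hy.1
      have h2 := hnm _ _ hx.2 hy.2
      exact ⟨hna _ _ h1 (hnm _ _ (by rw [norm_neg]; exact hnn.trans hp1) h2),
        hna _ _ (hna _ _ (hnm _ _ hx.1 hy.2) (hnm _ _ hx.2 hy.1)) (hnm _ _ (htn.trans hp1) h2)⟩
  · obtain ⟨⟨a, b⟩, rfl⟩ := e.symm.surjective z
    rw [LinearEquiv.apply_symm_apply] at hz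
    rw [he]
    have ha : algebraMap ℚ_[p] (LocAlg p F) a ∈ localOrder p F :=
      Subring.subset_closure (Or.inl ⟨⟨a, hz.1⟩, rfl⟩)
    have hb : algebraMap ℚ_[p] (LocAlg p F) b ∈ localOrder p F :=
      Subring.subset_closure (Or.inl ⟨⟨b, hz.2⟩, rfl⟩)
    have hth : ofGlobal p F θ ∈ localOrder p F := Subring.subset_closure (Or.inr ⟨θ, rfl⟩)
    exact Subring.add_mem _ ha (Subring.mul_mem _ hb hth)
  · have : ((t : ℚ_[p]) ^ 2 - 4 * n) = k ^ 2 * NumberField.discr F := by exact_mod_cast hdisc.symm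
    rw [this, norm_mul, norm_pow, hkn, one_pow, one_mul]

end LocalField

/-! ### The absolute value of the local algebra -/

section AbsoluteValue

variable {p : ℕ} [hp : Fact p.Prime] {F : Type*} [Field F] [NumberField F]

theorem absLoc_mul (x y : LocAlg p F) : absLoc p (x * y) = absLoc p x * absLoc p y := by
  unfold absLoc
  rw [map_mul, norm_mul]

theorem absLoc_one : absLoc p (1 : LocAlg p F) = 1 := by
  unfold absLoc
  rw [map_one, norm_one]

theorem absLoc_nonneg (x : LocAlg p F) : 0 ≤ absLoc p x := norm_nonneg _

theorem absLoc_neg_one : absLoc p (-1 : LocAlg p F) = 1 := by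
  have h : absLoc p (-1 : LocAlg p F) * absLoc p (-1 : LocAlg p F) = 1 := by
    rw [← absLoc_mul, neg_mul_neg, one_mul, absLoc_one]
  nlinarith [absLoc_nonneg (-1 : LocAlg p F)]

theorem absLoc_neg (x : LocAlg p F) : absLoc p (-x) = absLoc p x := by
  rw [neg_eq_neg_one_mul, absLoc_mul, absLoc_neg_one, one_mul]

theorem absLoc_pow (x : LocAlg p F) (k : ℕ) : absLoc p (x ^ k) = absLoc p x ^ k := by
  unfold absLoc
  rw [map_pow, norm_pow]

theorem absLoc_unit_pos (z : (LocAlg p F)ˣ) : 0 < absLoc p (z : LocAlg p F) := by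
  refine lt_of_le_of_ne (absLoc_nonneg _) fun h => ?_
  have := absLoc_mul (z : LocAlg p F) (z⁻¹ : (LocAlg p F)ˣ)
  rw [Units.mul_inv, absLoc_one, ← h, zero_mul] at this
  exact one_ne_zero this

theorem absLoc_inv (z : (LocAlg p F)ˣ) :
    absLoc p ((z⁻¹ : (LocAlg p F)ˣ) : LocAlg p F) = (absLoc p (z : LocAlg p F))⁻¹ := by
  apply eq_inv_of_mul_eq_one_left
  rw [← absLoc_mul, Units.inv_mul, absLoc_one]

theorem absLoc_zpow (z : (LocAlg p F)ˣ) (k : ℤ) :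
    absLoc p ((z ^ k : (LocAlg p F)ˣ) : LocAlg p F) = absLoc p (z : LocAlg p F) ^ k := by
  cases k with
  | ofNat k => simp [absLoc_pow]
  | negSucc k =>
    rw [zpow_negSucc, zpow_negSucc, absLoc_inv, Units.val_pow_eq_pow_val, absLoc_pow]

theorem norm_normUnits (z : (LocAlg p F)ˣ) :
    ‖((normUnits p F z : ℚ_[p]ˣ) : ℚ_[p])‖ = absLoc p (z : LocAlg p F) := rfl

theorem exists_absLoc_eq_zpow (z : (LocAlg p F)ˣ) :
    ∃ k : ℤ, absLoc p (z : LocAlg p F) = (p : ℝ) ^ k := by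
  have : ((normUnits p F z : ℚ_[p]ˣ) : ℚ_[p]) ≠ 0 := Units.ne_zero _
  exact ⟨_, Padic.norm_eq_zpow_neg_valuation this⟩

/-- Divisibility is determined by the absolute value. -/
theorem exists_eq_unit_mul {x : LocAlg p F} (y : (LocAlg p F)ˣ)
    (h : absLoc p x ≤ absLoc p (y : LocAlg p F)) :
    ∃ w : LocAlg p F, absLoc p w ≤ 1 ∧ x = (y : LocAlg p F) * w := by
  refine ⟨((y⁻¹ : (LocAlg p F)ˣ) : LocAlg p F) * x, ?_, (Units.mul_inv_cancel_left y x).symm⟩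
  rw [absLoc_mul, absLoc_inv]
  exact (inv_mul_le_one₀ (absLoc_unit_pos y)).mpr h

variable {c : F ≃ₐ[ℚ] F} (E : EisensteinGenerator p c)

theorem one_lt_p : (1 : ℝ) < p := by exact_mod_cast hp.out.one_lt

theorem p_pos : (0 : ℝ) < p := zero_lt_one.trans one_lt_p

namespace EisensteinGenerator

include E

theorem coord_apply (a b : ℚ_[p]) : E.coord (algebraMap _ _ a + algebraMap _ _ b * E.θ) = (a, b) := by
  rw [← E.coord_symm, LinearEquiv.apply_symm_apply]

theorem exists_eq (z : LocAlg p F) :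
    ∃ a b : ℚ_[p], z = algebraMap _ _ a + algebraMap _ _ b * E.θ := by
  obtain ⟨⟨a, b⟩, rfl⟩ := E.coord.symm.surjective z
  exact ⟨a, b, E.coord_symm a b⟩

theorem coord_algebraMap (a : ℚ_[p]) : E.coord (algebraMap _ _ a) = (a, 0) := by
  have := E.coord_apply a 0
  rwa [map_zero, zero_mul, add_zero] at this

theorem algebraMap_injective : Function.Injective (algebraMap ℚ_[p] (LocAlg p F)) := by
  intro a b h
  have := congrArg E.coord h
  rw [coord_algebraMap, coord_algebraMap] at this
  exact (Prod.ext_iff.mp this).1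

theorem galConj_apply (a b : ℚ_[p]) :
    galConj p c (algebraMap _ _ a + algebraMap _ _ b * E.θ) =
      algebraMap _ _ (a + b * E.t) + algebraMap _ _ (-b) * E.θ := by
  rw [map_add, map_mul, AlgEquiv.commutes, AlgEquiv.commutes, E.galConj_θ]
  simp only [map_add, map_mul, map_neg]
  ring

theorem norm_apply (a b : ℚ_[p]) :
    Algebra.norm ℚ_[p] (algebraMap ℚ_[p] (LocAlg p F) a + algebraMap _ _ b * E.θ) =
      a ^ 2 + a * b * E.t + b ^ 2 * E.n := by
  apply E.algebraMap_injective
  rw [algebraMap_norm p c E.ne_one E.finrank_eq, E.galConj_apply]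
  simp only [map_add, map_mul, map_neg, map_pow]
  linear_combination - (algebraMap ℚ_[p] (LocAlg p F) b) ^ 2 * E.sq

/-- The three terms of the norm `a² + a b t + b² n` cannot cancel, since the valuations of the
outer ones have different parity. -/
theorem absLoc_apply (a b : ℚ_[p]) :
    absLoc p (algebraMap ℚ_[p] (LocAlg p F) a + algebraMap _ _ b * E.θ) =
      max (‖a‖ ^ 2) (‖b‖ ^ 2 * (p : ℝ)⁻¹) := by
  have hp1 := one_lt_p (p := p)
  have hp0 := p_pos (p := p)
  have hq0 : (0 : ℝ) < (p : ℝ)⁻¹ := inv_pos.mpr hp0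
  have hq1 : (p : ℝ)⁻¹ < 1 := inv_lt_one_of_one_lt₀ hp1
  unfold absLoc
  rw [E.norm_apply]
  have h1 : ‖a ^ 2‖ = ‖a‖ ^ 2 := norm_pow _ _
  have h2 : ‖b ^ 2 * E.n‖ = ‖b‖ ^ 2 * (p : ℝ)⁻¹ := by rw [norm_mul, norm_pow, E.norm_n]
  have h3 : ‖a * b * E.t‖ ≤ ‖a‖ * ‖b‖ * (p : ℝ)⁻¹ := by
    rw [norm_mul, norm_mul]
    exact mul_le_mul_of_nonneg_left E.norm_t (by positivity)
  by_cases hab : a = 0 ∧ b = 0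
  · obtain ⟨rfl, rfl⟩ := hab
    simp
  have hne : ‖a‖ ^ 2 ≠ ‖b‖ ^ 2 * (p : ℝ)⁻¹ := by
    intro h
    have ha : a ≠ 0 := by
      rintro rfl
      rw [norm_zero, zero_pow two_ne_zero, eq_comm, mul_eq_zero] at h
      rcases h with h | h
      · exact hab ⟨rfl, norm_eq_zero.mp (pow_eq_zero_iff two_ne_zero |>.mp h)⟩
      · exact hq0.ne' h
    have hb : b ≠ 0 := by
      rintro rfl
      rw [norm_zero, zero_pow two_ne_zero, zero_mul] at h
      exact ha (norm_eq_zero.mp (pow_eq_zero_iff two_ne_zero |>.mp h))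
    rw [Padic.norm_eq_zpow_neg_valuation ha, Padic.norm_eq_zpow_neg_valuation hb,
      ← zpow_natCast, ← zpow_natCast, ← zpow_mul, ← zpow_mul, ← zpow_neg_one,
      ← zpow_add₀ hp0.ne'] at h
    have := zpow_right_injective₀ hp0 hp1.ne' h
    push_cast at this
    omega
  have hlt : ‖a * b * E.t‖ < ‖a ^ 2 + b ^ 2 * E.n‖ := by
    rw [Padic.add_eq_max_of_ne (by rwa [h1, h2]), h1, h2]
    refine h3.trans_lt ?_
    have hA := norm_nonneg a
    have hB := norm_nonneg b
    rcases lt_or_gt_of_ne hne with h | h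
    · refine lt_max_of_lt_right ?_
      have : ‖a‖ < ‖b‖ := by
        refine lt_of_pow_lt_pow_left₀ 2 hB (h.trans_le ?_)
        exact mul_le_of_le_one_right (by positivity) hq1.le
      have hB' : 0 < ‖b‖ := hA.trans_lt this
      rw [pow_two]
      exact mul_lt_mul_of_pos_right (mul_lt_mul_of_pos_right this hB') hq0
    · refine lt_max_of_lt_left ?_
      have : ‖b‖ * (p : ℝ)⁻¹ < ‖a‖ := by
        refine lt_of_pow_lt_pow_left₀ 2 hA (lt_of_le_of_lt ?_ h)
        rw [mul_pow, pow_two (p : ℝ)⁻¹, ← mul_assoc]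
        exact mul_le_of_le_one_right (by positivity) hq1.le
      have hA' : 0 < ‖a‖ := lt_of_le_of_lt (by positivity) this
      rw [pow_two, mul_assoc]
      exact mul_lt_mul_of_pos_left this hA'
  have e : a ^ 2 + a * b * E.t + b ^ 2 * E.n = a * b * E.t + (a ^ 2 + b ^ 2 * E.n) := by ring
  rw [e, Padic.add_eq_max_of_ne hlt.ne, max_eq_right hlt.le, Padic.add_eq_max_of_ne (by rwa [h1, h2]),
    h1, h2]

theorem absLoc_algebraMap (a : ℚ_[p]) :
    absLoc p (algebraMap ℚ_[p] (LocAlg p F) a) = ‖a‖ ^ 2 := by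
  have h := E.absLoc_apply a 0
  rw [map_zero, zero_mul, add_zero, norm_zero] at h
  rw [h]
  simp

theorem absLoc_θ : absLoc p E.θ = (p : ℝ)⁻¹ := by
  have h := E.absLoc_apply 0 1
  rw [map_zero, map_one, one_mul, zero_add, norm_zero, norm_one] at h
  rw [h]
  simp

/-- The normalized absolute value is ultrametric. -/
theorem absLoc_add_le (x y : LocAlg p F) : absLoc p (x + y) ≤ max (absLoc p x) (absLoc p y) := by
  obtain ⟨a, b, rfl⟩ := E.exists_eq x
  obtain ⟨a', b', rfl⟩ := E.exists_eq y
  have e : algebraMap ℚ_[p] (LocAlg p F) a + algebraMap _ _ b * E.θ +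
      (algebraMap _ _ a' + algebraMap _ _ b' * E.θ) =
      algebraMap _ _ (a + a') + algebraMap _ _ (b + b') * E.θ := by
    simp only [map_add]; ring
  have key : ∀ u v : ℚ_[p], ‖u + v‖ ^ 2 ≤ max (‖u‖ ^ 2) (‖v‖ ^ 2) := by
    intro u v
    rcases le_max_iff.mp (Padic.nonarchimedean u v) with h | h
    · exact le_max_of_le_left (by gcongr)
    · exact le_max_of_le_right (by gcongr)
  have hq0 : (0 : ℝ) ≤ (p : ℝ)⁻¹ := (inv_pos.mpr p_pos).le
  rw [e, E.absLoc_apply, E.absLoc_apply, E.absLoc_apply]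
  refine max_le ?_ ?_
  · exact (key a a').trans (max_le_max (le_max_left _ _) (le_max_left _ _))
  · refine (mul_le_mul_of_nonneg_right (key b b') hq0).trans ?_
    rw [max_mul_of_nonneg _ _ hq0]
    exact max_le_max (le_max_right _ _) (le_max_right _ _)

theorem absLoc_eq_zero {z : LocAlg p F} (h : absLoc p z = 0) : z = 0 := by
  obtain ⟨a, b, rfl⟩ := E.exists_eq z
  rw [E.absLoc_apply] at h
  have hq0 : (0 : ℝ) < (p : ℝ)⁻¹ := inv_pos.mpr p_pos
  have ha : ‖a‖ ^ 2 = 0 := le_antisymm (by rw [← h]; exact le_max_left _ _) (by positivity)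
  have hb : ‖b‖ ^ 2 * (p : ℝ)⁻¹ = 0 :=
    le_antisymm (by rw [← h]; exact le_max_right _ _) (by positivity)
  have hb' : ‖b‖ ^ 2 = 0 := by
    rcases mul_eq_zero.mp hb with h | h
    · exact h
    · exact absurd h hq0.ne'
  rw [norm_eq_zero.mp (pow_eq_zero_iff two_ne_zero |>.mp ha),
    norm_eq_zero.mp (pow_eq_zero_iff two_ne_zero |>.mp hb')]
  simp

theorem isUnit_of_ne_zero {z : LocAlg p F} (h : z ≠ 0) : IsUnit z := by
  have hn : Algebra.norm ℚ_[p] z ≠ 0 := fun h0 =>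
    h (E.absLoc_eq_zero (by unfold absLoc; rw [h0, norm_zero]))
  have h1 := algebraMap_norm p c E.ne_one E.finrank_eq z
  exact isUnit_of_mul_isUnit_left (h1 ▸ (IsUnit.mk0 _ hn).map (algebraMap ℚ_[p] (LocAlg p F)))

/-- The generator as a unit of `F_p`. -/
def θu : (LocAlg p F)ˣ :=
  (E.isUnit_of_ne_zero (z := E.θ) (by
    intro h
    have h1 := E.absLoc_θ
    have h2 : (0 : ℝ) < (p : ℝ)⁻¹ := inv_pos.mpr p_pos
    rw [h] at h1
    unfold absLoc at h1
    have h3 := E.norm_apply 0 0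
    rw [map_zero, zero_mul, add_zero] at h3
    rw [h3] at h1
    simp at h1
    exact absurd h1.symm (by exact_mod_cast hp.out.ne_zero))).unit

theorem val_θu : (E.θu : LocAlg p F) = E.θ := IsUnit.unit_spec _

theorem absLoc_θu : absLoc p (E.θu : LocAlg p F) = (p : ℝ)⁻¹ := by rw [val_θu, absLoc_θ]

theorem absLoc_θu_zpow (k : ℤ) :
    absLoc p ((E.θu ^ k : (LocAlg p F)ˣ) : LocAlg p F) = (p : ℝ) ^ (-k) := by
  rw [absLoc_zpow, absLoc_θu, inv_zpow, zpow_neg]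

theorem mem_order_iff (z : LocAlg p F) : z ∈ localOrder p F ↔ absLoc p z ≤ 1 := by
  obtain ⟨a, b, rfl⟩ := E.exists_eq z
  rw [E.mem_order, E.coord_apply, E.absLoc_apply, max_le_iff]
  have hp1 := one_lt_p (p := p)
  have hp0 := p_pos (p := p)
  refine and_congr (pow_le_one_iff_of_nonneg (norm_nonneg _) two_ne_zero).symm ⟨fun h => ?_, fun h => ?_⟩
  · refine mul_le_one₀ (pow_le_one₀ (norm_nonneg _) h) (by positivity)
      (inv_le_one_of_one_le₀ hp1.le)
  · by_contra! hb
    have hb0 : b ≠ 0 := by rintro rfl; simp at hb; linarith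
    rw [Padic.norm_eq_zpow_neg_valuation hb0] at h hb
    rw [← zpow_natCast, ← zpow_mul, ← zpow_neg_one, ← zpow_add₀ hp0.ne', zpow_le_one_iff_right₀ hp1] at h
    rw [one_lt_zpow_iff_right₀ hp1] at hb
    push_cast at h
    omega

theorem absLoc_galConj (z : LocAlg p F) : absLoc p (galConj p c z) = absLoc p z := by
  unfold absLoc
  congr 1
  apply E.algebraMap_injective
  rw [algebraMap_norm p c E.ne_one E.finrank_eq, algebraMap_norm p c E.ne_one E.finrank_eq,
    galConj_galConj p c E.finrank_eq, mul_comm]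

/-- An integral element with absolute value less than `1` is divisible by `θ`: there is no value
between `p⁻¹` and `1`. -/
theorem absLoc_le_of_lt_one {x : LocAlg p F} (h : absLoc p x < 1) : absLoc p x ≤ (p : ℝ)⁻¹ := by
  by_cases hx : x = 0
  · have : absLoc p x = 0 := by
      rw [hx]; have := E.absLoc_algebraMap 0
      rw [map_zero] at this; rw [this]; simp
    rw [this]
    exact (inv_pos.mpr p_pos).le
  · obtain ⟨u, rfl⟩ := E.isUnit_of_ne_zero hx
    obtain ⟨k, hk⟩ := exists_absLoc_eq_zpow u
    rw [hk] at h ⊢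
    rw [zpow_lt_one_iff_right₀ one_lt_p] at h
    rw [← zpow_neg_one, zpow_le_zpow_iff_right₀ one_lt_p]
    omega

theorem absLoc_uniformizer {ϖ : (LocAlg p F)ˣ} (hϖ : IsUniformizer p F ϖ) :
    absLoc p (ϖ : LocAlg p F) = (p : ℝ)⁻¹ := by
  have hp1 := one_lt_p (p := p)
  have hq1 : (p : ℝ)⁻¹ < 1 := inv_lt_one_of_one_lt₀ hp1
  have hunit : ∀ x : localOrder p F, IsUnit x → absLoc p (x : LocAlg p F) = 1 := by
    rintro _ ⟨u, rfl⟩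
    have h1 := (E.mem_order_iff _).mp (u : localOrder p F).2
    have h2 := (E.mem_order_iff _).mp ((u⁻¹ : (localOrder p F)ˣ) : localOrder p F).2
    have h3 := absLoc_mul ((u : localOrder p F) : LocAlg p F)
      (((u⁻¹ : (localOrder p F)ˣ) : localOrder p F) : LocAlg p F)
    rw [← Subring.coe_mul, Units.mul_inv, Subring.coe_one, absLoc_one] at h3
    nlinarith [absLoc_nonneg ((u : localOrder p F) : LocAlg p F)]
  have hunit' : ∀ x : localOrder p F, absLoc p (x : LocAlg p F) = 1 → IsUnit x := by
    intro x hx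
    have hx0 : (x : LocAlg p F) ≠ 0 := by
      intro h0
      have := E.absLoc_algebraMap 0
      rw [map_zero] at this
      rw [h0, this] at hx
      simp at hx
    obtain ⟨u, hu⟩ := E.isUnit_of_ne_zero hx0
    have hi : ((u⁻¹ : (LocAlg p F)ˣ) : LocAlg p F) ∈ localOrder p F := by
      rw [E.mem_order_iff, absLoc_inv, hu, hx, inv_one]
    refine IsUnit.of_mul_eq_one ⟨_, hi⟩ ?_
    apply Subtype.ext
    change (x : LocAlg p F) * _ = 1
    rw [← hu, Units.mul_inv]
  have h1 := (E.mem_order_iff _).mp hϖ.1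
  have hnu : absLoc p (ϖ : LocAlg p F) ≠ 1 := by
    intro h
    have := (hϖ.2 ⟨ϖ, hϖ.1⟩).mpr ⟨1, (mul_one _).symm⟩
    exact this (hunit' _ h)
  refine le_antisymm (E.absLoc_le_of_lt_one (lt_of_le_of_ne h1 hnu)) ?_
  have hθ : E.θ ∈ localOrder p F := by rw [E.mem_order_iff, E.absLoc_θ]; exact hq1.le
  obtain ⟨y, hy⟩ := (hϖ.2 ⟨E.θ, hθ⟩).mp (fun h => by
    have := hunit _ h
    change absLoc p E.θ = 1 at this
    rw [E.absLoc_θ] at this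
    exact hq1.ne this)
  change E.θ = _ at hy
  rw [← E.absLoc_θ, hy, absLoc_mul]
  exact mul_le_of_le_one_right (absLoc_nonneg _) ((E.mem_order_iff _).mp y.2)

end EisensteinGenerator

end AbsoluteValue

/-! ### Residues modulo powers of the generator -/

section Residues

variable {p : ℕ} [hp : Fact p.Prime] {F : Type*} [Field F] [NumberField F]
variable {c : F ≃ₐ[ℚ] F} (E : EisensteinGenerator p c)

namespace EisensteinGenerator

include E

theorem absLoc_zero : absLoc p (0 : LocAlg p F) = 0 := by
  have h := E.absLoc_algebraMap 0
  rw [map_zero, norm_zero, zero_pow two_ne_zero] at h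
  exact h

theorem ne_zero_of_absLoc {z : LocAlg p F} (h : 0 < absLoc p z) : z ≠ 0 := by
  rintro rfl
  exact h.ne' E.absLoc_zero

theorem absLoc_sub_le (x y : LocAlg p F) : absLoc p (x - y) ≤ max (absLoc p x) (absLoc p y) := by
  rw [sub_eq_add_neg, ← absLoc_neg y]
  exact E.absLoc_add_le x (-y)

theorem exists_nat_lt {z : LocAlg p F} (hz : absLoc p z ≤ 1) :
    ∃ d < p, absLoc p (z - (d : LocAlg p F)) ≤ (p : ℝ)⁻¹ := by
  obtain ⟨a, b, rfl⟩ := E.exists_eq z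
  rw [← E.mem_order_iff, E.mem_order, E.coord_apply] at hz
  obtain ⟨a, rfl⟩ : ∃ α : ℤ_[p], (α : ℚ_[p]) = a := ⟨⟨a, hz.1⟩, rfl⟩
  obtain ⟨d, hd, hd'⟩ := PadicInt.exists_mem_range a
  refine ⟨d, hd, E.absLoc_le_of_lt_one ?_⟩
  have e : algebraMap ℚ_[p] (LocAlg p F) a + algebraMap _ _ b * E.θ - (d : LocAlg p F) =
      algebraMap _ _ ((a : ℚ_[p]) - d) + algebraMap _ _ b * E.θ := by
    rw [map_sub, map_natCast]; ring
  rw [e, E.absLoc_apply]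
  rw [IsLocalRing.mem_maximalIdeal, PadicInt.mem_nonunits] at hd'
  have h1 : ‖(a : ℚ_[p]) - d‖ < 1 := by
    rw [PadicInt.norm_def, PadicInt.coe_sub, PadicInt.coe_natCast] at hd'
    exact hd'
  refine max_lt (pow_lt_one₀ (norm_nonneg _) h1 two_ne_zero) ?_
  have h2 : ‖b‖ ^ 2 ≤ 1 := pow_le_one₀ (norm_nonneg _) hz.2
  have h3 : (p : ℝ)⁻¹ < 1 := inv_lt_one_of_one_lt₀ one_lt_p
  have h4 : (0 : ℝ) < (p : ℝ)⁻¹ := inv_pos.mpr p_pos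
  nlinarith

theorem nat_eq_of_absLoc_lt {d d' : ℕ} (hd : d < p) (hd' : d' < p)
    (h : absLoc p ((d : LocAlg p F) - (d' : LocAlg p F)) < 1) : d = d' := by
  have e : (d : LocAlg p F) - (d' : LocAlg p F) = algebraMap ℚ_[p] _ (((d - d' : ℤ)) : ℚ_[p]) := by
    rw [map_intCast]
    push_cast
    ring
  rw [e, E.absLoc_algebraMap] at h
  have h1 : ‖((d - d' : ℤ) : ℚ_[p])‖ < 1 := by
    by_contra! h2
    exact absurd h (not_lt.mpr (one_le_pow₀ h2))
  rw [Padic.norm_intCast_lt_one_iff] at h1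
  obtain ⟨k, hk⟩ := h1
  have hp0 : (0 : ℤ) < p := by exact_mod_cast hp.out.pos
  have : k = 0 := by
    by_contra hk0
    rcases lt_or_gt_of_ne hk0 with h | h
    · nlinarith
    · nlinarith
  subst this
  omega

/-- The quotient `𝒪 / θ^i 𝒪` has `p^i` elements: representatives are built from those of the residue
field `𝔽_p`. -/
theorem exists_residues (i : ℕ) : ∃ R : Finset (LocAlg p F), R.card = p ^ i ∧
    (∀ x ∈ R, absLoc p x ≤ 1) ∧
    (∀ z, absLoc p z ≤ 1 → ∃ x ∈ R, absLoc p (z - x) ≤ (p : ℝ)⁻¹ ^ i) ∧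
    ∀ x ∈ R, ∀ y ∈ R, absLoc p (x - y) ≤ (p : ℝ)⁻¹ ^ i → x = y := by
  classical
  have hq1 : (p : ℝ)⁻¹ < 1 := inv_lt_one_of_one_lt₀ one_lt_p
  have hq0 : (0 : ℝ) < (p : ℝ)⁻¹ := inv_pos.mpr p_pos
  have hnat : ∀ d : ℕ, absLoc p (d : LocAlg p F) ≤ 1 := by
    intro d
    rw [← map_natCast (algebraMap ℚ_[p] (LocAlg p F)), E.absLoc_algebraMap]
    exact pow_le_one₀ (norm_nonneg _) (by simpa using Padic.norm_int_le_one (p := p) d)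
  induction i with
  | zero =>
    refine ⟨{0}, by simp, by simp [E.absLoc_zero], fun z hz => ⟨0, by simp, by simpa using hz⟩, ?_⟩
    intro x hx y hy _
    rw [Finset.mem_singleton.mp hx, Finset.mem_singleton.mp hy]
  | succ i ih =>
    obtain ⟨R, hcard, hint, hex, huniq⟩ := ih
    have key : ∀ x ∈ R, ∀ y ∈ R, ∀ d < p, ∀ d' < p,
        absLoc p ((x + E.θ ^ i * (d : LocAlg p F)) - (y + E.θ ^ i * (d' : LocAlg p F))) ≤
          (p : ℝ)⁻¹ ^ (i + 1) →
        x = y ∧ d = d' := by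
      intro x hx y hy d hd d' hd' h
      have hxy : x = y := by
        apply huniq x hx y hy
        have e : x - y = ((x + E.θ ^ i * d) - (y + E.θ ^ i * d')) +
            E.θ ^ i * ((d' : LocAlg p F) - d) := by ring
        rw [e]
        refine (E.absLoc_add_le _ _).trans (max_le (h.trans ?_) ?_)
        · exact pow_le_pow_of_le_one hq0.le hq1.le (Nat.le_succ i)
        · rw [absLoc_mul, absLoc_pow, E.absLoc_θ]
          exact mul_le_of_le_one_right (by positivity)
            ((E.absLoc_sub_le _ _).trans (max_le (hnat _) (hnat _)))
      refine ⟨hxy, E.nat_eq_of_absLoc_lt hd hd' ?_⟩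
      subst hxy
      have e : (x + E.θ ^ i * d) - (x + E.θ ^ i * d') = E.θ ^ i * ((d : LocAlg p F) - d') := by ring
      rw [e, absLoc_mul, absLoc_pow, E.absLoc_θ, pow_succ] at h
      exact (le_of_mul_le_mul_left h (by positivity)).trans_lt hq1
    refine ⟨(R ×ˢ Finset.range p).image fun x => x.1 + E.θ ^ i * (x.2 : LocAlg p F), ?_, ?_, ?_, ?_⟩
    · rw [Finset.card_image_of_injOn, Finset.card_product, hcard, Finset.card_range, pow_succ]
      rintro ⟨x, d⟩ hx ⟨y, d'⟩ hy h
      simp only [Finset.coe_product, Set.mem_prod, Finset.mem_coe, Finset.mem_range] at hx hy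
      have := key x hx.1 y hy.1 d hx.2 d' hy.2 (by
        simp only at h
        rw [h, sub_self, E.absLoc_zero]; positivity)
      rw [this.1, this.2]
    · intro z hz
      obtain ⟨⟨x, d⟩, hx, rfl⟩ := Finset.mem_image.mp hz
      rw [Finset.mem_product] at hx
      refine (E.absLoc_add_le _ _).trans (max_le (hint x hx.1) ?_)
      rw [absLoc_mul, absLoc_pow, E.absLoc_θ]
      exact mul_le_one₀ (pow_le_one₀ hq0.le hq1.le) (absLoc_nonneg _) (hnat _)
    · intro z hz
      obtain ⟨x, hx, hzx⟩ := hex z hz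
      obtain ⟨w, hw, hzw⟩ := exists_eq_unit_mul (x := z - x) (E.θu ^ i) (by
        rw [Units.val_pow_eq_pow_val, E.val_θu, absLoc_pow, E.absLoc_θ]; exact hzx)
      obtain ⟨d, hd, hwd⟩ := E.exists_nat_lt hw
      refine ⟨x + E.θ ^ i * d, Finset.mem_image.mpr ⟨(x, d), ?_, rfl⟩, ?_⟩
      · exact Finset.mem_product.mpr ⟨hx, Finset.mem_range.mpr hd⟩
      · rw [Units.val_pow_eq_pow_val, E.val_θu] at hzw
        have e : z - (x + E.θ ^ i * d) = E.θ ^ i * (w - d) := by linear_combination hzw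
        rw [e, absLoc_mul, absLoc_pow, E.absLoc_θ, pow_succ]
        exact mul_le_mul_of_nonneg_left hwd (by positivity)
    · intro z hz z' hz' h
      obtain ⟨⟨x, d⟩, hx, rfl⟩ := Finset.mem_image.mp hz
      obtain ⟨⟨y, d'⟩, hy, rfl⟩ := Finset.mem_image.mp hz'
      rw [Finset.mem_product, Finset.mem_range] at hx hy
      have := key x hx.1 y hy.1 d hx.2 d' hy.2 h
      simp only [this.1, this.2]

/-- A set of representatives of `𝒪 / θ^i 𝒪`. -/
def residues (i : ℕ) : Finset (LocAlg p F) := (E.exists_residues i).choose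

theorem card_residues (i : ℕ) : (E.residues i).card = p ^ i :=
  (E.exists_residues i).choose_spec.1

theorem absLoc_residues {i : ℕ} {x : LocAlg p F} (hx : x ∈ E.residues i) : absLoc p x ≤ 1 :=
  (E.exists_residues i).choose_spec.2.1 x hx

theorem exists_residue (i : ℕ) {z : LocAlg p F} (hz : absLoc p z ≤ 1) :
    ∃ x ∈ E.residues i, absLoc p (z - x) ≤ (p : ℝ)⁻¹ ^ i :=
  (E.exists_residues i).choose_spec.2.2.1 z hz

theorem residue_unique {i : ℕ} {x y : LocAlg p F} (hx : x ∈ E.residues i) (hy : y ∈ E.residues i)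
    (h : absLoc p (x - y) ≤ (p : ℝ)⁻¹ ^ i) : x = y :=
  (E.exists_residues i).choose_spec.2.2.2 x hx y hy h

end EisensteinGenerator

end Residues

/-! ### Iwasawa and Cartan decompositions -/

section GeneralLinear

variable (p : ℕ) [hp : Fact p.Prime] (F : Type*) [Field F] [NumberField F]

/-- The monoid `M₂(𝒪)`. -/
def integralMatrices : Submonoid (Matrix (Fin 2) (Fin 2) (LocAlg p F)) where
  carrier := {M | ∀ i j, M i j ∈ localOrder p F}
  one_mem' i j := by
    rw [Matrix.one_apply]
    split_ifs
    · exact Subring.one_mem _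
    · exact Subring.zero_mem _
  mul_mem' {M N} hM hN i j := by
    rw [Matrix.mul_apply]
    exact Subring.sum_mem _ fun k _ => Subring.mul_mem _ (hM i k) (hN k j)

/-- The group `GL₂(𝒪)`. -/
def integralGL : Subgroup (GL (Fin 2) (LocAlg p F)) := (integralMatrices p F).units

variable {p F}

theorem mem_integralGL {r : GL (Fin 2) (LocAlg p F)} : r ∈ integralGL p F ↔ IsIntegralGL p r :=
  Submonoid.mem_units_iff _ _

/-- The permutation matrix which exchanges the two coordinates. -/
def swapGL : GL (Fin 2) (LocAlg p F) where
  val := !![0, 1; 1, 0]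
  inv := !![0, 1; 1, 0]
  val_inv := by rw [Matrix.mul_fin_two, Matrix.one_fin_two]; simp
  inv_val := by rw [Matrix.mul_fin_two, Matrix.one_fin_two]; simp

theorem swapGL_mem : swapGL ∈ integralGL p F := by
  have h : ∀ i j : Fin 2, (!![0, 1; 1, 0] : Matrix (Fin 2) (Fin 2) (LocAlg p F)) i j
      ∈ localOrder p F := by
    intro i j
    fin_cases i <;> fin_cases j
    · exact Subring.zero_mem _
    · exact Subring.one_mem _
    · exact Subring.one_mem _
    · exact Subring.zero_mem _
  exact mem_integralGL.mpr ⟨h, h⟩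

theorem swapGL_mul_self : (swapGL : GL (Fin 2) (LocAlg p F)) * swapGL = 1 := by
  apply Units.ext
  exact swapGL.val_inv

theorem upper_mul (a d a' d' : (LocAlg p F)ˣ) (x x' : LocAlg p F) :
    upper p a d x * upper p a' d' x' = upper p (a * a') (d * d') (a * x' + x * d') := by
  apply Units.ext
  change !![(a : LocAlg p F), x; 0, (d : LocAlg p F)] * !![(a' : LocAlg p F), x'; 0, (d' : LocAlg p F)] =
    !![((a * a' : (LocAlg p F)ˣ) : LocAlg p F), a * x' + x * d'; 0, ((d * d' : (LocAlg p F)ˣ) : LocAlg p F)]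
  rw [Matrix.mul_fin_two]
  simp

theorem upper_inv (a d : (LocAlg p F)ˣ) (x : LocAlg p F) :
    (upper p a d x)⁻¹ = upper p a⁻¹ d⁻¹
      (-(((a⁻¹ : (LocAlg p F)ˣ) : LocAlg p F) * x * ((d⁻¹ : (LocAlg p F)ˣ) : LocAlg p F))) := by
  apply Units.ext
  rfl

theorem det_upper (a d : (LocAlg p F)ˣ) (x : LocAlg p F) :
    (upper p a d x : Matrix (Fin 2) (Fin 2) (LocAlg p F)).det = a * d := by
  change Matrix.det !![(a : LocAlg p F), x; 0, (d : LocAlg p F)] = _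
  rw [Matrix.det_fin_two_of]
  simp

/-- Lower triangular unipotent matrices are conjugate to upper triangular ones by `swapGL`. -/
theorem lower_val (w : LocAlg p F) :
    ((swapGL * upper p 1 1 w * swapGL : GL (Fin 2) (LocAlg p F)) :
      Matrix (Fin 2) (Fin 2) (LocAlg p F)) = !![1, 0; w, 1] := by
  change !![(0 : LocAlg p F), 1; 1, 0] * !![((1 : (LocAlg p F)ˣ) : LocAlg p F), w; 0, ((1 : (LocAlg p F)ˣ) : LocAlg p F)] *
    !![(0 : LocAlg p F), 1; 1, 0] = _
  rw [Matrix.mul_fin_two, Matrix.mul_fin_two]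
  simp

theorem mul_swapGL_apply (g : GL (Fin 2) (LocAlg p F)) (i : Fin 2) :
    (g * swapGL : GL (Fin 2) (LocAlg p F)) i 0 = g i 1 ∧
      (g * swapGL : GL (Fin 2) (LocAlg p F)) i 1 = g i 0 := by
  have : ((g * swapGL : GL (Fin 2) (LocAlg p F)) : Matrix (Fin 2) (Fin 2) (LocAlg p F)) =
    (g : Matrix (Fin 2) (Fin 2) (LocAlg p F)) * !![0, 1; 1, 0] := rfl
  rw [this, Matrix.mul_apply, Matrix.mul_apply, Fin.sum_univ_two, Fin.sum_univ_two]
  simp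

theorem swapGL_mul_apply (g : GL (Fin 2) (LocAlg p F)) (j : Fin 2) :
    (swapGL * g : GL (Fin 2) (LocAlg p F)) 0 j = g 1 j ∧
      (swapGL * g : GL (Fin 2) (LocAlg p F)) 1 j = g 0 j := by
  have : ((swapGL * g : GL (Fin 2) (LocAlg p F)) : Matrix (Fin 2) (Fin 2) (LocAlg p F)) =
    !![0, 1; 1, 0] * (g : Matrix (Fin 2) (Fin 2) (LocAlg p F)) := rfl
  rw [this, Matrix.mul_apply, Matrix.mul_apply, Fin.sum_univ_two, Fin.sum_univ_two]
  simp

variable {c : F ≃ₐ[ℚ] F} (E : EisensteinGenerator p c)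

namespace EisensteinGenerator

include E

theorem upper_mem_iff {a d : (LocAlg p F)ˣ} {x : LocAlg p F} :
    upper p a d x ∈ integralGL p F ↔ absLoc p (a : LocAlg p F) = 1 ∧
      absLoc p (d : LocAlg p F) = 1 ∧ absLoc p x ≤ 1 := by
  rw [mem_integralGL]
  constructor
  · rintro ⟨h1, h2⟩
    have a1 : absLoc p (a : LocAlg p F) ≤ 1 := (E.mem_order_iff _).mp (h1 0 0)
    have d1 : absLoc p (d : LocAlg p F) ≤ 1 := (E.mem_order_iff _).mp (h1 1 1)
    have x1 : absLoc p x ≤ 1 := (E.mem_order_iff _).mp (h1 0 1)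
    have a2 : absLoc p ((a⁻¹ : (LocAlg p F)ˣ) : LocAlg p F) ≤ 1 := (E.mem_order_iff _).mp (h2 0 0)
    have d2 : absLoc p ((d⁻¹ : (LocAlg p F)ˣ) : LocAlg p F) ≤ 1 := (E.mem_order_iff _).mp (h2 1 1)
    rw [absLoc_inv, inv_le_one₀ (absLoc_unit_pos _)] at a2 d2
    exact ⟨le_antisymm a1 a2, le_antisymm d1 d2, x1⟩
  · rintro ⟨ha, hd, hx⟩
    refine ⟨fun i j => ?_, fun i j => ?_⟩
    · rw [E.mem_order_iff]
      fin_cases i <;> fin_cases j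
      · exact ha.le
      · exact hx
      · exact E.absLoc_zero.le.trans zero_le_one
      · exact hd.le
    · rw [E.mem_order_iff]
      fin_cases i <;> fin_cases j
      · change absLoc p ((a⁻¹ : (LocAlg p F)ˣ) : LocAlg p F) ≤ 1
        rw [absLoc_inv, ha, inv_one]
      · change absLoc p (-(((a⁻¹ : (LocAlg p F)ˣ) : LocAlg p F) * x *
          ((d⁻¹ : (LocAlg p F)ˣ) : LocAlg p F))) ≤ 1
        rw [absLoc_neg, absLoc_mul, absLoc_mul, absLoc_inv, absLoc_inv, ha, hd]
        simpa using hx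
      · exact E.absLoc_zero.le.trans zero_le_one
      · change absLoc p ((d⁻¹ : (LocAlg p F)ˣ) : LocAlg p F) ≤ 1
        rw [absLoc_inv, hd, inv_one]

theorem mem_integralGL_of_det {g : GL (Fin 2) (LocAlg p F)}
    (hg : (g : Matrix (Fin 2) (Fin 2) (LocAlg p F)) ∈ integralMatrices p F)
    (hdet : absLoc p (g : Matrix (Fin 2) (Fin 2) (LocAlg p F)).det = 1) :
    g ∈ integralGL p F := by
  refine mem_integralGL.mpr ⟨hg, fun i j => ?_⟩
  set M := (g : Matrix (Fin 2) (Fin 2) (LocAlg p F)) with hM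
  have h1 : ((g⁻¹ : GL (Fin 2) (LocAlg p F)) : Matrix (Fin 2) (Fin 2) (LocAlg p F)) * M = 1 := by
    rw [hM, ← Units.val_mul, inv_mul_cancel, Units.val_one]
  have hadj : ∀ i j, absLoc p (M.adjugate i j) ≤ 1 := by
    intro i j
    rw [Matrix.adjugate_fin_two]
    fin_cases i <;> fin_cases j
    · exact (E.mem_order_iff _).mp (hg 1 1)
    · exact (absLoc_neg _).le.trans ((E.mem_order_iff _).mp (hg 0 1))
    · exact (absLoc_neg _).le.trans ((E.mem_order_iff _).mp (hg 1 0))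
    · exact (E.mem_order_iff _).mp (hg 0 0)
  have h2 : M.det • ((g⁻¹ : GL (Fin 2) (LocAlg p F)) : Matrix (Fin 2) (Fin 2) (LocAlg p F))
      = M.adjugate := by
    calc _ = ((g⁻¹ : GL (Fin 2) (LocAlg p F)) : Matrix (Fin 2) (Fin 2) (LocAlg p F)) *
          (M * M.adjugate) := by rw [Matrix.mul_adjugate, Matrix.mul_smul, mul_one]
      _ = M.adjugate := by rw [← mul_assoc, h1, one_mul]
  have h3 := congrArg (absLoc p) (congrFun (congrFun h2 i) j)
  rw [Matrix.smul_apply, smul_eq_mul, absLoc_mul, hdet, one_mul] at h3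
  rw [E.mem_order_iff, h3]
  exact hadj i j

theorem absLoc_det_of_mem {g : GL (Fin 2) (LocAlg p F)} (hg : g ∈ integralGL p F) :
    absLoc p (g : Matrix (Fin 2) (Fin 2) (LocAlg p F)).det = 1 := by
  have key : ∀ k ∈ integralGL p F, absLoc p (k : Matrix (Fin 2) (Fin 2) (LocAlg p F)).det ≤ 1 := by
    intro k hk
    have hk1 := (mem_integralGL.mp hk).1
    rw [← E.mem_order_iff, Matrix.det_fin_two]
    exact Subring.sub_mem _ (Subring.mul_mem _ (hk1 _ _) (hk1 _ _))
      (Subring.mul_mem _ (hk1 _ _) (hk1 _ _))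
  have h1 := key g hg
  have h2 := key g⁻¹ (inv_mem hg)
  have h3 : absLoc p (g : Matrix (Fin 2) (Fin 2) (LocAlg p F)).det *
      absLoc p ((g⁻¹ : GL (Fin 2) (LocAlg p F)) : Matrix (Fin 2) (Fin 2) (LocAlg p F)).det = 1 := by
    rw [← absLoc_mul, ← Matrix.det_mul, ← Units.val_mul, mul_inv_cancel, Units.val_one,
      Matrix.det_one, absLoc_one]
  nlinarith [absLoc_nonneg (g : Matrix (Fin 2) (Fin 2) (LocAlg p F)).det]

theorem lower_mem {w : LocAlg p F} (hw : absLoc p w ≤ 1) :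
    swapGL * upper p 1 1 w * swapGL ∈ integralGL p F :=
  mul_mem (mul_mem swapGL_mem (E.upper_mem_iff.mpr ⟨absLoc_one, absLoc_one, hw⟩)) swapGL_mem

/-- The Iwasawa decomposition of `GL₂(F_p)`. -/
theorem exists_iwasawa (g : GL (Fin 2) (LocAlg p F)) :
    ∃ (a d : (LocAlg p F)ˣ) (x : LocAlg p F), ∃ k ∈ integralGL p F, g = upper p a d x * k := by
  have key : ∀ g : GL (Fin 2) (LocAlg p F), absLoc p (g 1 0) ≤ absLoc p (g 1 1) →
      ∃ (a d : (LocAlg p F)ˣ) (x : LocAlg p F), ∃ k ∈ integralGL p F, g = upper p a d x * k := by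
    intro g hg
    have hdet : IsUnit (g : Matrix (Fin 2) (Fin 2) (LocAlg p F)).det :=
      (Matrix.isUnit_iff_isUnit_det _).mp g.isUnit
    have h11 : g 1 1 ≠ 0 := by
      intro h
      rw [h, E.absLoc_zero] at hg
      have h10 := E.absLoc_eq_zero (le_antisymm hg (absLoc_nonneg _))
      rw [Matrix.det_fin_two, h, h10, mul_zero, mul_zero, sub_zero, isUnit_iff_exists] at hdet
      obtain ⟨y, hy, -⟩ := hdet
      rw [zero_mul] at hy
      have := congrArg (absLoc p) hy
      rw [absLoc_one, E.absLoc_zero] at this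
      exact zero_ne_one this
    obtain ⟨d, hd⟩ := E.isUnit_of_ne_zero h11
    rw [← hd] at hg
    obtain ⟨w, hw, hgw⟩ := exists_eq_unit_mul d hg
    have ha : IsUnit (g 0 0 - g 0 1 * w) := by
      rw [Matrix.det_fin_two, ← hd, hgw] at hdet
      have e : g 0 0 * d - g 0 1 * (d * w) = (g 0 0 - g 0 1 * w) * d := by ring
      rw [e] at hdet
      exact isUnit_of_mul_isUnit_left hdet
    obtain ⟨a, ha⟩ := ha
    refine ⟨a, d, g 0 1, _, E.lower_mem hw, ?_⟩
    apply Units.ext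
    rw [Units.val_mul, lower_val]
    change _ = !![(a : LocAlg p F), g 0 1; 0, (d : LocAlg p F)] * _
    rw [Matrix.mul_fin_two]
    ext i j
    fin_cases i <;> fin_cases j
    · simp [ha]
    · simp
    · simp [hgw]
    · simp [hd]
  rcases le_total (absLoc p (g 1 0)) (absLoc p (g 1 1)) with h | h
  · exact key g h
  · have e := mul_swapGL_apply g
    obtain ⟨a, d, x, k, hk, hg⟩ := key (g * swapGL) (by rw [(e 1).1, (e 1).2]; exact h)
    refine ⟨a, d, x, k * swapGL, mul_mem hk swapGL_mem, ?_⟩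
    rw [← mul_assoc, ← hg, mul_assoc, swapGL_mul_self, mul_one]

/-- The Cartan decomposition of a primitive integral matrix. -/
theorem exists_cartan (g : GL (Fin 2) (LocAlg p F))
    (hg : (g : Matrix (Fin 2) (Fin 2) (LocAlg p F)) ∈ integralMatrices p F)
    (hprim : ∃ i j, absLoc p (g i j) = 1) :
    ∃ k₁ ∈ integralGL p F, ∃ k₂ ∈ integralGL p F, ∃ d : (LocAlg p F)ˣ,
      g = k₁ * upper p 1 d 0 * k₂ := by
  have key : ∀ g : GL (Fin 2) (LocAlg p F),
      (g : Matrix (Fin 2) (Fin 2) (LocAlg p F)) ∈ integralMatrices p F → absLoc p (g 0 0) = 1 →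
      ∃ k₁ ∈ integralGL p F, ∃ k₂ ∈ integralGL p F, ∃ d : (LocAlg p F)ˣ,
        g = k₁ * upper p 1 d 0 * k₂ := by
    intro g hg h00
    obtain ⟨a, ha⟩ := E.isUnit_of_ne_zero (E.ne_zero_of_absLoc (h00 ▸ zero_lt_one))
    have hdet : IsUnit (g : Matrix (Fin 2) (Fin 2) (LocAlg p F)).det :=
      (Matrix.isUnit_iff_isUnit_det _).mp g.isUnit
    obtain ⟨w, hw, hgw⟩ := exists_eq_unit_mul (x := g 1 0) a (by
      rw [ha, h00]; exact (E.mem_order_iff _).mp (hg 1 0))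
    have hd : IsUnit (g 1 1 - w * g 0 1) := by
      rw [Matrix.det_fin_two, ← ha, hgw] at hdet
      have e : a * g 1 1 - g 0 1 * (a * w) = a * (g 1 1 - w * g 0 1) := by ring
      rw [e] at hdet
      exact isUnit_of_mul_isUnit_right hdet
    obtain ⟨d, hd⟩ := hd
    refine ⟨_, E.lower_mem hw, upper p a 1 (g 0 1), E.upper_mem_iff.mpr
      ⟨by rw [ha, h00], absLoc_one, (E.mem_order_iff _).mp (hg 0 1)⟩, d, ?_⟩
    apply Units.ext
    rw [Units.val_mul, Units.val_mul, lower_val]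
    change _ = _ * !![((1 : (LocAlg p F)ˣ) : LocAlg p F), 0; 0, (d : LocAlg p F)] *
      !![(a : LocAlg p F), g 0 1; 0, ((1 : (LocAlg p F)ˣ) : LocAlg p F)]
    rw [Matrix.mul_fin_two, Matrix.mul_fin_two]
    ext i j
    fin_cases i <;> fin_cases j
    · simp [ha]
    · simp
    · simp [hgw, mul_comm]
    · simp [hd]
  have hs : ((swapGL : GL (Fin 2) (LocAlg p F)) : Matrix (Fin 2) (Fin 2) (LocAlg p F)) ∈ integralMatrices p F :=
    (mem_integralGL.mp swapGL_mem).1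
  have hR : ∀ g : GL (Fin 2) (LocAlg p F),
      (∃ k₁ ∈ integralGL p F, ∃ k₂ ∈ integralGL p F, ∃ d : (LocAlg p F)ˣ,
        g * swapGL = k₁ * upper p 1 d 0 * k₂) →
      ∃ k₁ ∈ integralGL p F, ∃ k₂ ∈ integralGL p F, ∃ d : (LocAlg p F)ˣ,
        g = k₁ * upper p 1 d 0 * k₂ := by
    rintro g ⟨k₁, hk₁, k₂, hk₂, d, h⟩
    refine ⟨k₁, hk₁, k₂ * swapGL, mul_mem hk₂ swapGL_mem, d, ?_⟩
    rw [← mul_assoc, ← h, mul_assoc, swapGL_mul_self, mul_one]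
  have hL : ∀ g : GL (Fin 2) (LocAlg p F),
      (∃ k₁ ∈ integralGL p F, ∃ k₂ ∈ integralGL p F, ∃ d : (LocAlg p F)ˣ,
        swapGL * g = k₁ * upper p 1 d 0 * k₂) →
      ∃ k₁ ∈ integralGL p F, ∃ k₂ ∈ integralGL p F, ∃ d : (LocAlg p F)ˣ,
        g = k₁ * upper p 1 d 0 * k₂ := by
    rintro g ⟨k₁, hk₁, k₂, hk₂, d, h⟩
    refine ⟨swapGL * k₁, mul_mem swapGL_mem hk₁, k₂, hk₂, d, ?_⟩
    rw [mul_assoc, mul_assoc, ← mul_assoc k₁, ← h, ← mul_assoc, swapGL_mul_self, one_mul]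
  have hrow : ∀ g : GL (Fin 2) (LocAlg p F),
      (g : Matrix (Fin 2) (Fin 2) (LocAlg p F)) ∈ integralMatrices p F →
      (∃ j, absLoc p (g 0 j) = 1) →
      ∃ k₁ ∈ integralGL p F, ∃ k₂ ∈ integralGL p F, ∃ d : (LocAlg p F)ˣ,
        g = k₁ * upper p 1 d 0 * k₂ := by
    rintro g hg ⟨j, hj⟩
    fin_cases j
    · exact key g hg hj
    · exact hR g (key _ (mul_mem hg hs) (by rw [(mul_swapGL_apply g 0).1]; exact hj))
  obtain ⟨i, j, hij⟩ := hprim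
  fin_cases i
  · exact hrow g hg ⟨j, hij⟩
  · exact hL g (hrow _ (mul_mem hs hg) ⟨j, by rw [(swapGL_mul_apply g j).1]; exact hij⟩)

end EisensteinGenerator

end GeneralLinear

/-! ### Hecke operators on the unramified principal series -/

/-- If the elements `r j`, for `j ∈ J`, represent the left cosets modulo `K` in a set `M` which is
stable under left translation by `K`, then `∑ j, π (r j) v` is `K`-invariant for every `K`-invariant
vector `v`, because `K` permutes these cosets. -/
theorem sum_coset_representatives_invariant {G ι V : Type*} [Group G] [AddCommGroup V] [Module ℂ V]
    (π : Representation ℂ G V) (K : Subgroup G) (M : Set G)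
    (hM : ∀ k ∈ K, ∀ g ∈ M, k * g ∈ M) (J : Finset ι) (r : ι → G) (hr : ∀ j ∈ J, r j ∈ M)
    (hex : ∀ g ∈ M, ∃ j ∈ J, (r j)⁻¹ * g ∈ K)
    (huniq : ∀ i ∈ J, ∀ j ∈ J, (r i)⁻¹ * r j ∈ K → i = j)
    {v : V} (hv : ∀ k ∈ K, π k v = v) {k : G} (hk : k ∈ K) :
    π k (∑ j ∈ J, π (r j) v) = ∑ j ∈ J, π (r j) v := by
  rw [map_sum]
  choose! s hsJ hsK using fun j (hj : j ∈ J) => hex (k * r j) (hM k hk _ (hr j hj))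
  have hinj : Set.InjOn s J := by
    intro i hi j hj hij
    refine huniq i hi j hj ?_
    have h1 := inv_mem (hsK i hi)
    rw [hij] at h1
    have h2 := mul_mem h1 (hsK j hj)
    have e : ((r (s j))⁻¹ * (k * r i))⁻¹ * ((r (s j))⁻¹ * (k * r j)) = (r i)⁻¹ * r j := by group
    rwa [e] at h2
  refine Finset.sum_nbij s hsJ hinj
    (Finset.surjOn_of_injOn_of_card_le s hsJ hinj le_rfl) fun j hj => ?_
  have e : k * r j = r (s j) * ((r (s j))⁻¹ * (k * r j)) := by group
  rw [← Module.End.mul_apply, ← map_mul, e, map_mul, Module.End.mul_apply, hv _ (hsK j hj)]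

section Hecke

variable {p : ℕ} [hp : Fact p.Prime] {F : Type*} [Field F] [NumberField F]
variable {c : F ≃ₐ[ℚ] F} (E : EisensteinGenerator p c)

variable (p F) in
/-- The integral matrices whose determinant has absolute value `p^{-m}`. -/
def heckeSet (m : ℕ) : Set (GL (Fin 2) (LocAlg p F)) :=
  {g | (g : Matrix (Fin 2) (Fin 2) (LocAlg p F)) ∈ integralMatrices p F ∧
    absLoc p (g : Matrix (Fin 2) (Fin 2) (LocAlg p F)).det = (p : ℝ)⁻¹ ^ m}

theorem det_mul_val (g h : GL (Fin 2) (LocAlg p F)) :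
    ((g * h : GL (Fin 2) (LocAlg p F)) : Matrix (Fin 2) (Fin 2) (LocAlg p F)).det =
      (g : Matrix (Fin 2) (Fin 2) (LocAlg p F)).det *
        (h : Matrix (Fin 2) (Fin 2) (LocAlg p F)).det := by
  rw [Units.val_mul, Matrix.det_mul]

namespace EisensteinGenerator

/-- Indices of the cosets `g GL₂(𝒪)` in `heckeSet p F m`: an exponent `i ≤ m` and a residue modulo
`θ^i`. -/
def heckeIndex (m : ℕ) : Finset (Σ _ : ℕ, LocAlg p F) :=
  (Finset.range (m + 1)).sigma fun i => E.residues i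

/-- The representative `(θ^i x; 0 θ^(m-i))`. -/
def heckeRep (m : ℕ) (j : Σ _ : ℕ, LocAlg p F) : GL (Fin 2) (LocAlg p F) :=
  upper p (E.θu ^ j.1) (E.θu ^ (m - j.1)) j.2

theorem absLoc_θu_pow (i : ℕ) :
    absLoc p ((E.θu ^ i : (LocAlg p F)ˣ) : LocAlg p F) = (p : ℝ)⁻¹ ^ i := by
  rw [Units.val_pow_eq_pow_val, absLoc_pow, E.absLoc_θu]

theorem det_heckeRep {m : ℕ} {j : Σ _ : ℕ, LocAlg p F} (hj : j ∈ E.heckeIndex m) :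
    (E.heckeRep m j : Matrix (Fin 2) (Fin 2) (LocAlg p F)).det = E.θ ^ m := by
  have h1 : j.1 < m + 1 := Finset.mem_range.mp (Finset.mem_sigma.mp hj).1
  unfold heckeRep
  rw [det_upper, ← Units.val_mul, ← pow_add, Nat.add_sub_of_le (by omega), Units.val_pow_eq_pow_val,
    E.val_θu]

theorem heckeRep_mem {m : ℕ} {j : Σ _ : ℕ, LocAlg p F} (hj : j ∈ E.heckeIndex m) :
    E.heckeRep m j ∈ heckeSet p F m := by
  have hq1 : (p : ℝ)⁻¹ < 1 := inv_lt_one_of_one_lt₀ one_lt_p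
  have hq0 : (0 : ℝ) < (p : ℝ)⁻¹ := inv_pos.mpr p_pos
  refine ⟨fun i k => ?_, by rw [E.det_heckeRep hj, absLoc_pow, E.absLoc_θ]⟩
  rw [E.mem_order_iff]
  fin_cases i <;> fin_cases k
  · exact (E.absLoc_θu_pow _).le.trans (pow_le_one₀ hq0.le hq1.le)
  · exact E.absLoc_residues (Finset.mem_sigma.mp hj).2
  · exact E.absLoc_zero.le.trans zero_le_one
  · exact (E.absLoc_θu_pow _).le.trans (pow_le_one₀ hq0.le hq1.le)

include E in
theorem mul_mem_heckeSet {m : ℕ} {k : GL (Fin 2) (LocAlg p F)} (hk : k ∈ integralGL p F)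
    {g : GL (Fin 2) (LocAlg p F)} (hg : g ∈ heckeSet p F m) : k * g ∈ heckeSet p F m := by
  refine ⟨mul_mem (mem_integralGL.mp hk).1 hg.1, ?_⟩
  rw [det_mul_val, absLoc_mul, E.absLoc_det_of_mem hk, one_mul, hg.2]

include E in
theorem mul_mem_heckeSet' {m : ℕ} {k : GL (Fin 2) (LocAlg p F)} (hk : k ∈ integralGL p F)
    {g : GL (Fin 2) (LocAlg p F)} (hg : g ∈ heckeSet p F m) : g * k ∈ heckeSet p F m := by
  refine ⟨mul_mem hg.1 (mem_integralGL.mp hk).1, ?_⟩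
  rw [det_mul_val, absLoc_mul, E.absLoc_det_of_mem hk, mul_one, hg.2]

/-- Every coset in `heckeSet p F m` has an upper triangular representative, by the Iwasawa
decomposition, which is then brought into Hermite normal form. -/
theorem exists_heckeRep {m : ℕ} {g : GL (Fin 2) (LocAlg p F)} (hg : g ∈ heckeSet p F m) :
    ∃ j ∈ E.heckeIndex m, (E.heckeRep m j)⁻¹ * g ∈ integralGL p F := by
  have hp1 := one_lt_p (p := p)
  have hq0 : (0 : ℝ) < (p : ℝ)⁻¹ := inv_pos.mpr p_pos
  have hqp : ∀ i : ℕ, (0 : ℝ) < (p : ℝ)⁻¹ ^ i := fun i => pow_pos hq0 i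
  obtain ⟨a, d, x, k, hk, rfl⟩ := E.exists_iwasawa g
  have hu : upper p a d x ∈ heckeSet p F m := by
    have := E.mul_mem_heckeSet' (inv_mem hk) hg
    rwa [mul_inv_cancel_right] at this
  have hdet := hu.2
  rw [det_upper, absLoc_mul] at hdet
  have ha : absLoc p (a : LocAlg p F) ≤ 1 := (E.mem_order_iff _).mp (hu.1 0 0)
  have hd : absLoc p (d : LocAlg p F) ≤ 1 := (E.mem_order_iff _).mp (hu.1 1 1)
  have hx : absLoc p x ≤ 1 := (E.mem_order_iff _).mp (hu.1 0 1)
  obtain ⟨i, hai, him⟩ : ∃ i : ℕ, absLoc p (a : LocAlg p F) = (p : ℝ)⁻¹ ^ i ∧ i ≤ m := by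
    obtain ⟨u, hu⟩ := exists_absLoc_eq_zpow a
    obtain ⟨v, hv⟩ := exists_absLoc_eq_zpow d
    rw [hu, zpow_le_one_iff_right₀ hp1] at ha
    rw [hv, zpow_le_one_iff_right₀ hp1] at hd
    rw [hu, hv, ← zpow_add₀ (p_pos (p := p)).ne', inv_pow, ← zpow_natCast, ← zpow_neg] at hdet
    have := zpow_right_injective₀ p_pos hp1.ne' hdet
    refine ⟨(-u).toNat, ?_, by omega⟩
    rw [hu, inv_pow, ← zpow_natCast, ← zpow_neg, Int.toNat_of_nonneg (by omega), neg_neg]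
  have hdi : absLoc p (d : LocAlg p F) = (p : ℝ)⁻¹ ^ (m - i) := by
    rw [hai] at hdet
    have : (p : ℝ)⁻¹ ^ m = (p : ℝ)⁻¹ ^ i * (p : ℝ)⁻¹ ^ (m - i) := by
      rw [← pow_add, Nat.add_sub_of_le him]
    rw [this] at hdet
    exact mul_left_cancel₀ (hqp i).ne' hdet
  -- The residue `y` is chosen so that `x - y θ^(i-m) d` is divisible by `θ^i`.
  set w : (LocAlg p F)ˣ := (E.θu ^ (m - i))⁻¹ * d with hw
  have hw1 : absLoc p (w : LocAlg p F) = 1 := by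
    rw [hw, Units.val_mul, absLoc_mul, absLoc_inv, E.absLoc_θu_pow, hdi,
      inv_mul_cancel₀ (hqp _).ne']
  obtain ⟨y, hy, hxy⟩ := E.exists_residue i
    (z := x * ((w⁻¹ : (LocAlg p F)ˣ) : LocAlg p F)) (by
      rw [absLoc_mul, absLoc_inv, hw1, inv_one, mul_one]; exact hx)
  refine ⟨⟨i, y⟩, Finset.mem_sigma.mpr ⟨Finset.mem_range.mpr (Nat.lt_succ_of_le him), hy⟩, ?_⟩
  rw [← mul_assoc]
  refine mul_mem ?_ hk
  unfold heckeRep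
  rw [upper_inv, upper_mul, E.upper_mem_iff]
  refine ⟨?_, hw1, ?_⟩
  · rw [Units.val_mul, absLoc_mul, absLoc_inv, E.absLoc_θu_pow, hai, inv_mul_cancel₀ (hqp _).ne']
  · have e : (((E.θu ^ i)⁻¹ : (LocAlg p F)ˣ) : LocAlg p F) * x +
        -((((E.θu ^ i)⁻¹ : (LocAlg p F)ˣ) : LocAlg p F) * y *
          (((E.θu ^ (m - i))⁻¹ : (LocAlg p F)ˣ) : LocAlg p F)) * (d : LocAlg p F) =
        (((E.θu ^ i)⁻¹ : (LocAlg p F)ˣ) : LocAlg p F) *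
          ((x * ((w⁻¹ : (LocAlg p F)ˣ) : LocAlg p F) - y) * (w : LocAlg p F)) := by
      have h1 : (w : LocAlg p F) = (((E.θu ^ (m - i))⁻¹ : (LocAlg p F)ˣ) : LocAlg p F) * d := by
        rw [hw, Units.val_mul]
      have h2 : ((w⁻¹ : (LocAlg p F)ˣ) : LocAlg p F) * (w : LocAlg p F) = 1 := Units.inv_mul w
      rw [h1] at h2 ⊢
      linear_combination -(((E.θu ^ i)⁻¹ : (LocAlg p F)ˣ) : LocAlg p F) * x * h2
    change absLoc p ((((E.θu ^ i)⁻¹ : (LocAlg p F)ˣ) : LocAlg p F) * x +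
        -((((E.θu ^ i)⁻¹ : (LocAlg p F)ˣ) : LocAlg p F) * y *
          (((E.θu ^ (m - i))⁻¹ : (LocAlg p F)ˣ) : LocAlg p F)) * (d : LocAlg p F)) ≤ 1
    rw [e, absLoc_mul, absLoc_mul, hw1, mul_one, absLoc_inv, E.absLoc_θu_pow]
    exact (inv_mul_le_one₀ (hqp i)).mpr hxy

theorem heckeRep_unique {m : ℕ} {i j : Σ _ : ℕ, LocAlg p F} (hi : i ∈ E.heckeIndex m)
    (hj : j ∈ E.heckeIndex m) (h : (E.heckeRep m i)⁻¹ * E.heckeRep m j ∈ integralGL p F) :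
    i = j := by
  have hp1 := one_lt_p (p := p)
  have hq0 : (0 : ℝ) < (p : ℝ)⁻¹ := inv_pos.mpr p_pos
  have hqp : ∀ i : ℕ, (0 : ℝ) < (p : ℝ)⁻¹ ^ i := fun i => pow_pos hq0 i
  obtain ⟨i, x⟩ := i
  obtain ⟨j, y⟩ := j
  have hx : x ∈ E.residues i := (Finset.mem_sigma.mp hi).2
  have hy : y ∈ E.residues j := (Finset.mem_sigma.mp hj).2
  unfold heckeRep at h
  rw [upper_inv, upper_mul, E.upper_mem_iff] at h
  obtain ⟨h1, -, h2⟩ := h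
  have hij : j = i := by
    rw [Units.val_mul, absLoc_mul, absLoc_inv, E.absLoc_θu_pow, E.absLoc_θu_pow,
      inv_mul_eq_one₀ (hqp _).ne'] at h1
    exact (pow_right_injective₀ hq0 (inv_lt_one_of_one_lt₀ hp1).ne h1).symm
  subst hij
  have e : (((E.θu ^ j)⁻¹ : (LocAlg p F)ˣ) : LocAlg p F) * y +
        -((((E.θu ^ j)⁻¹ : (LocAlg p F)ˣ) : LocAlg p F) * x *
          (((E.θu ^ (m - j))⁻¹ : (LocAlg p F)ˣ) : LocAlg p F)) *
          ((E.θu ^ (m - j) : (LocAlg p F)ˣ) : LocAlg p F) =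
        -(((E.θu ^ j)⁻¹ : (LocAlg p F)ˣ) : LocAlg p F) * (x - y) := by
    have h3 := Units.inv_mul (E.θu ^ (m - j))
    linear_combination -(((E.θu ^ j)⁻¹ : (LocAlg p F)ˣ) : LocAlg p F) * x * h3
  simp only at h2
  rw [e, absLoc_mul, absLoc_neg, absLoc_inv, E.absLoc_θu_pow] at h2
  rw [E.residue_unique hx hy ((inv_mul_le_one₀ (hqp j)).mp h2)]

theorem sum_heckeIndex {V : Type*} [AddCommMonoid V] (m : ℕ) (u : ℕ → V) :
    ∑ j ∈ E.heckeIndex m, u j.1 = ∑ i ∈ Finset.range (m + 1), p ^ i • u i := by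
  unfold heckeIndex
  rw [Finset.sum_sigma]
  refine Finset.sum_congr rfl fun i _ => ?_
  change ∑ _ ∈ E.residues i, u i = _
  rw [Finset.sum_const, E.card_residues]

/-- A primitive matrix in `heckeSet p F m` lies in `K diag(1, θ^m) K`. -/
theorem exists_cartan_θ {m : ℕ} {g : GL (Fin 2) (LocAlg p F)} (hg : g ∈ heckeSet p F m)
    (hprim : ∃ i j, absLoc p (g i j) = 1) :
    ∃ k₁ ∈ integralGL p F, ∃ k₂ ∈ integralGL p F, g = k₁ * upper p 1 (E.θu ^ m) 0 * k₂ := by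
  obtain ⟨k₁, hk₁, k₂, hk₂, d, rfl⟩ := E.exists_cartan g hg.1 hprim
  have hd : absLoc p (d : LocAlg p F) = (p : ℝ)⁻¹ ^ m := by
    have h := hg.2
    rwa [det_mul_val, det_mul_val, det_upper, absLoc_mul, absLoc_mul, E.absLoc_det_of_mem hk₁,
      E.absLoc_det_of_mem hk₂, Units.val_one, one_mul, one_mul, mul_one] at h
  refine ⟨k₁, hk₁, upper p 1 ((E.θu ^ m)⁻¹ * d) 0 * k₂,
    mul_mem (E.upper_mem_iff.mpr ⟨absLoc_one, ?_, E.absLoc_zero.le.trans zero_le_one⟩) hk₂, ?_⟩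
  · rw [Units.val_mul, absLoc_mul, absLoc_inv, E.absLoc_θu_pow, hd, inv_mul_cancel₀]
    exact (pow_pos (inv_pos.mpr p_pos) m).ne'
  · rw [← mul_assoc, mul_assoc k₁ (upper p 1 (E.θu ^ m) 0), upper_mul, mul_inv_cancel_left,
      one_mul, zero_mul, mul_zero, add_zero]

end EisensteinGenerator

/-! ### The eigenvalues of the Hecke operators -/

section Eigenvalue

variable {μ ν : (LocAlg p F)ˣ →* ℂˣ}

/-- The eigenvalue `p^{m/2} ∑ α^i β^{m-i}` of the Hecke operator of degree `m` on the spherical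
vector with Satake parameters `α, β`. -/
def heckeEigenvalue (p : ℕ) (α β : ℂ) (m : ℕ) : ℂ :=
  (Real.sqrt p : ℂ) ^ m * ∑ i ∈ Finset.range (m + 1), α ^ i * β ^ (m - i)

theorem sqrt_identity {i m : ℕ} (h : i ≤ m) :
    (p : ℝ) ^ i * Real.sqrt ((p : ℝ)⁻¹ ^ i / (p : ℝ)⁻¹ ^ (m - i)) = Real.sqrt p ^ m := by
  have hp0 := p_pos (p := p)
  have hs : 0 < Real.sqrt p := Real.sqrt_pos.mpr hp0
  have hp2 : (p : ℝ) = Real.sqrt p ^ 2 := (Real.sq_sqrt hp0.le).symm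
  obtain ⟨l, rfl⟩ := Nat.exists_eq_add_of_le h
  rw [Nat.add_sub_cancel_left]
  generalize Real.sqrt p = s at hs hp2
  rw [hp2]
  have e : ((s ^ 2)⁻¹ ^ i / (s ^ 2)⁻¹ ^ l) = (s ^ l / s ^ i) ^ 2 := by
    simp only [inv_pow]
    field_simp
    ring
  rw [e, Real.sqrt_sq (by positivity)]
  field_simp
  ring

/-- The Hecke operator of degree `m`, evaluated at the identity: the transformation law on the left
determines the values at the upper triangular representatives. -/
theorem sum_heckeRep_apply (φ : principalSeriesSpace p μ ν) (m : ℕ) :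
    ∑ j ∈ E.heckeIndex m, φ.1 (E.heckeRep m j) =
      heckeEigenvalue p (μ E.θu) (ν E.θu) m * φ.1 1 := by
  have h : ∀ j ∈ E.heckeIndex m, φ.1 (E.heckeRep m j) =
      (fun i => (μ E.θu : ℂ) ^ i * (ν E.θu : ℂ) ^ (m - i) *
        (Real.sqrt ((p : ℝ)⁻¹ ^ i / (p : ℝ)⁻¹ ^ (m - i)) : ℂ) * φ.1 1) j.1 := by
    intro j _
    have := φ.2.1 (E.θu ^ j.1) (E.θu ^ (m - j.1)) j.2 1
    rw [mul_one, E.absLoc_θu_pow, E.absLoc_θu_pow, map_pow, map_pow, Units.val_pow_eq_pow_val,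
      Units.val_pow_eq_pow_val] at this
    exact this
  rw [Finset.sum_congr rfl h, E.sum_heckeIndex m (fun i => (μ E.θu : ℂ) ^ i * (ν E.θu : ℂ) ^ (m - i) *
        (Real.sqrt ((p : ℝ)⁻¹ ^ i / (p : ℝ)⁻¹ ^ (m - i)) : ℂ) * φ.1 1), heckeEigenvalue,
    Finset.mul_sum, Finset.sum_mul]
  refine Finset.sum_congr rfl fun i hi => ?_
  rw [← Complex.ofReal_pow, ← sqrt_identity (p := p) (Nat.lt_succ_iff.mp (Finset.mem_range.mp hi)),
    nsmul_eq_mul]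
  push_cast
  ring

variable {V : Type*} [AddCommGroup V] [Module ℂ V] {π : Representation ℂ (GL (Fin 2) (LocAlg p F)) V}
  {e : V ≃ₗ[ℂ] principalSeriesSpace p μ ν}

theorem apply_mul_of_invariant (he : ∀ g v, e (π g v) = principalSeries p μ ν g (e v)) {v : V}
    {k : GL (Fin 2) (LocAlg p F)} (hk : π k v = v) (g : GL (Fin 2) (LocAlg p F)) :
    (e v).1 (g * k) = (e v).1 g := by
  have h : principalSeries p μ ν k (e v) = e v := by rw [← he, hk]
  exact congrFun (congrArg Subtype.val h) g

include E in
/-- By the Iwasawa decomposition, the spherical vectors of a principal series representation form a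
space of dimension at most one. -/
theorem spherical_proportional (he : ∀ g v, e (π g v) = principalSeries p μ ν g (e v)) {v w : V}
    (hv : ∀ k ∈ integralGL p F, π k v = v) (hw : ∀ k ∈ integralGL p F, π k w = w) :
    (e v).1 1 • w = (e w).1 1 • v := by
  apply e.injective
  rw [map_smul, map_smul]
  apply Subtype.ext
  funext g
  change (e v).1 1 * (e w).1 g = (e w).1 1 * (e v).1 g
  obtain ⟨a, d, x, k, hk, rfl⟩ := E.exists_iwasawa g
  rw [apply_mul_of_invariant he (hv k hk), apply_mul_of_invariant he (hw k hk)]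
  have h1 := (e v).2.1 a d x 1
  have h2 := (e w).2.1 a d x 1
  rw [mul_one] at h1 h2
  rw [h1, h2]
  ring

include E in
theorem apply_one_ne_zero (he : ∀ g v, e (π g v) = principalSeries p μ ν g (e v)) {v : V}
    (hv : ∀ k ∈ integralGL p F, π k v = v) (hv0 : v ≠ 0) : (e v).1 1 ≠ 0 := by
  intro h
  apply hv0
  apply e.injective
  rw [map_zero]
  apply Subtype.ext
  funext g
  obtain ⟨a, d, x, k, hk, rfl⟩ := E.exists_iwasawa g
  rw [apply_mul_of_invariant he (hv k hk)]
  have h1 := (e v).2.1 a d x 1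
  rw [mul_one, h, mul_zero] at h1
  exact h1

/-- The spherical vector is an eigenvector of the Hecke operator of degree `m`. The eigenvalue is found
by evaluation at the identity. -/
theorem hecke_eigenvector (he : ∀ g v, e (π g v) = principalSeries p μ ν g (e v)) {v : V}
    (hv : ∀ k ∈ integralGL p F, π k v = v) (hv0 : v ≠ 0) (m : ℕ) :
    ∑ j ∈ E.heckeIndex m, π (E.heckeRep m j) v =
      heckeEigenvalue p (μ E.θu) (ν E.θu) m • v := by
  have hinv : ∀ k ∈ integralGL p F, π k (∑ j ∈ E.heckeIndex m, π (E.heckeRep m j) v) =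
      ∑ j ∈ E.heckeIndex m, π (E.heckeRep m j) v := fun k hk =>
    sum_coset_representatives_invariant π (integralGL p F) (heckeSet p F m)
      (fun k hk g hg => E.mul_mem_heckeSet hk hg) _ _ (fun j hj => E.heckeRep_mem hj)
      (fun g hg => E.exists_heckeRep hg) (fun i hi j hj h => E.heckeRep_unique hi hj h) hv hk
  have h1 := spherical_proportional E he hv hinv
  have h2 : (e (∑ j ∈ E.heckeIndex m, π (E.heckeRep m j) v)).1 1 =
      heckeEigenvalue p (μ E.θu) (ν E.θu) m * (e v).1 1 := by
    rw [← sum_heckeRep_apply E (e v) m, map_sum, AddSubmonoidClass.coe_finsetSum, Finset.sum_apply]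
    refine Finset.sum_congr rfl fun j _ => ?_
    rw [he]
    change (e v).1 (1 * _) = _
    rw [one_mul]
  have h0 := apply_one_ne_zero E he hv hv0
  rw [h2, mul_comm, mul_smul] at h1
  exact smul_right_injective V h0 h1

include E in
theorem mul_eq_one_of_trivialCentralChar (he : ∀ g v, e (π g v) = principalSeries p μ ν g (e v))
    {v : V} (hv : ∀ k ∈ integralGL p F, π k v = v) (hv0 : v ≠ 0) (hπ : TrivialCentralChar p π)
    (z : (LocAlg p F)ˣ) : (μ z : ℂ) * (ν z : ℂ) = 1 := by
  have h0 := apply_one_ne_zero E he hv hv0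
  have h1 : (e v).1 (1 * (centralEmb p F z).1) = (e v).1 1 :=
    apply_mul_of_invariant he (by rw [hπ]; rfl) 1
  have h2 : (centralEmb p F z).1 = upper p z z 0 := by
    apply Units.ext
    change Matrix.scalar (Fin 2) (z : LocAlg p F) = !![(z : LocAlg p F), 0; 0, (z : LocAlg p F)]
    ext i j
    fin_cases i <;> fin_cases j <;> simp
  have h3 := (e v).2.1 z z 0 1
  rw [mul_one, ← h2, ← one_mul (centralEmb p F z).1, h1, div_self (absLoc_unit_pos z).ne',
    Real.sqrt_one, Complex.ofReal_one, mul_one] at h3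
  exact (mul_eq_right₀ h0).mp h3.symm

end Eigenvalue

end Hecke

/-! ### Bounds for the Satake parameters -/

/-- If `α` is a root of `X² - r X + 1` with `r` real and `|r| ≤ s + s⁻¹` for some `s > 1`, then
`|α| < s` unless `α² = s²`. -/
theorem norm_lt_of_add_real {α β : ℂ} (hαβ : α * β = 1) {s : ℝ} (hs : 1 < s)
    (him : (α + β).im = 0) (hre : |(α + β).re| ≤ s + s⁻¹) (hne : α ^ 2 ≠ (s : ℂ) ^ 2) :
    ‖α‖ < s := by
  by_contra! h
  have hα0 : α ≠ 0 := left_ne_zero_of_mul_eq_one hαβ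
  have hβ : β = α⁻¹ := eq_inv_of_mul_eq_one_right hαβ
  have hN : 1 < Complex.normSq α := by
    rw [Complex.normSq_eq_norm_sq]
    exact one_lt_pow₀ (hs.trans_le h) two_ne_zero
  have hi : α.im = 0 := by
    rw [hβ, Complex.add_im, Complex.inv_im] at him
    have : α.im * (Complex.normSq α - 1) = 0 := by
      field_simp at him
      linarith
    rcases mul_eq_zero.mp this with h | h
    · exact h
    · linarith
  obtain ⟨a, rfl⟩ : ∃ a : ℝ, (a : ℂ) = α := ⟨α.re, Complex.ext rfl (by simp [hi])⟩
  rw [hβ, ← Complex.ofReal_inv, ← Complex.ofReal_add, Complex.ofReal_re] at hre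
  rw [Complex.norm_real, Real.norm_eq_abs] at h
  have hs0 : 0 < s := one_pos.trans hs
  have h1 : |a + a⁻¹| = |a| + |a|⁻¹ := by
    have ha0 : a ≠ 0 := by exact_mod_cast hα0
    rw [← abs_inv]
    rcases lt_or_gt_of_ne ha0 with h | h
    · rw [abs_of_neg h, abs_of_neg (inv_neg''.mpr h), abs_of_neg (add_neg h (inv_neg''.mpr h))]
      ring
    · rw [abs_of_pos h, abs_of_pos (inv_pos.mpr h), abs_of_pos (add_pos h (inv_pos.mpr h))]
  rw [h1] at hre
  have hx : 0 < |a| := hs0.trans_le h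
  have h2 : (|a| - s) * (|a| * s - 1) ≤ 0 := by
    have : (|a| + |a|⁻¹) * (|a| * s) ≤ (s + s⁻¹) * (|a| * s) :=
      mul_le_mul_of_nonneg_right hre (by positivity)
    have e1 : (|a| + |a|⁻¹) * (|a| * s) = |a| ^ 2 * s + s := by field_simp
    have e2 : (s + s⁻¹) * (|a| * s) = |a| * s ^ 2 + |a| := by field_simp
    nlinarith
  have h3 : 0 < |a| * s - 1 := by nlinarith
  have h4 : |a| = s := by
    by_contra h5
    have : 0 < |a| - s := sub_pos.mpr (lt_of_le_of_ne h (Ne.symm h5))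
    nlinarith [mul_pos this h3]
  apply hne
  rw [← h4, ← Complex.ofReal_pow, ← Complex.ofReal_pow, sq_abs]

section Unitarity

variable {p : ℕ} [hp : Fact p.Prime] {F : Type*} [Field F] [NumberField F]
variable {c : F ≃ₐ[ℚ] F} (E : EisensteinGenerator p c)
variable {μ ν : (LocAlg p F)ˣ →* ℂˣ}
variable {V : Type*} [AddCommGroup V] [Module ℂ V] {π : Representation ℂ (GL (Fin 2) (LocAlg p F)) V}

/-- A matrix coefficient of a spherical vector with respect to an invariant form is invariant under
`GL₂(𝒪)` on both sides. -/
theorem matrixCoeff_mul_mul {B : V →ₗ[ℂ] V →ₗ⋆[ℂ] ℂ} (hB : ∀ g v w, B (π g v) (π g w) = B v w)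
    {v : V} (hv : ∀ k ∈ integralGL p F, π k v = v) {k₁ k₂ : GL (Fin 2) (LocAlg p F)}
    (hk₁ : k₁ ∈ integralGL p F) (hk₂ : k₂ ∈ integralGL p F) (g : GL (Fin 2) (LocAlg p F)) :
    B (π (k₁ * g * k₂) v) v = B (π g v) v := by
  rw [map_mul, map_mul, Module.End.mul_apply, Module.End.mul_apply, hv k₂ hk₂]
  conv_lhs => rw [← hv k₁ hk₁]
  rw [hv k₁ hk₁]
  conv_lhs => rw [show v = π k₁ v from (hv k₁ hk₁).symm]
  rw [hB, hv k₁ hk₁]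

/-- The Hecke operator of degree one is self-adjoint with respect to an invariant Hermitian form, so
its eigenvalue is real, and it is bounded by the number `p + 1` of cosets. -/
theorem heckeEigenvalue_one_real {B : V →ₗ[ℂ] V →ₗ⋆[ℂ] ℂ}
    (hB : ∀ g v w, B (π g v) (π g w) = B v w) (hsymm : ∀ v w, conj (B v w) = B w v)
    (hpos : ∀ v, v ≠ 0 → 0 < (B v v).re) (hπ : TrivialCentralChar p π)
    {v : V} (hv : ∀ k ∈ integralGL p F, π k v = v) (hv0 : v ≠ 0) {l : ℂ}
    (hl : ∑ j ∈ E.heckeIndex 1, π (E.heckeRep 1 j) v = l • v) :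
    l.im = 0 ∧ |l.re| ≤ p + 1 := by
  set g := upper p (1 : (LocAlg p F)ˣ) (E.θu ^ 1) 0 with hg
  set x := B (π g v) v with hx
  have hcoef : ∀ j ∈ E.heckeIndex 1, B (π (E.heckeRep 1 j) v) v = x := by
    intro j hj
    obtain ⟨k₁, hk₁, k₂, hk₂, h⟩ := E.exists_cartan_θ (E.heckeRep_mem hj) (by
      have h1 : j.1 < 2 := Finset.mem_range.mp (Finset.mem_sigma.mp hj).1
      rcases (by omega : j.1 = 0 ∨ j.1 = 1) with h | h
      · refine ⟨0, 0, ?_⟩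
        change absLoc p ((E.θu ^ j.1 : (LocAlg p F)ˣ) : LocAlg p F) = 1
        rw [h, pow_zero, Units.val_one, absLoc_one]
      · refine ⟨1, 1, ?_⟩
        change absLoc p ((E.θu ^ (1 - j.1) : (LocAlg p F)ˣ) : LocAlg p F) = 1
        rw [h, Nat.sub_self, pow_zero, Units.val_one, absLoc_one])
    rw [h, matrixCoeff_mul_mul hB hv hk₁ hk₂]
  have hself : conj x = x := by
    -- Up to the center, `g⁻¹` is the conjugate of `g` by the permutation matrix.
    have h1 : g⁻¹ = (centralEmb p F E.θu⁻¹).1 * (swapGL * g * swapGL) := by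
      rw [hg, upper_inv]
      apply Units.ext
      change !![((1⁻¹ : (LocAlg p F)ˣ) : LocAlg p F), _; 0, (((E.θu ^ 1)⁻¹ : (LocAlg p F)ˣ) : LocAlg p F)] =
        Matrix.scalar (Fin 2) ((E.θu⁻¹ : (LocAlg p F)ˣ) : LocAlg p F) * (!![0, 1; 1, 0] *
          !![((1 : (LocAlg p F)ˣ) : LocAlg p F), 0; 0, ((E.θu ^ 1 : (LocAlg p F)ˣ) : LocAlg p F)] *
          !![0, 1; 1, 0])
      rw [Matrix.mul_fin_two, Matrix.mul_fin_two]
      ext i j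
      fin_cases i <;> fin_cases j <;> simp
    have h2 : B v (π g v) = B (π g⁻¹ v) v := by
      rw [← hB g (π g⁻¹ v) v, ← Module.End.mul_apply, ← map_mul, mul_inv_cancel, map_one,
        Module.End.one_apply]
    rw [hx, hsymm, h2, h1, map_mul, hπ, one_mul, matrixCoeff_mul_mul hB hv swapGL_mem swapGL_mem]
  have hN : (B v v).im = 0 := Complex.conj_eq_iff_im.mp (hsymm v v)
  have hNpos := hpos v hv0
  have hxim : x.im = 0 := Complex.conj_eq_iff_im.mp hself
  have hlx : l * B v v = ((p + 1 : ℝ) : ℂ) * x := by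
    have h1 := congrArg (fun w => B w v) hl
    simp only [map_sum, map_smul, LinearMap.sum_apply, LinearMap.smul_apply, smul_eq_mul] at h1
    rw [← h1, Finset.sum_congr rfl hcoef, Finset.sum_const]
    have h2 := E.sum_heckeIndex 1 (fun _ => 1)
    rw [Finset.sum_const, smul_eq_mul, mul_one] at h2
    rw [h2, Finset.sum_range_succ, Finset.sum_range_one, nsmul_eq_mul]
    simp only [pow_zero, pow_one, nsmul_eq_mul, mul_one, Nat.cast_one, Nat.cast_add, Nat.cast_id,
      Complex.ofReal_add, Complex.ofReal_natCast, Complex.ofReal_one]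
    ring
  have hbound : |x.re| ≤ (B v v).re := by
    have hnn : ∀ w, 0 ≤ (B w w).re := by
      intro w
      by_cases h : w = 0
      · rw [h]; simp
      · exact (hpos w h).le
    have h1 := hnn (π g v + v)
    have h2 := hnn (π g v - v)
    have h3 : B v (π g v) = x := by rw [← hsymm, ← hx, hself]
    simp only [map_add, map_sub, LinearMap.add_apply, LinearMap.sub_apply, hB, h3, ← hx,
      Complex.add_re, Complex.sub_re] at h1 h2
    rw [abs_le]
    constructor <;> linarith
  have hre := congrArg Complex.re hlx
  have him := congrArg Complex.im hlx
  rw [Complex.mul_re, hN, Complex.re_ofReal_mul] at hre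
  rw [Complex.mul_im, hN, Complex.im_ofReal_mul, hxim] at him
  constructor
  · have : l.im * (B v v).re = 0 := by linarith
    rcases mul_eq_zero.mp this with h | h
    · exact h
    · exact absurd h hNpos.ne'
  · have h1 : |l.re| * (B v v).re = (p + 1) * |x.re| := by
      rw [← abs_of_pos hNpos, ← abs_mul]
      have : l.re * (B v v).re = (p + 1) * x.re := by linarith
      rw [this, abs_mul, abs_of_pos (by positivity : (0 : ℝ) < p + 1)]
    have h2 : |l.re| * (B v v).re ≤ (p + 1) * (B v v).re := by
      rw [h1]
      exact mul_le_mul_of_nonneg_left hbound (by positivity)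
    exact le_of_mul_le_mul_right h2 hNpos

include E in
theorem exists_eq_zpow_mul (z : (LocAlg p F)ˣ) :
    ∃ (k : ℤ) (u : (LocAlg p F)ˣ), z = E.θu ^ k * u ∧ absLoc p (u : LocAlg p F) = 1 := by
  obtain ⟨k, hk⟩ := exists_absLoc_eq_zpow z
  refine ⟨-k, E.θu ^ k * z, by rw [← mul_assoc, ← zpow_add, neg_add_cancel, zpow_zero, one_mul], ?_⟩
  rw [Units.val_mul, absLoc_mul, E.absLoc_θu_zpow, hk, ← zpow_add₀ p_pos.ne', neg_add_cancel,
    zpow_zero]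

include E in
/-- The units of `𝒪` are the elements of absolute value one. -/
theorem unramified_apply_eq_one (hμ : IsUnramified p μ) {u : (LocAlg p F)ˣ}
    (hu : absLoc p (u : LocAlg p F) = 1) : μ u = 1 := by
  refine hμ u ((E.mem_order_iff _).mpr hu.le) ((E.mem_order_iff _).mpr ?_)
  rw [absLoc_inv, hu, inv_one]

/-- The condition `μ ν⁻¹ ≠ |·|^{±1}` in terms of the Satake parameters. -/
theorem regular_sq_ne (hμ : IsUnramified p μ) (hν : IsUnramified p ν) (hμν : IsRegularPair p μ ν)
    (h1 : (μ E.θu : ℂ) * (ν E.θu : ℂ) = 1) :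
    (μ E.θu : ℂ) ^ 2 ≠ (p : ℂ) ∧ (ν E.θu : ℂ) ^ 2 ≠ (p : ℂ) := by
  have hquot : ∀ z : (LocAlg p F)ˣ, ∃ k : ℤ, (μ z : ℂ) / (ν z : ℂ) = ((μ E.θu : ℂ) ^ 2) ^ k ∧
      absLoc p (z : LocAlg p F) = (p : ℝ) ^ (-k) := by
    intro z
    obtain ⟨k, u, rfl, hu⟩ := exists_eq_zpow_mul E z
    refine ⟨k, ?_, ?_⟩
    · rw [map_mul, map_mul, unramified_apply_eq_one E hμ hu, unramified_apply_eq_one E hν hu,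
        mul_one, mul_one, map_zpow, map_zpow, Units.val_zpow_eq_zpow_val,
        Units.val_zpow_eq_zpow_val, ← div_zpow]
      congr 1
      rw [div_eq_iff (Units.ne_zero _), pow_two, mul_assoc, h1, mul_one]
    · rw [Units.val_mul, absLoc_mul, hu, mul_one, E.absLoc_θu_zpow]
  have hpC : (p : ℂ) ≠ 0 := by exact_mod_cast hp.out.ne_zero
  constructor
  · intro h
    refine hμν.2 fun z => ?_
    obtain ⟨k, hk1, hk2⟩ := hquot z
    rw [hk1, hk2, h, zpow_neg]
    push_cast
    rw [inv_inv]
  · intro h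
    have h' : (μ E.θu : ℂ) ^ 2 = (p : ℂ)⁻¹ := by
      apply eq_inv_of_mul_eq_one_left
      rw [← h, ← mul_pow, h1, one_pow]
    refine hμν.1 fun z => ?_
    obtain ⟨k, hk1, hk2⟩ := hquot z
    rw [hk1, hk2, h', inv_zpow, zpow_neg]
    push_cast
    rfl

/-- The Satake parameters of a unitary representation which is not at the edge of the
complementary series have absolute value less than `p^{1/2}`. -/
theorem norm_satake_lt {e : V ≃ₗ[ℂ] principalSeriesSpace p μ ν}
    (he : ∀ g v, e (π g v) = principalSeries p μ ν g (e v))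
    (hμ : IsUnramified p μ) (hν : IsUnramified p ν) (hμν : IsRegularPair p μ ν)
    (hπ : TrivialCentralChar p π) (hunit : IsUnitary p π)
    {v : V} (hv : ∀ k ∈ integralGL p F, π k v = v) (hv0 : v ≠ 0) :
    ‖(μ E.θu : ℂ)‖ < Real.sqrt p ∧ ‖(ν E.θu : ℂ)‖ < Real.sqrt p := by
  obtain ⟨B, hB, hsymm, hpos⟩ := hunit
  have h1 := mul_eq_one_of_trivialCentralChar E he hv hv0 hπ E.θu
  obtain ⟨him, hre⟩ := heckeEigenvalue_one_real E hB hsymm hpos hπ hv hv0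
    (hecke_eigenvector E he hv hv0 1)
  obtain ⟨hne1, hne2⟩ := regular_sq_ne E hμ hν hμν h1
  have hp0 := p_pos (p := p)
  have hs1 : 1 < Real.sqrt p := by
    rw [Real.lt_sqrt zero_le_one, one_pow]; exact one_lt_p
  have hs0 : 0 < Real.sqrt p := one_pos.trans hs1
  have hsq : Real.sqrt p ^ 2 = p := Real.sq_sqrt hp0.le
  have hsqC : ((Real.sqrt p : ℝ) : ℂ) ^ 2 = p := by rw [← Complex.ofReal_pow, hsq]; simp
  have hval : heckeEigenvalue p (μ E.θu) (ν E.θu) 1 =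
      (Real.sqrt p : ℂ) * ((μ E.θu : ℂ) + (ν E.θu : ℂ)) := by
    rw [heckeEigenvalue, Finset.sum_range_succ, Finset.sum_range_one]
    rw [pow_one, pow_zero, pow_one, one_mul, pow_one, Nat.sub_self, pow_zero, mul_one, add_comm]
  rw [hval, Complex.im_ofReal_mul] at him
  rw [hval, Complex.re_ofReal_mul, abs_mul, abs_of_pos hs0] at hre
  have him' : ((μ E.θu : ℂ) + (ν E.θu : ℂ)).im = 0 := by
    rcases mul_eq_zero.mp him with h | h
    · exact absurd h hs0.ne'
    · exact h
  have hre' : |((μ E.θu : ℂ) + (ν E.θu : ℂ)).re| ≤ Real.sqrt p + (Real.sqrt p)⁻¹ := by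
    refine le_of_mul_le_mul_left (hre.trans_eq ?_) hs0
    rw [mul_add, mul_inv_cancel₀ hs0.ne', ← pow_two, hsq]
  refine ⟨norm_lt_of_add_real h1 hs1 him' hre' (by rw [hsqC]; exact hne1),
    norm_lt_of_add_real ((mul_comm _ _).trans h1) hs1 ?_ ?_ (by rw [hsqC]; exact hne2)⟩
  · rw [add_comm]; exact him'
  · rw [add_comm]; exact hre'

end Unitarity

/-! ### Topology of the groups -/

section Topology

variable {p : ℕ} [hp : Fact p.Prime] {F : Type*} [Field F] [NumberField F]
variable {c : F ≃ₐ[ℚ] F} (E : EisensteinGenerator p c)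

instance : ContinuousSMul ℚ_[p] (LocAlg p F) := IsModuleTopology.toContinuousSMul ℚ_[p] _

theorem continuous_algebraMap : Continuous (algebraMap ℚ_[p] (LocAlg p F)) :=
  IsModuleTopology.continuous_of_linearMap (Algebra.linearMap ℚ_[p] (LocAlg p F))

namespace EisensteinGenerator

theorem continuous_coord : Continuous E.coord :=
  IsModuleTopology.continuous_of_linearMap E.coord.toLinearMap

theorem continuous_coord_symm : Continuous E.coord.symm :=
  IsModuleTopology.continuous_of_linearMap E.coord.symm.toLinearMap

include E

theorem t2Space : T2Space (LocAlg p F) :=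
  T2Space.of_injective_continuous E.coord.injective E.continuous_coord

theorem continuous_norm : Continuous fun z : LocAlg p F => Algebra.norm ℚ_[p] z := by
  have h : (fun z : LocAlg p F => Algebra.norm ℚ_[p] z) = fun z =>
      (E.coord z).1 ^ 2 + (E.coord z).1 * (E.coord z).2 * E.t + (E.coord z).2 ^ 2 * E.n := by
    funext z
    conv_lhs => rw [← E.coord.symm_apply_apply z, E.coord_symm, E.norm_apply]
  rw [h]
  have := E.continuous_coord
  fun_prop

theorem isOpen_order : IsOpen (localOrder p F : Set (LocAlg p F)) := by
  have h : (localOrder p F : Set (LocAlg p F)) =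
      E.coord ⁻¹' (Metric.closedBall 0 1 ×ˢ Metric.closedBall 0 1) := by
    ext z
    simp [E.mem_order]
  rw [h]
  exact ((IsUltrametricDist.isOpen_closedBall 0 one_ne_zero).prod
    (IsUltrametricDist.isOpen_closedBall 0 one_ne_zero)).preimage E.continuous_coord

theorem isCompact_order : IsCompact (localOrder p F : Set (LocAlg p F)) := by
  have h : (localOrder p F : Set (LocAlg p F)) =
      E.coord.symm '' (Metric.closedBall 0 1 ×ˢ Metric.closedBall 0 1) := by
    ext z
    rw [LinearEquiv.image_symm_eq_preimage]
    simp [E.mem_order]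
  rw [h]
  exact ((isCompact_closedBall (0 : ℚ_[p]) 1).prod (isCompact_closedBall 0 1)).image
    E.continuous_coord_symm

theorem isOpen_integralMatrices :
    IsOpen (integralMatrices p F : Set (Matrix (Fin 2) (Fin 2) (LocAlg p F))) := by
  have h : (integralMatrices p F : Set (Matrix (Fin 2) (Fin 2) (LocAlg p F))) =
      ⋂ i, ⋂ j, (fun M => M i j) ⁻¹' (localOrder p F : Set (LocAlg p F)) := by
    ext M
    simp only [Set.mem_iInter]
    rfl
  rw [h]
  exact isOpen_iInter_of_finite fun i => isOpen_iInter_of_finite fun j =>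
    E.isOpen_order.preimage (continuous_id.matrix_elem i j)

theorem isCompact_integralMatrices :
    IsCompact (integralMatrices p F : Set (Matrix (Fin 2) (Fin 2) (LocAlg p F))) := by
  have h : (integralMatrices p F : Set (Matrix (Fin 2) (Fin 2) (LocAlg p F))) =
      Set.univ.pi fun _ => Set.univ.pi fun _ => (localOrder p F : Set (LocAlg p F)) := by
    ext M
    exact ⟨fun h i _ j _ => h i j, fun h i j => h i trivial j trivial⟩
  rw [h]
  exact isCompact_univ_pi fun _ => isCompact_univ_pi fun _ => E.isCompact_order

theorem isOpen_integralGL : IsOpen (integralGL p F : Set (GL (Fin 2) (LocAlg p F))) := by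
  have h : (integralGL p F : Set (GL (Fin 2) (LocAlg p F))) =
      Units.val ⁻¹' (integralMatrices p F : Set (Matrix (Fin 2) (Fin 2) (LocAlg p F))) ∩
      (fun g : GL (Fin 2) (LocAlg p F) => (g⁻¹).val) ⁻¹'
        (integralMatrices p F : Set (Matrix (Fin 2) (Fin 2) (LocAlg p F))) := by
    ext g
    exact Submonoid.mem_units_iff _ _
  rw [h]
  exact (E.isOpen_integralMatrices.preimage Units.continuous_val).inter
    (E.isOpen_integralMatrices.preimage Units.continuous_coe_inv)

theorem isCompact_integralGL : IsCompact (integralGL p F : Set (GL (Fin 2) (LocAlg p F))) := by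
  have := E.t2Space
  exact Submonoid.units_isCompact E.isCompact_integralMatrices

end EisensteinGenerator

end Topology

/-! ### The open compact subgroup of `H⁰₁` -/

section OpenCompact

variable {p : ℕ} [hp : Fact p.Prime] {F : Type*} [Field F] [NumberField F]
variable {c : F ≃ₐ[ℚ] F} (E : EisensteinGenerator p c)

variable (p F) in
/-- The subgroup `(GL₂(𝒪) × ℤ_pˣ) / 𝒪ˣ` of `H⁰(ℚ_p)`. -/
def integralH0 : Subgroup (H0 p F) :=
  ((integralGL p F).prod ((PadicInt.subring p).toSubmonoid.units)).map (QuotientGroup.mk' _)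

theorem mem_units_padicInt {β : ℚ_[p]ˣ} :
    β ∈ (PadicInt.subring p).toSubmonoid.units ↔ ‖(β : ℚ_[p])‖ = 1 := by
  rw [Submonoid.mem_units_iff]
  change ‖(β : ℚ_[p])‖ ≤ 1 ∧ ‖((β⁻¹ : ℚ_[p]ˣ) : ℚ_[p])‖ ≤ 1 ↔ _
  rw [Units.val_inv_eq_inv_val, norm_inv, inv_le_one₀ (norm_pos_iff.mpr β.ne_zero)]
  exact ⟨fun h => le_antisymm h.1 h.2, fun h => ⟨h.le, h.ge⟩⟩

theorem mem_integralH0 {h : H0 p F} : h ∈ integralH0 p F ↔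
    ∃ (r : GL (Fin 2) (LocAlg p F)) (β : ℚ_[p]ˣ), r ∈ integralGL p F ∧ ‖(β : ℚ_[p])‖ = 1 ∧
      QuotientGroup.mk (r, β) = h := by
  constructor
  · rintro ⟨⟨r, β⟩, ⟨hr, hβ⟩, rfl⟩
    exact ⟨r, β, hr, mem_units_padicInt.mp hβ, rfl⟩
  · rintro ⟨r, β, hr, hβ, rfl⟩
    exact ⟨(r, β), ⟨hr, mem_units_padicInt.mpr hβ⟩, rfl⟩

variable (p F) in
/-- The group `𝒰_p`, as a subgroup of `H⁰₁(ℚ_p)`. -/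
def openCompactSubgroup : Subgroup (H01 p F) := (integralH0 p F).subgroupOf (H01 p F)

theorem coe_openCompactSubgroup :
    (openCompactSubgroup p F : Set (H01 p F)) = openCompact p F := by
  ext h
  change (h : H0 p F) ∈ integralH0 p F ↔ _
  rw [mem_integralH0]
  constructor
  · rintro ⟨r, β, hr, hβ, h1⟩
    exact ⟨r, β, mem_integralGL.mp hr, hβ, h1.symm⟩
  · rintro ⟨r, β, hr, hβ, h1⟩
    exact ⟨r, β, mem_integralGL.mpr hr, hβ, h1.symm⟩

theorem isOpen_units_padicInt :
    IsOpen ((PadicInt.subring p).toSubmonoid.units : Set ℚ_[p]ˣ) := by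
  have h : ((PadicInt.subring p).toSubmonoid.units : Set ℚ_[p]ˣ) =
      Units.val ⁻¹' (Metric.sphere (0 : ℚ_[p]) 1) := by
    ext β
    rw [SetLike.mem_coe, mem_units_padicInt]
    simp
  rw [h]
  exact (IsUltrametricDist.isOpen_sphere 0 one_ne_zero).preimage Units.continuous_val

theorem isCompact_units_padicInt :
    IsCompact ((PadicInt.subring p).toSubmonoid.units : Set ℚ_[p]ˣ) := by
  apply Submonoid.units_isCompact
  have h : ((PadicInt.subring p).toSubmonoid : Set ℚ_[p]) = Metric.closedBall 0 1 := by
    ext x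
    simp only [mem_closedBall_zero_iff]
    rfl
  rw [h]
  exact isCompact_closedBall _ _

namespace EisensteinGenerator

include E

theorem isOpen_openCompactSubgroup : IsOpen (openCompactSubgroup p F : Set (H01 p F)) := by
  have h1 : IsOpen (integralH0 p F : Set (H0 p F)) :=
    QuotientGroup.isOpenMap_coe _ (E.isOpen_integralGL.prod isOpen_units_padicInt)
  exact h1.preimage continuous_subtype_val

theorem isCompact_openCompactSubgroup : IsCompact (openCompactSubgroup p F : Set (H01 p F)) := by
  have := E.t2Space
  rw [Topology.IsEmbedding.subtypeVal.isCompact_iff]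
  -- The elements of `GL₂(𝒪) × ℤ_pˣ` with trivial similitude form a closed subset.
  have h : Subtype.val '' (openCompactSubgroup p F : Set (H01 p F)) =
      QuotientGroup.mk '' (((integralGL p F : Set (GL (Fin 2) (LocAlg p F))) ×ˢ
        ((PadicInt.subring p).toSubmonoid.units : Set ℚ_[p]ˣ)) ∩
        {x | Algebra.norm ℚ_[p] (x.1 : Matrix (Fin 2) (Fin 2) (LocAlg p F)).det =
          (x.2 : ℚ_[p]) ^ 2}) := by
    have hsim : ∀ r (β : ℚ_[p]ˣ), (QuotientGroup.mk (r, β) : H0 p F) ∈ H01 p F ↔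
        Algebra.norm ℚ_[p] (r : Matrix (Fin 2) (Fin 2) (LocAlg p F)).det = (β : ℚ_[p]) ^ 2 := by
      intro r β
      change (β ^ 2)⁻¹ * normUnits p F (Matrix.GeneralLinearGroup.det r) = 1 ↔ _
      rw [inv_mul_eq_one, eq_comm, Units.ext_iff]
      rfl
    ext x
    constructor
    · rintro ⟨⟨x, hx⟩, hx', rfl⟩
      obtain ⟨⟨r, β⟩, hrβ, rfl⟩ := hx'
      exact ⟨(r, β), ⟨hrβ, (hsim r β).mp hx⟩, rfl⟩
    · rintro ⟨⟨r, β⟩, ⟨hrβ, h2⟩, rfl⟩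
      exact ⟨⟨_, (hsim r β).mpr h2⟩, ⟨(r, β), hrβ, rfl⟩, rfl⟩
  rw [h]
  refine IsCompact.image (IsCompact.inter_right
    (E.isCompact_integralGL.prod isCompact_units_padicInt) ?_) QuotientGroup.continuous_mk
  refine isClosed_eq ?_ ?_
  · exact E.continuous_norm.comp (Continuous.matrix_det (Units.continuous_val.comp continuous_fst))
  · exact (Units.continuous_val.comp continuous_snd).pow 2

end EisensteinGenerator

end OpenCompact

/-! ### Coordinates on the quadratic space -/

section Coordinates

variable {p : ℕ} [hp : Fact p.Prime] {F : Type*} [Field F] [NumberField F]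
variable {c : F ≃ₐ[ℚ] F} (E : EisensteinGenerator p c)

theorem inv_p_le_norm_two : (p : ℝ)⁻¹ ≤ ‖(2 : ℚ_[p])‖ := by
  have h2 : (2 : ℚ_[p]) = ((2 : ℤ) : ℚ_[p]) := by norm_num
  rw [h2]
  by_cases h : (p : ℤ) ∣ 2
  · have : p ∣ 2 := by exact_mod_cast h
    have hp2 : p = 2 := (Nat.prime_dvd_prime_iff_eq hp.out Nat.prime_two).mp this
    have : ((2 : ℤ) : ℚ_[p]) = (p : ℚ_[p]) := by
      rw [congrArg (Nat.cast : ℕ → ℚ_[p]) hp2]; norm_num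
    rw [this, Padic.norm_p]
  · have h1 : ‖((2 : ℤ) : ℚ_[p])‖ = 1 := by
      refine le_antisymm (Padic.norm_int_le_one _) ?_
      by_contra! h'
      exact h (Padic.norm_intCast_lt_one_iff.mp h')
    rw [h1]
    exact inv_le_one_of_one_le₀ one_lt_p.le

namespace EisensteinGenerator

/-- The trace of `θ` is divisible by `2` in `ℤ_p`, also for `p = 2`, because it is divisible by `p`. -/
theorem norm_half_t : ‖E.t / 2‖ ≤ 1 := by
  rw [norm_div, div_le_one (norm_pos_iff.mpr two_ne_zero)]
  exact E.norm_t.trans inv_p_le_norm_two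

/-- The generator `δ = θ - t / 2` of the elements of trace zero in `𝒪`. -/
def δ : LocAlg p F := E.θ - algebraMap _ _ (E.t / 2)

/-- The square of `δ`. -/
def D : ℚ_[p] := (E.t / 2) ^ 2 - E.n

theorem δ_mul_δ : E.δ * E.δ = algebraMap _ _ E.D := by
  have h : algebraMap ℚ_[p] (LocAlg p F) E.t = algebraMap _ _ (E.t / 2) + algebraMap _ _ (E.t / 2) := by
    rw [← map_add, add_halves]
  have hs := E.sq
  rw [h] at hs
  unfold δ D
  rw [map_sub, map_pow]
  linear_combination hs

theorem galConj_δ : galConj p c E.δ = -E.δ := by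
  have h : algebraMap ℚ_[p] (LocAlg p F) E.t = algebraMap _ _ (E.t / 2) + algebraMap _ _ (E.t / 2) := by
    rw [← map_add, add_halves]
  unfold δ
  rw [map_sub, E.galConj_θ, AlgEquiv.commutes, h]
  ring

theorem norm_four_mul_D : ‖4 * E.D‖ = ‖(NumberField.discr F : ℚ_[p])‖ := by
  rw [E.norm_discr]
  congr 1
  unfold D
  ring

theorem D_ne_zero : E.D ≠ 0 := by
  intro h
  have h1 := E.norm_four_mul_D
  rw [h, mul_zero, norm_zero, eq_comm, norm_eq_zero, Int.cast_eq_zero] at h1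
  exact NumberField.discr_ne_zero F h1

theorem norm_D_le_one : ‖E.D‖ ≤ 1 := by
  unfold D
  rw [sub_eq_add_neg]
  refine (Padic.nonarchimedean _ _).trans (max_le ?_ ?_)
  · rw [norm_pow]
    exact pow_le_one₀ (norm_nonneg _) E.norm_half_t
  · rw [norm_neg, E.norm_n]
    exact inv_le_one_of_one_le₀ one_lt_p.le

/-- The coordinates in the basis `1, δ`. -/
def δcoord (z : LocAlg p F) : ℚ_[p] × ℚ_[p] :=
  ((E.coord z).1 + (E.coord z).2 * (E.t / 2), (E.coord z).2)

theorem δcoord_apply (a b : ℚ_[p]) :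
    E.δcoord (algebraMap _ _ a + algebraMap _ _ b * E.δ) = (a, b) := by
  have h : algebraMap ℚ_[p] (LocAlg p F) a + algebraMap _ _ b * E.δ =
      algebraMap _ _ (a - b * (E.t / 2)) + algebraMap _ _ b * E.θ := by
    unfold δ
    rw [map_sub, map_mul]
    ring
  unfold δcoord
  rw [h, E.coord_apply]
  simp

theorem eq_δcoord (z : LocAlg p F) :
    z = algebraMap _ _ (E.δcoord z).1 + algebraMap _ _ (E.δcoord z).2 * E.δ := by
  conv_lhs => rw [← E.coord.symm_apply_apply z, E.coord_symm]
  unfold δcoord δ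
  rw [map_add, map_mul]
  ring

theorem δcoord_add (z w : LocAlg p F) : E.δcoord (z + w) = E.δcoord z + E.δcoord w := by
  unfold δcoord
  rw [map_add]
  ext <;> simp
  ring

theorem δcoord_smul (r : ℚ_[p]) (z : LocAlg p F) : E.δcoord (r • z) = r • E.δcoord z := by
  unfold δcoord
  rw [map_smul]
  ext <;> simp
  ring

theorem continuous_δcoord : Continuous E.δcoord := by
  have := E.continuous_coord
  unfold δcoord
  fun_prop

/-- The elements `1, δ` form a basis of `𝒪` over `ℤ_p`. -/
theorem mem_order_δ (a b : ℚ_[p]) :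
    algebraMap ℚ_[p] (LocAlg p F) a + algebraMap _ _ b * E.δ ∈ localOrder p F ↔
      ‖a‖ ≤ 1 ∧ ‖b‖ ≤ 1 := by
  have h : algebraMap ℚ_[p] (LocAlg p F) a + algebraMap _ _ b * E.δ =
      algebraMap _ _ (a - b * (E.t / 2)) + algebraMap _ _ b * E.θ := by
    unfold δ
    rw [map_sub, map_mul]
    ring
  rw [h, E.mem_order, E.coord_apply]
  have key : ∀ b : ℚ_[p], ‖b‖ ≤ 1 → ‖b * (E.t / 2)‖ ≤ 1 := fun b hb => by
    rw [norm_mul]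
    exact mul_le_one₀ hb (norm_nonneg _) E.norm_half_t
  constructor
  · rintro ⟨h1, h2⟩
    refine ⟨?_, h2⟩
    have e : a = (a - b * (E.t / 2)) + b * (E.t / 2) := by ring
    rw [e]
    exact (Padic.nonarchimedean _ _).trans (max_le h1 (key b h2))
  · rintro ⟨h1, h2⟩
    refine ⟨?_, h2⟩
    rw [sub_eq_add_neg]
    exact (Padic.nonarchimedean _ _).trans (max_le h1 (by rw [norm_neg]; exact key b h2))

/-- The matrix `(w₀ + w₁ δ, w₂ δ; w₃ δ, w₀ - w₁ δ)`. -/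
def toMatrix (w : Fin 4 → ℚ_[p]) : Matrix (Fin 2) (Fin 2) (LocAlg p F) :=
  !![algebraMap _ _ (w 0) + algebraMap _ _ (w 1) * E.δ, algebraMap _ _ (w 2) * E.δ;
    algebraMap _ _ (w 3) * E.δ, algebraMap _ _ (w 0) - algebraMap _ _ (w 1) * E.δ]

theorem toMatrix_mem (w : Fin 4 → ℚ_[p]) : E.toMatrix w ∈ quadSpace p c := by
  change Matrix.adjugate _ = Matrix.map _ _
  unfold toMatrix
  rw [Matrix.adjugate_fin_two_of]
  ext i j
  fin_cases i <;> fin_cases j <;> simp [E.galConj_δ, sub_eq_add_neg]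

theorem algebraMap_mul_δ_of_galConj {z : LocAlg p F} (hz : galConj p c z = -z) :
    z = algebraMap _ _ (E.δcoord z).2 * E.δ := by
  have h := E.eq_δcoord z
  have h2 := congrArg (galConj p c) h
  rw [hz, map_add, map_mul, AlgEquiv.commutes, AlgEquiv.commutes, E.galConj_δ] at h2
  have h3 : algebraMap ℚ_[p] (LocAlg p F) (2 * (E.δcoord z).1) = 0 := by
    rw [map_mul, map_ofNat]
    linear_combination -h - h2
  rw [map_eq_zero_iff _ E.algebraMap_injective, mul_eq_zero] at h3
  rw [h3.resolve_left two_ne_zero, map_zero, zero_add] at h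
  exact h

/-- The coordinates of `V_p`: its elements are the matrices `E.toMatrix w`. -/
def vcoord : quadSpace p c ≃ₗ[ℚ_[p]] (Fin 4 → ℚ_[p]) where
  toFun x := ![(E.δcoord (x.1 0 0)).1, (E.δcoord (x.1 0 0)).2, (E.δcoord (x.1 0 1)).2,
    (E.δcoord (x.1 1 0)).2]
  map_add' x y := by
    ext i
    fin_cases i <;> simp [E.δcoord_add]
  map_smul' r x := by
    ext i
    fin_cases i <;> simp [E.δcoord_smul]
  invFun w := ⟨E.toMatrix w, E.toMatrix_mem w⟩
  left_inv x := by
    apply Subtype.ext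
    have hx : (x.1).adjugate = (x.1).map (galConj p c) := x.2
    rw [Matrix.adjugate_fin_two] at hx
    have h11 : x.1 1 1 = galConj p c (x.1 0 0) := congrFun (congrFun hx 0) 0
    have h01 : galConj p c (x.1 0 1) = -x.1 0 1 := (congrFun (congrFun hx 0) 1).symm
    have h10 : galConj p c (x.1 1 0) = -x.1 1 0 := (congrFun (congrFun hx 1) 0).symm
    ext i j
    fin_cases i <;> fin_cases j
    · exact (E.eq_δcoord _).symm
    · exact (E.algebraMap_mul_δ_of_galConj h01).symm
    · exact (E.algebraMap_mul_δ_of_galConj h10).symm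
    · change _ = x.1 1 1
      rw [h11]
      conv_rhs => rw [E.eq_δcoord (x.1 0 0), map_add, map_mul, AlgEquiv.commutes,
        AlgEquiv.commutes, E.galConj_δ, mul_neg, ← sub_eq_add_neg]
      rfl
  right_inv w := by
    have h2 : ∀ b : ℚ_[p], (E.δcoord (algebraMap _ _ b * E.δ)).2 = b := by
      intro b
      have := E.δcoord_apply 0 b
      rw [map_zero, zero_add] at this
      rw [this]
    ext i
    fin_cases i
    · change (E.δcoord (algebraMap _ _ (w 0) + algebraMap _ _ (w 1) * E.δ)).1 = _
      rw [E.δcoord_apply]; rfl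
    · change (E.δcoord (algebraMap _ _ (w 0) + algebraMap _ _ (w 1) * E.δ)).2 = _
      rw [E.δcoord_apply]; rfl
    · exact h2 _
    · exact h2 _

theorem vcoord_symm_val (w : Fin 4 → ℚ_[p]) : (E.vcoord.symm w).1 = E.toMatrix w := rfl

theorem continuous_vcoord : Continuous E.vcoord := by
  have hδ := E.continuous_δcoord
  have hm : ∀ i j, Continuous fun x : quadSpace p c => x.1 i j := fun i j =>
    continuous_subtype_val.matrix_elem i j
  refine continuous_pi fun i => ?_
  fin_cases i
  · exact (hδ.comp (hm 0 0)).fst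
  · exact (hδ.comp (hm 0 0)).snd
  · exact (hδ.comp (hm 0 1)).snd
  · exact (hδ.comp (hm 1 0)).snd

theorem continuous_vcoord_symm : Continuous E.vcoord.symm := by
  have ha := continuous_algebraMap (p := p) (F := F)
  refine Continuous.subtype_mk (f := fun w => E.toMatrix w) ?_ _
  refine continuous_matrix fun i j => ?_
  unfold toMatrix
  fin_cases i <;> fin_cases j
  · change Continuous fun w : Fin 4 → ℚ_[p] => algebraMap _ _ (w 0) + algebraMap _ _ (w 1) * E.δ
    fun_prop
  · change Continuous fun w : Fin 4 → ℚ_[p] => algebraMap _ _ (w 2) * E.δ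
    fun_prop
  · change Continuous fun w : Fin 4 → ℚ_[p] => algebraMap _ _ (w 3) * E.δ
    fun_prop
  · change Continuous fun w : Fin 4 → ℚ_[p] => algebraMap _ _ (w 0) - algebraMap _ _ (w 1) * E.δ
    fun_prop

include E in
theorem finrank_locAlg : Module.finrank ℚ_[p] (LocAlg p F) = 2 := by
  rw [E.coord.finrank_eq, Module.finrank_prod, Module.finrank_self]

theorem quadForm_eq (w : Fin 4 → ℚ_[p]) :
    quadForm p c (E.vcoord.symm w) = w 0 ^ 2 - E.D * w 1 ^ 2 - E.D * w 2 * w 3 := by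
  have h : (E.vcoord.symm w).1.det =
      algebraMap _ _ (w 0 ^ 2 - E.D * w 1 ^ 2 - E.D * w 2 * w 3) := by
    rw [vcoord_symm_val, toMatrix, Matrix.det_fin_two_of]
    simp only [map_sub, map_mul, map_pow]
    linear_combination - (algebraMap ℚ_[p] (LocAlg p F) (w 1) ^ 2 +
      algebraMap _ _ (w 2) * algebraMap _ _ (w 3)) * E.δ_mul_δ
  unfold quadForm
  rw [h, Algebra.trace_algebraMap, E.finrank_locAlg, nsmul_eq_mul]
  push_cast
  field_simp

theorem bilin_eq (x y : quadSpace p c) :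
    bilin p c x y = 2 * (E.vcoord x 0 * E.vcoord y 0) - 2 * E.D * (E.vcoord x 1 * E.vcoord y 1) -
      E.D * (E.vcoord x 2 * E.vcoord y 3 + E.vcoord x 3 * E.vcoord y 2) := by
  have h : ∀ z, quadForm p c z = E.vcoord z 0 ^ 2 - E.D * E.vcoord z 1 ^ 2 -
      E.D * E.vcoord z 2 * E.vcoord z 3 := fun z => by
    rw [← E.quadForm_eq, LinearEquiv.symm_apply_apply]
  unfold bilin
  rw [h, h, h, map_add]
  simp only [Pi.add_apply]
  ring

/-- The lattice of the points of `V_p` whose coordinates lie in `s₀ ℤ_p, …, s₃ ℤ_p`. -/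
def box (s : Fin 4 → ℚ_[p]) : AddSubgroup (quadSpace p c) where
  carrier := {x | ∀ i, ‖E.vcoord x i‖ ≤ ‖s i‖}
  zero_mem' i := by simp
  add_mem' {x y} hx hy i := by
    rw [map_add, Pi.add_apply]
    exact (Padic.nonarchimedean _ _).trans (max_le (hx i) (hy i))
  neg_mem' {x} hx i := by
    rw [map_neg, Pi.neg_apply, norm_neg]
    exact hx i

theorem mem_box {s : Fin 4 → ℚ_[p]} {x : quadSpace p c} :
    x ∈ E.box s ↔ ∀ i, ‖E.vcoord x i‖ ≤ ‖s i‖ := Iff.rfl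

theorem isOpen_box {s : Fin 4 → ℚ_[p]} (hs : ∀ i, s i ≠ 0) : IsOpen (E.box s : Set (quadSpace p c)) := by
  have h : (E.box s : Set (quadSpace p c)) =
      ⋂ i, (fun x => E.vcoord x i) ⁻¹' Metric.closedBall 0 ‖s i‖ := by
    ext x
    simp [mem_box]
  rw [h]
  exact isOpen_iInter_of_finite fun i => (IsUltrametricDist.isOpen_closedBall 0
    (norm_ne_zero_iff.mpr (hs i))).preimage ((continuous_apply i).comp E.continuous_vcoord)

theorem isCompact_box (s : Fin 4 → ℚ_[p]) : IsCompact (E.box s : Set (quadSpace p c)) := by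
  have h : (E.box s : Set (quadSpace p c)) =
      E.vcoord.symm '' Set.univ.pi fun i => Metric.closedBall 0 ‖s i‖ := by
    ext x
    rw [LinearEquiv.image_symm_eq_preimage]
    simp [mem_box]
  rw [h]
  exact (isCompact_univ_pi fun i => isCompact_closedBall _ _).image E.continuous_vcoord_symm

theorem coe_box_one : (E.box 1 : Set (quadSpace p c)) = latticeL p c := by
  ext x
  obtain ⟨w, rfl⟩ := E.vcoord.symm.surjective x
  have h2 : ∀ b : ℚ_[p], algebraMap _ _ b * E.δ ∈ localOrder p F ↔ ‖b‖ ≤ 1 := by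
    intro b
    have := E.mem_order_δ 0 b
    rw [map_zero, zero_add, norm_zero] at this
    rw [this]
    simp
  have h3 : algebraMap ℚ_[p] (LocAlg p F) (w 0) - algebraMap _ _ (w 1) * E.δ =
      algebraMap _ _ (w 0) + algebraMap _ _ (-w 1) * E.δ := by
    rw [map_neg]; ring
  have h4 : (E.vcoord.symm w ∈ latticeL p c) ↔
      ((algebraMap _ _ (w 0) + algebraMap _ _ (w 1) * E.δ ∈ localOrder p F ∧
        algebraMap _ _ (w 2) * E.δ ∈ localOrder p F) ∧
      algebraMap _ _ (w 3) * E.δ ∈ localOrder p F ∧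
        algebraMap _ _ (w 0) - algebraMap _ _ (w 1) * E.δ ∈ localOrder p F) := by
    change (∀ i j, E.toMatrix w i j ∈ _) ↔ _
    rw [Fin.forall_fin_two, Fin.forall_fin_two, Fin.forall_fin_two]
    rfl
  rw [h4, h3, h2, h2, E.mem_order_δ, E.mem_order_δ, SetLike.mem_coe, mem_box,
    LinearEquiv.apply_symm_apply, Fin.forall_fin_succ, Fin.forall_fin_succ, Fin.forall_fin_two]
  simp only [Pi.one_apply, norm_one, norm_neg]
  simp only [Fin.succ_zero_eq_one, Fin.succ_one_eq_two]
  change (_ ∧ _ ∧ _ ∧ ‖w 3‖ ≤ 1) ↔ _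
  tauto

end EisensteinGenerator

end Coordinates

/-! ### Indices of lattices and volumes -/

open MeasureTheory

section Index

/-- A subgroup is a disjoint union of the cosets of a smaller one. -/
theorem measure_eq_relIndex_mul {G : Type*} [AddGroup G] [MeasurableSpace G] [MeasurableAdd G]
    (μ : Measure G) [μ.IsAddLeftInvariant] {A B : AddSubgroup G} (hAB : A ≤ B)
    (hA : MeasurableSet (A : Set G)) (hne : A.relIndex B ≠ 0) :
    μ (B : Set G) = A.relIndex B * μ (A : Set G) := by
  have hfin : (A.addSubgroupOf B).FiniteIndex := ⟨hne⟩
  have : Finite (B ⧸ A.addSubgroupOf B) := AddSubgroup.finite_quotient_of_finiteIndex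
  have := Fintype.ofFinite (B ⧸ A.addSubgroupOf B)
  have hU : (B : Set G) = ⋃ q : B ⧸ A.addSubgroupOf B,
      (fun x => -(q.out : G) + x) ⁻¹' (A : Set G) := by
    ext x
    simp only [Set.mem_iUnion, Set.mem_preimage, SetLike.mem_coe]
    constructor
    · intro hx
      refine ⟨QuotientAddGroup.mk (⟨x, hx⟩ : B), ?_⟩
      have h := QuotientAddGroup.mk_out_eq_add (A.addSubgroupOf B) (⟨x, hx⟩ : B)
      obtain ⟨a, ha⟩ := h
      rw [ha]
      simp only [AddSubgroup.coe_add, neg_add_rev]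
      rw [add_assoc, neg_add_cancel, add_zero]
      exact A.neg_mem (AddSubgroup.mem_addSubgroupOf.mp a.2)
    · rintro ⟨q, hq⟩
      have := B.add_mem q.out.2 (hAB hq)
      rwa [add_neg_cancel_left] at this
  have hdisj : Pairwise (Function.onFun Disjoint fun q : B ⧸ A.addSubgroupOf B =>
      (fun x => -(q.out : G) + x) ⁻¹' (A : Set G)) := by
    intro q r hqr
    refine Set.disjoint_left.mpr fun x hx hx' => hqr ?_
    rw [← q.out_eq, ← r.out_eq]
    refine QuotientAddGroup.eq.mpr (AddSubgroup.mem_addSubgroupOf.mpr ?_)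
    have := A.add_mem hx (A.neg_mem hx')
    simpa [add_assoc] using this
  conv_lhs => rw [hU]
  rw [measure_iUnion hdisj fun q => (measurable_const_add _) hA]
  simp only [measure_preimage_add]
  rw [tsum_fintype, Finset.sum_const, Finset.card_univ, nsmul_eq_mul, ← Nat.card_eq_fintype_card]
  rfl

variable {p : ℕ} [hp : Fact p.Prime]

theorem index_ker_toZModPow (k : ℕ) :
    ((PadicInt.toZModPow k : ℤ_[p] →+* ZMod (p ^ k)).toAddMonoidHom.ker).index = p ^ k := by
  rw [AddSubgroup.index_ker, AddMonoidHom.range_eq_top.mpr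
    (ZMod.ringHom_surjective (PadicInt.toZModPow k : ℤ_[p] →+* ZMod (p ^ k))),
    Nat.card_congr AddSubgroup.topEquiv.toEquiv, Nat.card_zmod]

theorem mem_ker_toZModPow {k : ℕ} {x : ℤ_[p]} :
    x ∈ (PadicInt.toZModPow k : ℤ_[p] →+* ZMod (p ^ k)).toAddMonoidHom.ker ↔
      ‖(x : ℚ_[p])‖ ≤ (p : ℝ)⁻¹ ^ k := by
  rw [← PadicInt.norm_def, inv_pow, ← zpow_natCast, ← zpow_neg, PadicInt.norm_le_pow_iff_mem_span_pow,
    ← PadicInt.ker_toZModPow]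
  rfl

theorem exists_norm_eq_pow {x : ℚ_[p]} (hx : x ≠ 0) (h : ‖x‖ ≤ 1) :
    ∃ k : ℕ, ‖x‖ = (p : ℝ)⁻¹ ^ k := by
  rw [Padic.norm_le_one_iff_val_nonneg] at h
  obtain ⟨k, hk⟩ := Int.eq_ofNat_of_zero_le h
  exact ⟨k, by rw [Padic.norm_eq_zpow_neg_valuation hx, hk, inv_pow, zpow_neg, zpow_natCast]⟩

variable {F : Type*} [Field F] [NumberField F] {c : F ≃ₐ[ℚ] F} (E : EisensteinGenerator p c)

namespace EisensteinGenerator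

/-- The parametrization of the lattice `E.box s` by `ℤ_p⁴`. -/
def boxMap (s : Fin 4 → ℚ_[p]) : (Fin 4 → ℤ_[p]) →+ quadSpace p c where
  toFun w := E.vcoord.symm fun i => s i * (w i : ℚ_[p])
  map_zero' := by
    rw [← map_zero E.vcoord.symm]
    congr 1
    ext i
    simp
  map_add' w w' := by
    rw [← map_add]
    congr 1
    ext i
    simp [mul_add]

theorem boxMap_injective {s : Fin 4 → ℚ_[p]} (hs : ∀ i, s i ≠ 0) :
    Function.Injective (E.boxMap s) := by
  intro w w' h
  have h1 := E.vcoord.symm.injective h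
  funext i
  exact PadicInt.ext (mul_left_cancel₀ (hs i) (congrFun h1 i))

theorem map_boxMap {s s' : Fin 4 → ℚ_[p]} (hs : ∀ i, s i ≠ 0) {k : Fin 4 → ℕ}
    (hk : ∀ i, ‖s' i‖ = ‖s i‖ * (p : ℝ)⁻¹ ^ k i) :
    (AddSubgroup.pi Set.univ fun i =>
      (PadicInt.toZModPow (k i) : ℤ_[p] →+* ZMod (p ^ k i)).toAddMonoidHom.ker).map (E.boxMap s) =
      E.box s' := by
  have hq : ∀ k : ℕ, (p : ℝ)⁻¹ ^ k ≤ 1 := fun k =>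
    pow_le_one₀ (inv_pos.mpr p_pos).le (inv_le_one_of_one_le₀ one_lt_p.le)
  ext x
  constructor
  · rintro ⟨w, hw, rfl⟩
    rw [mem_box]
    intro i
    change ‖E.vcoord (E.vcoord.symm _) i‖ ≤ _
    rw [LinearEquiv.apply_symm_apply, norm_mul, hk]
    exact mul_le_mul_of_nonneg_left (mem_ker_toZModPow.mp (hw i trivial)) (norm_nonneg _)
  · intro hx
    rw [mem_box] at hx
    have h1 : ∀ i, ‖(s i)⁻¹ * E.vcoord x i‖ ≤ (p : ℝ)⁻¹ ^ k i := by
      intro i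
      rw [norm_mul, norm_inv, inv_mul_le_iff₀ (norm_pos_iff.mpr (hs i)), ← hk]
      exact hx i
    refine ⟨fun i => ⟨(s i)⁻¹ * E.vcoord x i, (h1 i).trans (hq _)⟩, fun i _ => ?_, ?_⟩
    · exact mem_ker_toZModPow.mpr (h1 i)
    · change E.vcoord.symm _ = x
      rw [LinearEquiv.symm_apply_eq]
      funext i
      change s i * ((s i)⁻¹ * E.vcoord x i) = _
      rw [mul_inv_cancel_left₀ (hs i)]

/-- If the coordinates of `s'` are those of `s` up to factors of absolute value `p^{-k i}`, then the
index of `E.box s'` in `E.box s` is the product of the indices of the ideals `p^{k i} ℤ_p`. -/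
theorem relIndex_box {s s' : Fin 4 → ℚ_[p]} (hs : ∀ i, s i ≠ 0) {k : Fin 4 → ℕ}
    (hk : ∀ i, ‖s' i‖ = ‖s i‖ * (p : ℝ)⁻¹ ^ k i) :
    (E.box s').relIndex (E.box s) = p ^ ∑ i, k i := by
  have h0 := E.map_boxMap hs (s' := s) (k := 0) (fun i => by simp)
  rw [← E.map_boxMap hs hk, ← h0,
    AddSubgroup.relIndex_map_map_of_injective _ _ (E.boxMap_injective hs)]
  have htop : (AddSubgroup.pi Set.univ fun i : Fin 4 =>
      (PadicInt.toZModPow ((0 : Fin 4 → ℕ) i) :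
        ℤ_[p] →+* ZMod (p ^ (0 : Fin 4 → ℕ) i)).toAddMonoidHom.ker) = ⊤ := by
    rw [eq_top_iff]
    intro w _ i _
    refine mem_ker_toZModPow.mpr ?_
    simpa using (w i).2
  rw [htop, AddSubgroup.relIndex_top_right, AddSubgroup.index_pi]
  simp only [index_ker_toZModPow]
  rw [Finset.prod_pow_eq_pow_sum]

end EisensteinGenerator

theorem relIndex_prod_self {G : Type*} [AddGroup G] {A B : AddSubgroup G} (hAB : A ≤ B) :
    (A.prod A).relIndex (B.prod B) = A.relIndex B ^ 2 := by
  have h1 : A.prod A = ((A.addSubgroupOf B).prod (A.addSubgroupOf B)).map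
      (B.subtype.prodMap B.subtype) := by
    ext z
    constructor
    · obtain ⟨x, y⟩ := z
      rintro ⟨hx, hy⟩
      exact ⟨(⟨x, hAB hx⟩, ⟨y, hAB hy⟩), ⟨hx, hy⟩, rfl⟩
    · rintro ⟨⟨x, y⟩, ⟨hx, hy⟩, rfl⟩
      exact ⟨hx, hy⟩
  have h2 : B.prod B = (⊤ : AddSubgroup (B × B)).map (B.subtype.prodMap B.subtype) := by
    ext z
    constructor
    · obtain ⟨x, y⟩ := z
      rintro ⟨hx, hy⟩
      exact ⟨(⟨x, hx⟩, ⟨y, hy⟩), trivial, rfl⟩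
    · rintro ⟨⟨x, y⟩, -, rfl⟩
      exact ⟨x.2, y.2⟩
  rw [h1, h2, AddSubgroup.relIndex_map_map_of_injective _ _
    (Prod.map_injective.mpr ⟨B.subtype_injective, B.subtype_injective⟩),
    AddSubgroup.relIndex_top_right, AddSubgroup.index_prod, pow_two]
  rfl

instance : MeasurableAdd (quadSpace p c × quadSpace p c) where
  measurable_const_add v :=
    ((continuous_const_add v.1).measurable.comp measurable_fst).prodMk
      ((continuous_const_add v.2).measurable.comp measurable_snd)
  measurable_add_const v :=
    ((continuous_add_const v.1).measurable.comp measurable_fst).prodMk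
      ((continuous_add_const v.2).measurable.comp measurable_snd)

/-- The volume of `B ⊕ B` in terms of that of `A ⊕ A`, for lattices `A ≤ B`. -/
theorem measureReal_prod_eq (dx : Measure (quadSpace p c × quadSpace p c)) [dx.IsAddLeftInvariant]
    {A B : AddSubgroup (quadSpace p c)} (hAB : A ≤ B)
    (hA : IsOpen (A : Set (quadSpace p c))) (hne : A.relIndex B ≠ 0) :
    dx.real ((B : Set (quadSpace p c)) ×ˢ (B : Set (quadSpace p c))) =
      (A.relIndex B : ℝ) ^ 2 * dx.real ((A : Set (quadSpace p c)) ×ˢ (A : Set (quadSpace p c))) := by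
  have h := measure_eq_relIndex_mul dx (A := A.prod A) (B := B.prod B)
    (AddSubgroup.prod_mono hAB hAB) (hA.measurableSet.prod hA.measurableSet)
    (by rw [relIndex_prod_self hAB]; exact pow_ne_zero _ hne)
  rw [relIndex_prod_self hAB] at h
  have h' := congrArg ENNReal.toReal h
  rw [ENNReal.toReal_mul] at h'
  simpa [AddSubgroup.coe_prod, Measure.real] using h'

end Index

/-! ### The self-dual measure -/

section SelfDual

variable {p : ℕ} [hp : Fact p.Prime]

theorem psi_apply (x : ℚ_[p]) :
    psi p x = Complex.exp (-(2 * Real.pi * Complex.I * (principalPart p x : ℂ))) := rfl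

theorem psi_eq_one {x : ℚ_[p]} (hx : ‖x‖ ≤ 1) : psi p x = 1 := by
  obtain ⟨hr, hxr⟩ := (exists_principalPart p x).choose_spec
  obtain ⟨k, hk⟩ := int_of_norm_le_one p hr (by
    have h := Padic.nonarchimedean x (-(x - ((exists_principalPart p x).choose : ℚ_[p])))
    rw [neg_sub, add_sub_cancel, ← norm_neg (_ - x), neg_sub] at h
    exact h.trans (max_le hx hxr))
  rw [psi_apply, Complex.exp_eq_one_iff]
  refine ⟨-k, ?_⟩
  have h : principalPart p x = k := hk
  rw [h]
  push_cast
  ring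

theorem psi_inv_p_ne_one : psi p (p : ℚ_[p])⁻¹ ≠ 1 := by
  intro h
  obtain ⟨-, hxr⟩ := (exists_principalPart p (p : ℚ_[p])⁻¹).choose_spec
  rw [psi_apply, Complex.exp_eq_one_iff] at h
  obtain ⟨k, hk⟩ := h
  have h1 : ((principalPart p (p : ℚ_[p])⁻¹ : ℚ) : ℂ) = ((-k : ℤ) : ℂ) := by
    have h2 : (2 * Real.pi * Complex.I : ℂ) ≠ 0 := Complex.two_pi_I_ne_zero
    refine mul_left_cancel₀ h2 ?_
    push_cast
    linear_combination -hk
  have h2 : principalPart p (p : ℚ_[p])⁻¹ = ((-k : ℤ) : ℚ) := by exact_mod_cast h1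
  change ‖(p : ℚ_[p])⁻¹ - ((principalPart p (p : ℚ_[p])⁻¹ : ℚ) : ℚ_[p])‖ ≤ 1 at hxr
  rw [h2, Rat.cast_intCast] at hxr
  have h3 := Padic.nonarchimedean ((p : ℚ_[p])⁻¹ - ((-k : ℤ) : ℚ_[p])) ((-k : ℤ) : ℚ_[p])
  rw [sub_add_cancel] at h3
  have h4 := h3.trans (max_le hxr (Padic.norm_int_le_one _))
  rw [norm_inv, Padic.norm_p, inv_inv] at h4
  exact absurd h4 one_lt_p.not_ge

/-- There is no absolute value between `1` and `p`. -/
theorem le_norm_of_one_lt {z : ℚ_[p]} (hz : 1 < ‖z‖) : (p : ℝ) ≤ ‖z‖ := by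
  have hz0 : z ≠ 0 := norm_ne_zero_iff.mp (by linarith)
  rw [Padic.norm_eq_zpow_neg_valuation hz0] at hz ⊢
  have h := (one_lt_zpow_iff_right₀ (one_lt_p (p := p))).mp hz
  calc (p : ℝ) = (p : ℝ) ^ (1 : ℤ) := (zpow_one _).symm
    _ ≤ _ := zpow_le_zpow_right₀ one_lt_p.le (by omega)

variable {F : Type*} [Field F] [NumberField F] {c : F ≃ₐ[ℚ] F} (E : EisensteinGenerator p c)

namespace EisensteinGenerator

/-- The nonzero entries of the Gram matrix of the bilinear form in the coordinates `E.vcoord`;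
the one in column `i` stands in row `Equiv.swap 2 3 i`. -/
def gram : Fin 4 → ℚ_[p] := ![2, -(2 * E.D), -E.D, -E.D]

theorem gram_ne_zero (i : Fin 4) : E.gram i ≠ 0 := by
  have := E.D_ne_zero
  fin_cases i <;> simp [gram, this]

theorem bilin_eq_sum (x y : quadSpace p c) :
    bilin p c x y = ∑ i, E.gram i * E.vcoord x (Equiv.swap 2 3 i) * E.vcoord y i := by
  have h2 : Equiv.swap (2 : Fin 4) 3 0 = 0 := by decide
  have h3 : Equiv.swap (2 : Fin 4) 3 1 = 1 := by decide
  rw [E.bilin_eq, Fin.sum_univ_four, h2, h3, Equiv.swap_apply_left, Equiv.swap_apply_right]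
  simp only [gram, Matrix.cons_val_zero, Matrix.cons_val_one, Matrix.cons_val]
  ring

/-- The dual lattice of `L_p` for the bilinear form. -/
def dualLattice : AddSubgroup (quadSpace p c) := E.box fun i => (E.gram i)⁻¹

theorem mem_dualLattice {x : quadSpace p c} :
    x ∈ E.dualLattice ↔ ∀ i, ‖E.gram i * E.vcoord x (Equiv.swap 2 3 i)‖ ≤ 1 := by
  have h : ∀ i, ‖E.gram (Equiv.swap 2 3 i)‖ = ‖E.gram i‖ := by
    intro i
    fin_cases i <;> simp [gram, Equiv.swap_apply_def]
  unfold dualLattice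
  rw [mem_box, ← (Equiv.swap (2 : Fin 4) 3).forall_congr_right]
  refine forall_congr' fun i => ?_
  rw [norm_inv, norm_mul, h, mul_comm, ← one_div, le_div_iff₀ (norm_pos_iff.mpr (E.gram_ne_zero i))]

theorem psi_bilin_eq_one {x y : quadSpace p c} (hx : x ∈ E.dualLattice) (hy : y ∈ E.box 1) :
    psi p (bilin p c x y) = 1 := by
  refine psi_eq_one ?_
  rw [E.bilin_eq_sum]
  refine IsUltrametricDist.norm_sum_le_of_forall_le_of_nonneg zero_le_one fun i _ => ?_
  rw [norm_mul]
  refine mul_le_one₀ (E.mem_dualLattice.mp hx i) (norm_nonneg _) ?_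
  simpa using E.mem_box.mp hy i

theorem exists_psi_bilin_ne_one {x : quadSpace p c} (hx : x ∉ E.dualLattice) :
    ∃ y ∈ E.box 1, psi p (bilin p c x y) ≠ 1 := by
  rw [mem_dualLattice] at hx
  push Not at hx
  obtain ⟨i, hi⟩ := hx
  set z := E.gram i * E.vcoord x (Equiv.swap 2 3 i) with hz
  have hz0 : z ≠ 0 := norm_ne_zero_iff.mp (by linarith)
  -- the vector on the `i`-th axis whose pairing with `x` is `p⁻¹`
  refine ⟨E.vcoord.symm (Pi.single i (z⁻¹ * (p : ℚ_[p])⁻¹)), ?_, ?_⟩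
  · rw [mem_box]
    intro j
    rw [LinearEquiv.apply_symm_apply]
    by_cases hj : j = i
    · subst hj
      rw [Pi.single_eq_same, norm_mul, norm_inv, norm_inv, Padic.norm_p, inv_inv, Pi.one_apply,
        norm_one, inv_mul_le_iff₀ (by linarith), mul_one]
      exact le_norm_of_one_lt hi
    · rw [Pi.single_eq_of_ne hj]
      simp
  · rw [E.bilin_eq_sum, Finset.sum_eq_single i]
    · rw [LinearEquiv.apply_symm_apply, Pi.single_eq_same, ← hz, mul_inv_cancel_left₀ hz0]
      exact psi_inv_p_ne_one
    · intro j _ hj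
      rw [LinearEquiv.apply_symm_apply, Pi.single_eq_of_ne hj, mul_zero]
    · exact fun h => absurd (Finset.mem_univ i) h

include E in
theorem bilin_add_right (x y z : quadSpace p c) :
    bilin p c x (y + z) = bilin p c x y + bilin p c x z := by
  simp only [E.bilin_eq_sum, map_add, Pi.add_apply, mul_add, Finset.sum_add_distrib]

include E in
theorem bilin_zero_left (y : quadSpace p c) : bilin p c 0 y = 0 := by
  simp [E.bilin_eq_sum]

include E in
theorem bilin_zero_right (x : quadSpace p c) : bilin p c x 0 = 0 := by
  simp [E.bilin_eq_sum]

theorem phiStar_eq : phiStar p c =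
    ((E.box 1).prod (E.box 1) : Set (quadSpace p c × quadSpace p c)).indicator 1 := by
  rw [AddSubgroup.coe_prod, coe_box_one]
  rfl

theorem isOpen_box_prod {s : Fin 4 → ℚ_[p]} (hs : ∀ i, s i ≠ 0) :
    IsOpen ((E.box s).prod (E.box s) : Set (quadSpace p c × quadSpace p c)) := by
  rw [AddSubgroup.coe_prod]
  exact (E.isOpen_box hs).prod (E.isOpen_box hs)

theorem isCompact_box_prod (s : Fin 4 → ℚ_[p]) :
    IsCompact ((E.box s).prod (E.box s) : Set (quadSpace p c × quadSpace p c)) := by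
  rw [AddSubgroup.coe_prod]
  exact (E.isCompact_box s).prod (E.isCompact_box s)

theorem measurableSet_box_prod {s : Fin 4 → ℚ_[p]} (hs : ∀ i, s i ≠ 0) :
    MeasurableSet ((E.box s).prod (E.box s) : Set (quadSpace p c × quadSpace p c)) := by
  rw [AddSubgroup.coe_prod]
  exact (E.isOpen_box hs).measurableSet.prod (E.isOpen_box hs).measurableSet

/-- The Fourier transform of the characteristic function of a lattice is supported on the dual
lattice, by orthogonality of characters. -/
theorem fourier_phiStar (dx : Measure (quadSpace p c × quadSpace p c)) [dx.IsAddLeftInvariant] :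
    fourier p c dx (phiStar p c) = fun x =>
      (E.dualLattice.prod E.dualLattice : Set (quadSpace p c × quadSpace p c)).indicator
        (fun _ => (dx.real ((E.box 1).prod (E.box 1) : Set (quadSpace p c × quadSpace p c)) : ℂ))
        x := by
  funext x
  unfold fourier
  rw [E.phiStar_eq]
  by_cases hx : x ∈ E.dualLattice.prod E.dualLattice
  · rw [Set.indicator_of_mem hx]
    have h : (fun y : quadSpace p c × quadSpace p c =>
        ((E.box 1).prod (E.box 1) : Set (quadSpace p c × quadSpace p c)).indicator (1 : quadSpace p c × quadSpace p c → ℂ) y *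
          psi p (bilin p c x.1 y.1 + bilin p c x.2 y.2)) =
        ((E.box 1).prod (E.box 1) : Set (quadSpace p c × quadSpace p c)).indicator
          fun _ => (1 : ℂ) := by
      funext y
      by_cases hy : y ∈ (E.box 1).prod (E.box 1)
      · rw [Set.indicator_of_mem hy, Set.indicator_of_mem hy, AddChar.map_add_eq_mul,
          E.psi_bilin_eq_one hx.1 hy.1, E.psi_bilin_eq_one hx.2 hy.2]
        simp
      · rw [Set.indicator_of_notMem hy, Set.indicator_of_notMem hy, zero_mul]
    rw [h, integral_indicator_const _ (E.measurableSet_box_prod (s := 1) fun _ => one_ne_zero)]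
    simp
  · rw [Set.indicator_of_notMem hx]
    obtain ⟨y₀, hy₀, hψ⟩ : ∃ y₀ ∈ (E.box 1).prod (E.box 1),
        psi p (bilin p c x.1 y₀.1 + bilin p c x.2 y₀.2) ≠ 1 := by
      rw [AddSubgroup.mem_prod, not_and_or] at hx
      rcases hx with hx | hx
      · obtain ⟨y, hy, h⟩ := E.exists_psi_bilin_ne_one hx
        refine ⟨(y, 0), ⟨hy, zero_mem _⟩, ?_⟩
        rwa [E.bilin_zero_right, add_zero]
      · obtain ⟨y, hy, h⟩ := E.exists_psi_bilin_ne_one hx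
        refine ⟨(0, y), ⟨zero_mem _, hy⟩, ?_⟩
        rwa [E.bilin_zero_right, zero_add]
    set g : quadSpace p c × quadSpace p c → ℂ := fun y =>
        ((E.box 1).prod (E.box 1) : Set (quadSpace p c × quadSpace p c)).indicator (1 : quadSpace p c × quadSpace p c → ℂ) y *
          psi p (bilin p c x.1 y.1 + bilin p c x.2 y.2) with hg
    have h1 : ∀ y, g (y₀ + y) = psi p (bilin p c x.1 y₀.1 + bilin p c x.2 y₀.2) * g y := by
      intro y
      have h2 : ((E.box 1).prod (E.box 1) : Set (quadSpace p c × quadSpace p c)).indicator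
          (1 : quadSpace p c × quadSpace p c → ℂ) (y₀ + y) = ((E.box 1).prod (E.box 1) :
            Set (quadSpace p c × quadSpace p c)).indicator (1 : quadSpace p c × quadSpace p c → ℂ) y := by
        have h3 : y₀ + y ∈ (E.box 1).prod (E.box 1) ↔ y ∈ (E.box 1).prod (E.box 1) :=
          AddSubgroup.add_mem_cancel_left _ hy₀
        by_cases hy : y ∈ (E.box 1).prod (E.box 1)
        · rw [Set.indicator_of_mem hy, Set.indicator_of_mem (h3.mpr hy)]
          rfl
        · rw [Set.indicator_of_notMem hy, Set.indicator_of_notMem (mt h3.mp hy)]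
      simp only [hg, h2, Prod.fst_add, Prod.snd_add, E.bilin_add_right]
      rw [add_add_add_comm, AddChar.map_add_eq_mul]
      ring
    have h4 := integral_add_left_eq_self (μ := dx) g y₀
    simp only [h1] at h4
    rw [integral_const_mul] at h4
    have h5 : (psi p (bilin p c x.1 y₀.1 + bilin p c x.2 y₀.2) - 1) * ∫ y, g y ∂dx = 0 := by
      linear_combination h4
    change ∫ y, g y ∂dx = 0
    exact (mul_eq_zero.mp h5).resolve_left (sub_ne_zero.mpr hψ)

/-- Fourier inversion for the characteristic function of `L_p ⊕ L_p` at the origin. -/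
theorem measureReal_mul_dual (dx : Measure (quadSpace p c × quadSpace p c))
    [dx.IsAddLeftInvariant] (hdx : IsSelfDual p c dx) :
    dx.real ((E.box 1).prod (E.box 1) : Set (quadSpace p c × quadSpace p c)) *
      dx.real (E.dualLattice.prod E.dualLattice : Set (quadSpace p c × quadSpace p c)) = 1 := by
  have := E.t2Space
  have hclopen : IsClopen ((E.box 1).prod (E.box 1) : Set (quadSpace p c × quadSpace p c)) :=
    ⟨AddSubgroup.isClosed_of_isOpen _ (E.isOpen_box_prod fun _ => one_ne_zero),
      E.isOpen_box_prod fun _ => one_ne_zero⟩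
  have hlc : IsLocallyConstant (phiStar p c) := by
    rw [E.phiStar_eq]
    exact (LocallyConstant.charFn ℂ hclopen).isLocallyConstant
  have hcs : HasCompactSupport (phiStar p c) :=
    HasCompactSupport.intro (E.isCompact_box_prod 1) fun x hx => by
      rw [E.phiStar_eq, Set.indicator_of_notMem hx]
  have h := hdx _ hlc hcs 0
  rw [E.fourier_phiStar, neg_zero, E.phiStar_eq, Set.indicator_of_mem (zero_mem _)] at h
  unfold fourier at h
  simp only [Prod.fst_zero, Prod.snd_zero, E.bilin_zero_left, add_zero, AddChar.map_zero_eq_one,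
    mul_one] at h
  rw [integral_indicator_const _ (show MeasurableSet
    (E.dualLattice.prod E.dualLattice : Set (quadSpace p c × quadSpace p c)) from
      E.measurableSet_box_prod fun i => inv_ne_zero (E.gram_ne_zero i))] at h
  rw [mul_comm]
  simpa [← Complex.ofReal_mul] using congrArg Complex.re h

theorem norm_gram_le_one (i : Fin 4) : ‖E.gram i‖ ≤ 1 := by
  have h2 : ‖(2 : ℚ_[p])‖ ≤ 1 := by
    have := Padic.norm_int_le_one (p := p) 2
    exact_mod_cast this
  have hD := E.norm_D_le_one
  fin_cases i
  · exact h2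
  · change ‖-(2 * E.D)‖ ≤ 1
    rw [norm_neg, norm_mul]
    exact mul_le_one₀ h2 (norm_nonneg _) hD
  · change ‖-E.D‖ ≤ 1
    rwa [norm_neg]
  · change ‖-E.D‖ ≤ 1
    rwa [norm_neg]

/-- The self-dual volume of `L_p ⊕ L_p` is the inverse of the index of `L_p` in its dual. -/
theorem measureReal_latticeL (dx : Measure (quadSpace p c × quadSpace p c))
    [dx.IsAddLeftInvariant] (hdx : IsSelfDual p c dx) :
    dx.real ((E.box 1 : Set (quadSpace p c)) ×ˢ (E.box 1 : Set (quadSpace p c))) =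
      ‖(2 : ℚ_[p]) ^ (-4 : ℤ) * (NumberField.discr F : ℚ_[p]) ^ 3‖ := by
  choose k hk using fun i => exists_norm_eq_pow (E.gram_ne_zero i) (E.norm_gram_le_one i)
  have hidx : (E.box 1).relIndex E.dualLattice = p ^ ∑ i, k i := by
    refine E.relIndex_box (fun i => inv_ne_zero (E.gram_ne_zero i)) fun i => ?_
    rw [← hk, norm_inv, inv_mul_cancel₀ (norm_ne_zero_iff.mpr (E.gram_ne_zero i)), Pi.one_apply,
      norm_one]
  have hle : E.box 1 ≤ E.dualLattice := by
    intro x hx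
    unfold dualLattice
    rw [mem_box] at hx ⊢
    intro i
    refine (hx i).trans ?_
    rw [Pi.one_apply, norm_one, norm_inv]
    exact (one_le_inv₀ (norm_pos_iff.mpr (E.gram_ne_zero i))).mpr (E.norm_gram_le_one i)
  have hp0 : (p : ℝ) ≠ 0 := p_pos.ne'
  have h := measureReal_prod_eq dx hle (E.isOpen_box fun _ => one_ne_zero) (by
    rw [hidx]
    exact pow_ne_zero _ hp.out.ne_zero)
  have h1 := E.measureReal_mul_dual dx hdx
  rw [AddSubgroup.coe_prod, AddSubgroup.coe_prod, h, hidx] at h1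
  have hprod : ((p : ℝ) ^ ∑ i, k i)⁻¹ = ‖4 * E.D ^ 3‖ := by
    rw [← inv_pow, ← Finset.prod_pow_eq_pow_sum]
    simp only [← hk]
    rw [← norm_prod, Fin.prod_univ_four]
    simp only [gram, Matrix.cons_val_zero, Matrix.cons_val_one, Matrix.cons_val]
    rw [← norm_neg]
    congr 1
    ring
  have hdisc : ‖(2 : ℚ_[p]) ^ (-4 : ℤ) * (NumberField.discr F : ℚ_[p]) ^ 3‖ = ‖4 * E.D ^ 3‖ := by
    rw [norm_mul, norm_pow, ← E.norm_four_mul_D, ← norm_pow, ← norm_mul]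
    congr 1
    have h2 : (2 : ℚ_[p]) ≠ 0 := two_ne_zero
    rw [zpow_neg]
    field_simp
    norm_num
  rw [hdisc, ← hprod]
  set v := dx.real ((E.box 1 : Set (quadSpace p c)) ×ˢ (E.box 1 : Set (quadSpace p c)))
  have hv : 0 ≤ v := measureReal_nonneg
  push_cast at h1
  have h2 : (v * (p : ℝ) ^ ∑ i, k i) ^ 2 = 1 := by linear_combination h1
  have h3 : v * (p : ℝ) ^ ∑ i, k i = 1 :=
    (pow_eq_one_iff_of_nonneg (mul_nonneg hv (pow_nonneg p_pos.le _)) two_ne_zero).mp h2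
  exact eq_inv_of_mul_eq_one_left h3

end EisensteinGenerator

end SelfDual

/-! ### Matrix coefficients of the Weil representation -/

section WeilCoefficient

variable {p : ℕ} [hp : Fact p.Prime] {F : Type*} [Field F] [NumberField F]
variable {c : F ≃ₐ[ℚ] F} (E : EisensteinGenerator p c)

namespace EisensteinGenerator

/-- The action of `H⁰(ℚ_p)` on `V_p`. -/
abbrev act : H0 p F →* Module.End ℚ_[p] (quadSpace p c) := rho p c E.ne_one E.finrank_eq

theorem act_mk_val (a : GL (Fin 2) (LocAlg p F)) (α : ℚ_[p]ˣ) (x : quadSpace p c) :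
    (E.act (QuotientGroup.mk (a, α)) x).1 = ((α⁻¹ : ℚ_[p]ˣ) : ℚ_[p]) •
      ((a : Matrix (Fin 2) (Fin 2) (LocAlg p F)) * x.1 *
        ((a : Matrix (Fin 2) (Fin 2) (LocAlg p F)).map (galConj p c)).adjugate) := rfl

theorem mem_box_one {x : quadSpace p c} :
    x ∈ E.box 1 ↔ ∀ i j, (x : Matrix (Fin 2) (Fin 2) (LocAlg p F)) i j ∈ localOrder p F := by
  rw [← SetLike.mem_coe, coe_box_one]
  rfl

include E in
theorem galConj_mem_order {z : LocAlg p F} (hz : z ∈ localOrder p F) :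
    galConj p c z ∈ localOrder p F := by
  rw [E.mem_order_iff] at hz ⊢
  rwa [E.absLoc_galConj]

theorem act_mem_box_one {k : H0 p F} (hk : k ∈ integralH0 p F) {x : quadSpace p c}
    (hx : x ∈ E.box 1) : E.act k x ∈ E.box 1 := by
  obtain ⟨r, β, hr, hβ, rfl⟩ := mem_integralH0.mp hk
  have hr' := (mem_integralGL.mp hr).1
  rw [mem_box_one] at hx ⊢
  have hadj : ∀ i j, ((r : Matrix (Fin 2) (Fin 2) (LocAlg p F)).map (galConj p c)).adjugate i j
      ∈ localOrder p F := by
    intro i j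
    rw [Matrix.adjugate_fin_two]
    fin_cases i <;> fin_cases j
    · exact E.galConj_mem_order (hr' 1 1)
    · exact neg_mem (E.galConj_mem_order (hr' 0 1))
    · exact neg_mem (E.galConj_mem_order (hr' 1 0))
    · exact E.galConj_mem_order (hr' 0 0)
  intro i j
  rw [act_mk_val, Matrix.smul_apply, Algebra.smul_def]
  refine mul_mem ?_ ?_
  · rw [E.mem_order_iff, E.absLoc_algebraMap, Units.val_inv_eq_inv_val, norm_inv, hβ]
    norm_num
  · rw [Matrix.mul_apply]
    refine sum_mem fun l _ => mul_mem ?_ (hadj l j)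
    rw [Matrix.mul_apply]
    exact sum_mem fun m _ => mul_mem (hr' i m) (hx m l)

theorem act_mem_box_one_iff {k : H0 p F} (hk : k ∈ integralH0 p F) {x : quadSpace p c} :
    E.act k x ∈ E.box 1 ↔ x ∈ E.box 1 := by
  refine ⟨fun h => ?_, E.act_mem_box_one hk⟩
  have h1 := E.act_mem_box_one ((integralH0 p F).inv_mem hk) h
  rwa [← Module.End.mul_apply, ← map_mul, inv_mul_cancel, map_one] at h1

/-- The lattice `L_p ∩ g⁻¹ L_p`. -/
def interLattice (g : H0 p F) : AddSubgroup (quadSpace p c) :=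
  E.box 1 ⊓ (E.box 1).comap (E.act g).toAddMonoidHom

theorem mem_interLattice {g : H0 p F} {x : quadSpace p c} :
    x ∈ E.interLattice g ↔ x ∈ E.box 1 ∧ E.act g x ∈ E.box 1 := Iff.rfl

/-- The index of `L_p ∩ g⁻¹ L_p` in `L_p` depends only on the double coset of `g`, because integral
points preserve `L_p`. -/
theorem relIndex_interLattice_mul_mul {k₁ k₂ : H0 p F} (hk₁ : k₁ ∈ integralH0 p F)
    (hk₂ : k₂ ∈ integralH0 p F) (g : H0 p F) :
    (E.interLattice (k₁ * g * k₂)).relIndex (E.box 1) = (E.interLattice g).relIndex (E.box 1) := by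
  have hinj : Function.Injective (E.act k₂).toAddMonoidHom := by
    refine Function.LeftInverse.injective (g := E.act k₂⁻¹) fun x => ?_
    change E.act k₂⁻¹ (E.act k₂ x) = x
    rw [← Module.End.mul_apply, ← map_mul, inv_mul_cancel, map_one]
    rfl
  have hsurj : ∀ x, ∃ y, E.act k₂ y = x := fun x => ⟨E.act k₂⁻¹ x, by
    rw [← Module.End.mul_apply, ← map_mul, mul_inv_cancel, map_one]
    rfl⟩
  have h1 : (E.interLattice (k₁ * g * k₂)).map (E.act k₂).toAddMonoidHom = E.interLattice g := by
    ext x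
    obtain ⟨y, rfl⟩ := hsurj x
    have h2 : y ∈ E.interLattice (k₁ * g * k₂) ↔ E.act k₂ y ∈ E.interLattice g := by
      rw [mem_interLattice, mem_interLattice, map_mul, map_mul, Module.End.mul_apply,
        Module.End.mul_apply, E.act_mem_box_one_iff hk₁, E.act_mem_box_one_iff hk₂]
    rw [← h2]
    exact AddSubgroup.mem_map_iff_mem hinj
  have h2 : (E.box 1).map (E.act k₂).toAddMonoidHom = E.box 1 := by
    ext x
    obtain ⟨y, rfl⟩ := hsurj x
    rw [E.act_mem_box_one_iff hk₂]
    exact AddSubgroup.mem_map_iff_mem hinj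
  rw [← h1]
  conv_rhs => rw [← h2]
  rw [AddSubgroup.relIndex_map_map_of_injective _ _ hinj]

theorem isOpen_interLattice (g : H0 p F) : IsOpen (E.interLattice g : Set (quadSpace p c)) := by
  have hc : Continuous (E.act g) := by
    have h1 : Continuous (E.vcoord ∘ E.act g ∘ E.vcoord.symm) :=
      LinearMap.continuous_on_pi (E.vcoord.toLinearMap ∘ₗ E.act g ∘ₗ E.vcoord.symm.toLinearMap)
    have h2 := (E.continuous_vcoord_symm.comp h1).comp E.continuous_vcoord
    convert h2 using 1
    funext x
    simp
  exact (E.isOpen_box fun _ => one_ne_zero).inter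
    ((E.isOpen_box fun _ => one_ne_zero).preimage hc)

/-- The matrix coefficient of the Weil representation is the volume of the intersection of two
lattices. -/
theorem pairingOmega_eq_measureReal (dx : Measure (quadSpace p c × quadSpace p c)) (h : H01 p F) :
    pairingOmega p c dx (weilAction p c E.ne_one E.finrank_eq h (phiStar p c)) (phiStar p c) =
      (dx.real ((E.interLattice (h : H0 p F)⁻¹ : Set (quadSpace p c)) ×ˢ
        (E.interLattice (h : H0 p F)⁻¹ : Set (quadSpace p c))) : ℂ) := by
  have hm := (E.isOpen_interLattice (h : H0 p F)⁻¹).measurableSet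
  have h1 : (fun x => weilAction p c E.ne_one E.finrank_eq h (phiStar p c) x *
      conj (phiStar p c x)) = ((E.interLattice (h : H0 p F)⁻¹ : Set (quadSpace p c)) ×ˢ
        (E.interLattice (h : H0 p F)⁻¹ : Set (quadSpace p c))).indicator fun _ => (1 : ℂ) := by
    funext x
    classical
    unfold weilAction phiStar
    rw [← E.coe_box_one]
    simp only [Set.indicator_apply, Set.mem_prod, SetLike.mem_coe, mem_interLattice, Subgroup.coe_inv]
    split_ifs <;> simp_all
  unfold pairingOmega
  rw [h1, integral_indicator_const _ (hm.prod hm)]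
  simp

theorem norm_normUnits_θu_pow (n : ℕ) :
    ‖((normUnits p F (E.θu ^ n) : ℚ_[p]ˣ) : ℚ_[p])‖ = (p : ℝ)⁻¹ ^ n := by
  rw [norm_normUnits, E.absLoc_θu_pow]

/-- The class of `(diag(1, θ^{2n}), N(θ)^n)`, which has trivial similitude. -/
def torusElt (n : ℕ) : H0 p F :=
  QuotientGroup.mk (upper p 1 (E.θu ^ (2 * n)) 0, normUnits p F (E.θu ^ n))

theorem torusElt_inv (n : ℕ) : (E.torusElt n)⁻¹ =
    QuotientGroup.mk (upper p 1 (E.θu ^ (2 * n))⁻¹ 0, (normUnits p F (E.θu ^ n))⁻¹) := by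
  unfold torusElt
  rw [← QuotientGroup.mk_inv, Prod.inv_mk, upper_inv]
  simp

/-- The inverse of `E.torusElt n` multiplies the diagonal entries by elements of absolute value one,
the upper right entry by `N(θ)^n` and the lower left entry by `N(θ)^{-n}`. -/
theorem interLattice_torusElt_inv (n : ℕ) :
    E.interLattice (E.torusElt n)⁻¹ = E.box ![1, 1, 1, (p : ℚ_[p]) ^ n] := by
  ext x
  obtain ⟨w, rfl⟩ := E.vcoord.symm.surjective x
  set N : ℚ_[p] := ((normUnits p F (E.θu ^ n) : ℚ_[p]ˣ) : ℚ_[p]) with hN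
  have hN0 : N ≠ 0 := (normUnits p F (E.θu ^ n)).ne_zero
  have hNn : ‖N‖ = (p : ℝ)⁻¹ ^ n := E.norm_normUnits_θu_pow n
  set d : LocAlg p F := (((E.θu ^ (2 * n))⁻¹ : (LocAlg p F)ˣ) : LocAlg p F) with hd
  have hdabs : absLoc p d = ((p : ℝ)⁻¹ ^ (2 * n))⁻¹ := by
    rw [hd, absLoc_inv, E.absLoc_θu_pow]
  have hdN : d * galConj p c d = algebraMap _ _ ((N ^ 2)⁻¹) := by
    rw [← algebraMap_norm p c E.ne_one E.finrank_eq]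
    congr 1
    change ((normUnits p F (E.θu ^ (2 * n))⁻¹ : ℚ_[p]ˣ) : ℚ_[p]) = _
    rw [map_inv, mul_comm, pow_mul, map_pow, Units.val_inv_eq_inv_val, Units.val_pow_eq_pow_val]
  set M := E.toMatrix w with hM
  have hval : (E.act (E.torusElt n)⁻¹ (E.vcoord.symm w)).1 =
      !![algebraMap _ _ N * (galConj p c d * M 0 0), algebraMap _ _ N * M 0 1;
        algebraMap _ _ (N⁻¹ * w 3) * E.δ, algebraMap _ _ N * (d * M 1 1)] := by
    have hu : (upper p 1 (E.θu ^ (2 * n))⁻¹ 0 : GL (Fin 2) (LocAlg p F)).val = !![1, 0; 0, d] := rfl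
    have h3 : N⁻¹ = N * (N ^ 2)⁻¹ := by field_simp
    have hmap : (!![1, 0; 0, d] : Matrix (Fin 2) (Fin 2) (LocAlg p F)).map (galConj p c) =
        !![1, 0; 0, galConj p c d] := by
      ext i j
      fin_cases i <;> fin_cases j <;> simp
    have h10 : algebraMap _ _ (N⁻¹ * w 3) * E.δ =
        algebraMap _ _ N * (d * galConj p c d * M 1 0) := by
      rw [hdN, h3, map_mul, map_mul]
      change _ = _ * (_ * (algebraMap _ _ (w 3) * E.δ))
      ring
    rw [torusElt_inv, act_mk_val, inv_inv, vcoord_symm_val, ← hM, hu, hmap, ← hN, h10,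
      Matrix.eta_fin_two M, Matrix.adjugate_fin_two_of, Matrix.mul_fin_two, Matrix.mul_fin_two,
      Matrix.smul_of]
    ext i j
    fin_cases i <;> fin_cases j <;> simp [Algebra.smul_def] <;> ring
  have hNN : ‖N‖ ^ 2 * absLoc p d = 1 := by
    rw [hdabs, hNn, ← pow_mul, mul_comm n 2]
    exact mul_inv_cancel₀ (pow_ne_zero _ (inv_ne_zero p_pos.ne'))
  have hδ : ∀ b : ℚ_[p], algebraMap _ _ b * E.δ ∈ localOrder p F ↔ ‖b‖ ≤ 1 := by
    intro b
    have := E.mem_order_δ 0 b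
    rw [map_zero, zero_add, norm_zero] at this
    simp [this]
  have hN1 : algebraMap ℚ_[p] (LocAlg p F) N ∈ localOrder p F := by
    rw [E.mem_order_iff, E.absLoc_algebraMap, hNn]
    exact pow_le_one₀ (by positivity) (pow_le_one₀ (by positivity)
      (inv_le_one_of_one_le₀ one_lt_p.le))
  have h3 : ‖N⁻¹ * w 3‖ ≤ 1 ↔ ‖w 3‖ ≤ ‖(p : ℚ_[p]) ^ n‖ := by
    rw [norm_mul, norm_inv, inv_mul_le_iff₀ (norm_pos_iff.mpr hN0), mul_one, hNn, norm_pow,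
      Padic.norm_p]
  have hact : E.vcoord.symm w ∈ E.box 1 →
      (E.act (E.torusElt n)⁻¹ (E.vcoord.symm w) ∈ E.box 1 ↔ ‖w 3‖ ≤ ‖(p : ℚ_[p]) ^ n‖) := by
    intro hx
    rw [mem_box_one] at hx
    change ∀ i j, M i j ∈ _ at hx
    rw [mem_box_one, hval, ← h3, ← hδ]
    refine ⟨fun h => h 1 0, fun h i j => ?_⟩
    fin_cases i <;> fin_cases j
    · change algebraMap _ _ N * (galConj p c d * M 0 0) ∈ _
      rw [E.mem_order_iff, absLoc_mul, absLoc_mul, E.absLoc_algebraMap, E.absLoc_galConj,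
        ← mul_assoc, hNN, one_mul, ← E.mem_order_iff]
      exact hx 0 0
    · exact mul_mem hN1 (hx 0 1)
    · exact h
    · change algebraMap _ _ N * (d * M 1 1) ∈ _
      rw [E.mem_order_iff, absLoc_mul, absLoc_mul, E.absLoc_algebraMap,
        ← mul_assoc, hNN, one_mul, ← E.mem_order_iff]
      exact hx 1 1
  have hpn : ‖(p : ℚ_[p]) ^ n‖ ≤ 1 := by
    rw [norm_pow, Padic.norm_p]
    exact pow_le_one₀ (by positivity) (inv_le_one_of_one_le₀ one_lt_p.le)
  rw [mem_interLattice, and_congr_right_iff.mpr hact, mem_box, mem_box]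
  simp only [LinearEquiv.apply_symm_apply, Fin.forall_fin_succ, Pi.one_apply, norm_one]
  change ((‖w 0‖ ≤ 1 ∧ ‖w 1‖ ≤ 1 ∧ ‖w 2‖ ≤ 1 ∧ ‖w 3‖ ≤ 1 ∧ _) ∧ _) ↔
    (‖w 0‖ ≤ ‖(1 : ℚ_[p])‖ ∧ ‖w 1‖ ≤ ‖(1 : ℚ_[p])‖ ∧ ‖w 2‖ ≤ ‖(1 : ℚ_[p])‖ ∧
      ‖w 3‖ ≤ ‖(p : ℚ_[p]) ^ n‖ ∧ _)
  rw [norm_one]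
  constructor
  · rintro ⟨⟨h0, h1, h2, -, h⟩, h4⟩
    exact ⟨h0, h1, h2, h4, fun i => i.elim0⟩
  · rintro ⟨h0, h1, h2, h4, h⟩
    exact ⟨⟨h0, h1, h2, h4.trans hpn, fun i => i.elim0⟩, h4⟩

end EisensteinGenerator

end WeilCoefficient

/-! ### Double cosets of the group of integral points -/

section Decomposition

variable {p : ℕ} [hp : Fact p.Prime] {F : Type*} [Field F] [NumberField F]
variable {c : F ≃ₐ[ℚ] F} (E : EisensteinGenerator p c)

theorem centralEmb_mul_apply (z : (LocAlg p F)ˣ) (a : GL (Fin 2) (LocAlg p F)) (i j : Fin 2) :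
    ((centralEmb p F z).1 * a : GL (Fin 2) (LocAlg p F)) i j = (z : LocAlg p F) * a i j := by
  change (Matrix.scalar (Fin 2) (z : LocAlg p F) * (a : Matrix (Fin 2) (Fin 2) (LocAlg p F))) i j = _
  rw [Matrix.scalar_apply, Matrix.diagonal_mul]

theorem mk_centralEmb_mul (z : (LocAlg p F)ˣ) (a : GL (Fin 2) (LocAlg p F)) (α : ℚ_[p]ˣ) :
    (QuotientGroup.mk ((centralEmb p F z).1 * a, normUnits p F z * α) : H0 p F) =
      QuotientGroup.mk (a, α) := by
  change (QuotientGroup.mk (centralEmb p F z * (a, α)) : H0 p F) = _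
  rw [QuotientGroup.mk_mul, (QuotientGroup.eq_one_iff (N := (centralEmb p F).range) _).mpr ⟨z, rfl⟩, one_mul]

theorem absLoc_det_of_mem_H01 {h : H01 p F} {a : GL (Fin 2) (LocAlg p F)} {α : ℚ_[p]ˣ}
    (hh : QuotientGroup.mk (a, α) = (h : H0 p F)) :
    absLoc p (a : Matrix (Fin 2) (Fin 2) (LocAlg p F)).det = ‖(α : ℚ_[p])‖ ^ 2 := by
  have h1 : similitude p F (QuotientGroup.mk (a, α)) = 1 := by rw [hh]; exact h.2
  have h2 : (α ^ 2)⁻¹ * normUnits p F (Matrix.GeneralLinearGroup.det a) = 1 := h1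
  rw [inv_mul_eq_one] at h2
  have h3 := congrArg (fun u : ℚ_[p]ˣ => ‖(u : ℚ_[p])‖) h2
  simp only [Units.val_pow_eq_pow_val, norm_pow] at h3
  rw [h3]
  rfl

variable (p F) in
/-- The classes `(a, α)` in `H⁰₁(ℚ_p)` where `a` is integral and `α` has valuation `n`. -/
def heckeBall (n : ℕ) : Set (H01 p F) :=
  {h | ∃ (a : GL (Fin 2) (LocAlg p F)) (α : ℚ_[p]ˣ),
    (a : Matrix (Fin 2) (Fin 2) (LocAlg p F)) ∈ integralMatrices p F ∧
      ‖(α : ℚ_[p])‖ = (p : ℝ)⁻¹ ^ n ∧ QuotientGroup.mk (a, α) = (h : H0 p F)}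

namespace EisensteinGenerator

/-- The elements of `H⁰₁(ℚ_p)` in the double coset of `E.torusElt n` for the group of integral points
of `H⁰(ℚ_p)`. -/
def doubleCoset (n : ℕ) : Set (H01 p F) :=
  {h | ∃ k₁ ∈ integralH0 p F, ∃ k₂ ∈ integralH0 p F, (h : H0 p F) = k₁ * E.torusElt n * k₂}

/-- A class `(a, α)` with `a` integral lies in one of the first double cosets: if `a` is primitive this is
the Cartan decomposition, and otherwise the common factor `θ` of its entries is divided out. -/
theorem exists_mem_doubleCoset_of_integral {h : H01 p F} {n : ℕ} : h ∈ heckeBall p F n →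
    ∃ m ≤ n, h ∈ E.doubleCoset m := by
  have hq0 : (0 : ℝ) < (p : ℝ)⁻¹ := inv_pos.mpr p_pos
  induction n with
  | zero =>
    rintro ⟨a, α, ha, hα, hh⟩
    have hdet := absLoc_det_of_mem_H01 hh
    rw [hα, pow_zero, one_pow] at hdet
    refine ⟨0, le_rfl, 1, one_mem _, h, mem_integralH0.mpr ⟨a, α, E.mem_integralGL_of_det ha hdet,
      by rw [hα, pow_zero], hh⟩, ?_⟩
    have h1 : E.torusElt 0 = 1 := by
      unfold torusElt
      have h2 : (upper p 1 (E.θu ^ (2 * 0)) 0 : GL (Fin 2) (LocAlg p F)) = 1 := by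
        apply Units.ext
        change !![_, _; _, _] = (1 : Matrix (Fin 2) (Fin 2) (LocAlg p F))
        rw [Matrix.one_fin_two]
        simp
      rw [h2, pow_zero, map_one]
      rfl
    rw [h1, one_mul, one_mul]
  | succ n ih =>
    rintro ⟨a, α, ha, hα, hh⟩
    have hdet := absLoc_det_of_mem_H01 hh
    by_cases hprim : ∃ i j, absLoc p (a i j) = 1
    · have hmem : a ∈ heckeSet p F (2 * (n + 1)) := ⟨ha, by
        rw [hdet, hα, ← pow_mul, mul_comm]⟩
      obtain ⟨k₁, hk₁, k₂, hk₂, rfl⟩ := E.exists_cartan_θ hmem hprim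
      refine ⟨n + 1, le_rfl, QuotientGroup.mk (k₁, 1), mem_integralH0.mpr ⟨k₁, 1, hk₁, by simp, rfl⟩,
        QuotientGroup.mk (k₂, (normUnits p F (E.θu ^ (n + 1)))⁻¹ * α),
        mem_integralH0.mpr ⟨k₂, _, hk₂, ?_, rfl⟩, ?_⟩
      · rw [Units.val_mul, norm_mul, Units.val_inv_eq_inv_val, norm_inv, norm_normUnits_θu_pow, hα]
        exact inv_mul_cancel₀ (pow_pos hq0 _).ne'
      · rw [← hh]
        change QuotientGroup.mk _ = QuotientGroup.mk ((k₁, 1) *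
          (upper p 1 (E.θu ^ (2 * (n + 1))) 0, normUnits p F (E.θu ^ (n + 1))) * (k₂, _))
        rw [Prod.mk_mul_mk, Prod.mk_mul_mk, one_mul, mul_inv_cancel_left]
    · push Not at hprim
      have hball : h ∈ heckeBall p F n := by
        refine ⟨(centralEmb p F E.θu⁻¹).1 * a, normUnits p F E.θu⁻¹ * α, ?_, ?_,
          by rw [mk_centralEmb_mul, hh]⟩
        · intro i j
          rw [centralEmb_mul_apply, E.mem_order_iff, absLoc_mul, absLoc_inv, E.absLoc_θu, inv_inv]
          have h1 : absLoc p (a i j) ≤ (p : ℝ)⁻¹ :=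
            E.absLoc_le_of_lt_one (((E.mem_order_iff _).mp (ha i j)).lt_of_ne (hprim i j))
          calc (p : ℝ) * absLoc p (a i j) ≤ p * (p : ℝ)⁻¹ := by gcongr
            _ = 1 := mul_inv_cancel₀ p_pos.ne'
        · rw [Units.val_mul, norm_mul, hα, norm_normUnits, absLoc_inv, E.absLoc_θu, inv_inv, pow_succ',
            mul_inv_cancel_left₀ p_pos.ne']
      obtain ⟨m, hm, h1⟩ := ih hball
      exact ⟨m, hm.trans n.le_succ, h1⟩

include E in
/-- After multiplication by a central element, every class is represented by an integral matrix. -/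
theorem exists_mem_heckeBall (h : H01 p F) : ∃ n, h ∈ heckeBall p F n := by
  have hq0 : (0 : ℝ) < (p : ℝ)⁻¹ := inv_pos.mpr p_pos
  obtain ⟨⟨a, α⟩, hh⟩ := QuotientGroup.mk_surjective (h : H0 p F)
  obtain ⟨k, hk⟩ := pow_unbounded_of_one_lt (∑ i, ∑ j, absLoc p (a i j)) (one_lt_p (p := p))
  have hint : (((centralEmb p F (E.θu ^ k)).1 * a : GL (Fin 2) (LocAlg p F)) :
      Matrix (Fin 2) (Fin 2) (LocAlg p F)) ∈ integralMatrices p F := by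
    intro i j
    have h1 : absLoc p (a i j) ≤ (p : ℝ) ^ k := by
      refine le_trans ?_ hk.le
      refine (Finset.single_le_sum (f := fun j => absLoc p (a i j)) (fun j _ => absLoc_nonneg _)
        (Finset.mem_univ j)).trans ?_
      exact Finset.single_le_sum (f := fun i => ∑ j, absLoc p (a i j))
        (fun i _ => Finset.sum_nonneg fun j _ => absLoc_nonneg _) (Finset.mem_univ i)
    rw [centralEmb_mul_apply, E.mem_order_iff, absLoc_mul, E.absLoc_θu_pow, inv_pow,
      inv_mul_le_iff₀ (pow_pos p_pos k), mul_one]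
    exact h1
  have hmk := (mk_centralEmb_mul (E.θu ^ k) a α).trans hh
  have hdet := absLoc_det_of_mem_H01 hmk
  have hle : ‖((normUnits p F (E.θu ^ k) * α : ℚ_[p]ˣ) : ℚ_[p])‖ ≤ 1 := by
    rw [← pow_le_one_iff_of_nonneg (norm_nonneg _) two_ne_zero, ← hdet, ← E.mem_order_iff,
      Matrix.det_fin_two]
    exact sub_mem (mul_mem (hint _ _) (hint _ _)) (mul_mem (hint _ _) (hint _ _))
  obtain ⟨n, hn⟩ := exists_norm_eq_pow (Units.ne_zero _) hle
  exact ⟨n, _, _, hint, hn, hmk⟩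

theorem mem_heckeBall_of_mem_doubleCoset {h : H01 p F} {m n : ℕ} (hmn : m ≤ n)
    (hm : h ∈ E.doubleCoset m) : h ∈ heckeBall p F n := by
  have hq0 : (0 : ℝ) < (p : ℝ)⁻¹ := inv_pos.mpr p_pos
  have hq1 : (p : ℝ)⁻¹ ≤ 1 := inv_le_one_of_one_le₀ one_lt_p.le
  obtain ⟨k₁, hk₁, k₂, hk₂, hh⟩ := hm
  obtain ⟨r₁, β₁, hr₁, hβ₁, rfl⟩ := mem_integralH0.mp hk₁
  obtain ⟨r₂, β₂, hr₂, hβ₂, rfl⟩ := mem_integralH0.mp hk₂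
  refine ⟨(centralEmb p F (E.θu ^ (n - m))).1 * (r₁ * upper p 1 (E.θu ^ (2 * m)) 0 * r₂),
    normUnits p F (E.θu ^ (n - m)) * (β₁ * normUnits p F (E.θu ^ m) * β₂), ?_, ?_, ?_⟩
  · have hu : ((upper p 1 (E.θu ^ (2 * m)) 0 : GL (Fin 2) (LocAlg p F)) :
        Matrix (Fin 2) (Fin 2) (LocAlg p F)) ∈ integralMatrices p F := by
      intro i j
      rw [E.mem_order_iff]
      fin_cases i <;> fin_cases j
      · exact absLoc_one.le
      · exact E.absLoc_zero.le.trans zero_le_one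
      · exact E.absLoc_zero.le.trans zero_le_one
      · exact (E.absLoc_θu_pow _).le.trans (pow_le_one₀ hq0.le hq1)
    have h1 := (integralMatrices p F).mul_mem
      ((integralMatrices p F).mul_mem (mem_integralGL.mp hr₁).1 hu) (mem_integralGL.mp hr₂).1
    intro i j
    rw [centralEmb_mul_apply]
    refine mul_mem ?_ (h1 i j)
    rw [E.mem_order_iff, E.absLoc_θu_pow]
    exact pow_le_one₀ hq0.le hq1
  · simp only [Units.val_mul, norm_mul, hβ₁, hβ₂, norm_normUnits_θu_pow]
    rw [one_mul, mul_one, ← pow_add, Nat.sub_add_cancel hmn]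
  · rw [mk_centralEmb_mul, hh]
    rfl

theorem mem_heckeBall_iff {h : H01 p F} {n : ℕ} :
    h ∈ heckeBall p F n ↔ ∃ m ≤ n, h ∈ E.doubleCoset m :=
  ⟨E.exists_mem_doubleCoset_of_integral, fun ⟨_, hm, h⟩ => E.mem_heckeBall_of_mem_doubleCoset hm h⟩

theorem iUnion_doubleCoset : ⋃ n, E.doubleCoset n = Set.univ := by
  refine Set.eq_univ_of_forall fun h => ?_
  obtain ⟨n, hn⟩ := E.exists_mem_heckeBall h
  obtain ⟨m, -, hm⟩ := E.mem_heckeBall_iff.mp hn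
  exact Set.mem_iUnion.mpr ⟨m, hm⟩

theorem relIndex_of_mem_doubleCoset {h : H01 p F} {n : ℕ} (hn : h ∈ E.doubleCoset n) :
    (E.interLattice (h : H0 p F)⁻¹).relIndex (E.box 1) = p ^ n := by
  obtain ⟨k₁, hk₁, k₂, hk₂, hh⟩ := hn
  rw [hh, mul_inv_rev, mul_inv_rev, ← mul_assoc, E.relIndex_interLattice_mul_mul
    (inv_mem hk₂) (inv_mem hk₁), interLattice_torusElt_inv,
    E.relIndex_box (s := 1) (fun _ => one_ne_zero) (k := ![0, 0, 0, n])]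
  · simp [Fin.sum_univ_four]
  · intro i
    fin_cases i <;> simp

/-- The double cosets are distinguished by the index of `L_p ∩ h L_p` in `L_p`. -/
theorem pairwise_disjoint_doubleCoset : Pairwise (Function.onFun Disjoint E.doubleCoset) := by
  intro m n hmn
  refine Set.disjoint_left.mpr fun h hm hn => hmn ?_
  have h1 := (E.relIndex_of_mem_doubleCoset hm).symm.trans (E.relIndex_of_mem_doubleCoset hn)
  exact Nat.pow_right_injective hp.out.two_le h1

/-- The matrix coefficient of the Weil representation on a double coset of the group of
integral points. -/
theorem pairingOmega_eq (dx : Measure (quadSpace p c × quadSpace p c)) [dx.IsAddLeftInvariant]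
    {n : ℕ} {h : H01 p F} (hn : h ∈ E.doubleCoset n) :
    pairingOmega p c dx (weilAction p c E.ne_one E.finrank_eq h (phiStar p c)) (phiStar p c) =
      (((p : ℝ)⁻¹ ^ 2) ^ n *
        dx.real ((E.box 1 : Set (quadSpace p c)) ×ˢ (E.box 1 : Set (quadSpace p c))) : ℝ) := by
  rw [pairingOmega_eq_measureReal]
  congr 1
  have hidx := E.relIndex_of_mem_doubleCoset hn
  have h1 := measureReal_prod_eq dx (A := E.interLattice (h : H0 p F)⁻¹) (B := E.box 1) inf_le_left
    (E.isOpen_interLattice _) (by rw [hidx]; exact pow_ne_zero _ hp.out.ne_zero)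
  rw [h1, hidx, ← mul_assoc]
  have hp0 : (p : ℝ) ≠ 0 := p_pos.ne'
  push_cast
  rw [← pow_mul, ← pow_mul, mul_comm n 2, ← mul_pow, inv_mul_cancel₀ hp0, one_pow, one_mul]

open scoped Pointwise in
theorem measurableSet_doubleCoset (n : ℕ) : MeasurableSet (E.doubleCoset n) := by
  have h1 : E.doubleCoset n = E.doubleCoset n * (openCompactSubgroup p F : Set (H01 p F)) := by
    refine Set.Subset.antisymm (fun h hh => ⟨h, hh, 1, one_mem _, mul_one h⟩) ?_
    rintro _ ⟨h, ⟨k₁, hk₁, k₂, hk₂, hh⟩, u, hu, rfl⟩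
    refine ⟨k₁, hk₁, k₂ * u, mul_mem hk₂ hu, ?_⟩
    rw [← mul_assoc, ← hh]
    rfl
  rw [h1]
  exact (E.isOpen_openCompactSubgroup.mul_left).measurableSet

theorem heckeRep_mem_H01 {n : ℕ} {j : Σ _ : ℕ, LocAlg p F} (hj : j ∈ E.heckeIndex (2 * n)) :
    (QuotientGroup.mk (E.heckeRep (2 * n) j, normUnits p F (E.θu ^ n)) : H0 p F) ∈ H01 p F := by
  change (normUnits p F (E.θu ^ n) ^ 2)⁻¹ *
    normUnits p F (Matrix.GeneralLinearGroup.det (E.heckeRep (2 * n) j)) = 1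
  have h : Matrix.GeneralLinearGroup.det (E.heckeRep (2 * n) j) = (E.θu ^ n) ^ 2 := by
    apply Units.ext
    refine (E.det_heckeRep hj).trans ?_
    rw [← pow_mul, mul_comm n 2, Units.val_pow_eq_pow_val, E.val_θu]
  rw [h, map_pow (normUnits p F) (E.θu ^ n) 2, inv_mul_cancel]

open Classical in
/-- The representatives of the cosets of `𝒰_p` in `heckeBall p F n`, indexed by
`E.heckeIndex (2 * n)`. The value outside this set is irrelevant. -/
def ballRep (n : ℕ) (j : Σ _ : ℕ, LocAlg p F) : H01 p F :=
  if hj : j ∈ E.heckeIndex (2 * n) then ⟨_, E.heckeRep_mem_H01 hj⟩ else 1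

theorem coe_ballRep {n : ℕ} {j : Σ _ : ℕ, LocAlg p F} (hj : j ∈ E.heckeIndex (2 * n)) :
    (E.ballRep n j : H0 p F) =
      QuotientGroup.mk (E.heckeRep (2 * n) j, normUnits p F (E.θu ^ n)) := by
  unfold ballRep
  rw [dif_pos hj]

theorem mem_heckeBall_iff_ballRep {n : ℕ} {h : H01 p F} : h ∈ heckeBall p F n ↔
    ∃ j ∈ E.heckeIndex (2 * n), (E.ballRep n j)⁻¹ * h ∈ openCompactSubgroup p F := by
  have hq0 : (0 : ℝ) < (p : ℝ)⁻¹ := inv_pos.mpr p_pos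
  have hint : ∀ j, (E.ballRep n j)⁻¹ * h ∈ openCompactSubgroup p F ↔
      (E.ballRep n j : H0 p F)⁻¹ * h ∈ integralH0 p F := fun j => Iff.rfl
  constructor
  · rintro ⟨a, α, ha, hα, hh⟩
    have hdet := absLoc_det_of_mem_H01 hh
    have hmem : a ∈ heckeSet p F (2 * n) := ⟨ha, by rw [hdet, hα, ← pow_mul, mul_comm]⟩
    obtain ⟨j, hj, hk⟩ := E.exists_heckeRep hmem
    refine ⟨j, hj, ?_⟩
    rw [hint, coe_ballRep E hj, ← hh, mem_integralH0]
    refine ⟨_, (normUnits p F (E.θu ^ n))⁻¹ * α, hk, ?_, rfl⟩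
    rw [Units.val_mul, norm_mul, Units.val_inv_eq_inv_val, norm_inv, norm_normUnits_θu_pow, hα]
    exact inv_mul_cancel₀ (pow_pos hq0 _).ne'
  · rintro ⟨j, hj, h1⟩
    rw [hint, mem_integralH0] at h1
    obtain ⟨r, β, hr, hβ, h2⟩ := h1
    rw [eq_inv_mul_iff_mul_eq, coe_ballRep E hj] at h2
    refine ⟨E.heckeRep (2 * n) j * r, normUnits p F (E.θu ^ n) * β,
      (E.mul_mem_heckeSet' hr (E.heckeRep_mem hj)).1, ?_, h2⟩
    rw [Units.val_mul, norm_mul, norm_normUnits_θu_pow, hβ, mul_one]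

theorem ballRep_unique {n : ℕ} {i j : Σ _ : ℕ, LocAlg p F} (hi : i ∈ E.heckeIndex (2 * n))
    (hj : j ∈ E.heckeIndex (2 * n))
    (h : (E.ballRep n i)⁻¹ * E.ballRep n j ∈ openCompactSubgroup p F) : i = j := by
  refine E.heckeRep_unique hi hj ?_
  have h1 : (E.ballRep n i : H0 p F)⁻¹ * E.ballRep n j ∈ integralH0 p F := h
  rw [coe_ballRep E hi, coe_ballRep E hj, mem_integralH0] at h1
  obtain ⟨r, β, hr, hβ, h2⟩ := h1
  have h3 : (QuotientGroup.mk (r, β) : H0 p F) =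
      QuotientGroup.mk ((E.heckeRep (2 * n) i)⁻¹ * E.heckeRep (2 * n) j,
        (normUnits p F (E.θu ^ n))⁻¹ * normUnits p F (E.θu ^ n)) := h2
  rw [inv_mul_cancel, QuotientGroup.eq] at h3
  obtain ⟨z, hz⟩ := h3
  have hz1 : (centralEmb p F z).1 =
      r⁻¹ * ((E.heckeRep (2 * n) i)⁻¹ * E.heckeRep (2 * n) j) := congrArg Prod.fst hz
  have hz2 : normUnits p F z = β⁻¹ * 1 := congrArg Prod.snd hz
  have hzabs : absLoc p (z : LocAlg p F) = 1 := by
    rw [← norm_normUnits, hz2, mul_one, Units.val_inv_eq_inv_val, norm_inv, hβ, inv_one]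
  have hzK : (centralEmb p F z).1 ∈ integralGL p F := by
    have h5 : ((centralEmb p F z).1 : Matrix (Fin 2) (Fin 2) (LocAlg p F)) =
        Matrix.scalar (Fin 2) (z : LocAlg p F) := rfl
    refine E.mem_integralGL_of_det (fun i j => ?_) ?_
    · rw [h5, Matrix.scalar_apply, Matrix.diagonal_apply]
      split_ifs
      · rw [E.mem_order_iff, hzabs]
      · exact zero_mem _
    · rw [h5, Matrix.scalar_apply, Matrix.det_diagonal, Fin.prod_univ_two, absLoc_mul, hzabs,
        one_mul]
  rw [← mul_inv_cancel_left r ((E.heckeRep (2 * n) i)⁻¹ * E.heckeRep (2 * n) j), ← hz1]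
  exact mul_mem hr hzK

end EisensteinGenerator

end Decomposition

/-! ### The generating series -/

section Series

/-- The sum of the monomials of degree `m` in two variables. -/
def completeSum (α β : ℂ) (m : ℕ) : ℂ := ∑ i ∈ Finset.range (m + 1), α ^ i * β ^ (m - i)

theorem completeSum_succ (α β : ℂ) (m : ℕ) :
    completeSum α β (m + 1) = α ^ (m + 1) + β * completeSum α β m := by
  unfold completeSum
  rw [Finset.sum_range_succ, Finset.mul_sum, Nat.sub_self, pow_zero, mul_one, add_comm]
  congr 1
  refine Finset.sum_congr rfl fun i hi => ?_
  rw [Nat.succ_sub (Nat.lt_succ_iff.mp (Finset.mem_range.mp hi)), pow_succ]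
  ring

theorem completeSum_succ' (α β : ℂ) (m : ℕ) :
    completeSum α β (m + 1) = β ^ (m + 1) + α * completeSum α β m := by
  unfold completeSum
  rw [Finset.sum_range_succ', Finset.mul_sum, pow_zero, one_mul, Nat.sub_zero, add_comm]
  congr 1
  refine Finset.sum_congr rfl fun i _ => ?_
  rw [Nat.add_sub_add_right, pow_succ]
  ring

theorem completeSum_add_two {α β : ℂ} (h : α * β = 1) (m : ℕ) :
    completeSum α β (m + 2) = completeSum α β m + α ^ (m + 2) + β ^ (m + 2) := by
  rw [completeSum_succ, completeSum_succ']
  linear_combination completeSum α β m * h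

/-- The monomials of even degree `2 n + 2`, split according to the parity of the exponents, when the
product of the two variables is `1`. -/
theorem completeSum_two_mul_succ {α β : ℂ} (h : α * β = 1) (n : ℕ) :
    completeSum α β (2 * (n + 1)) =
      completeSum (α ^ 2) (β ^ 2) (n + 1) + completeSum (α ^ 2) (β ^ 2) n := by
  have h2 : α ^ 2 * β ^ 2 = 1 := by rw [← mul_pow, h, one_pow]
  induction n with
  | zero =>
    simp [completeSum, Finset.sum_range_succ]
    linear_combination h
  | succ n ih =>
    rw [show 2 * (n + 1 + 1) = 2 * (n + 1) + 2 by ring, completeSum_add_two h, ih,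
      completeSum_add_two h2]
    ring

/-- Multiplication of a power series by `1 + x`, on the level of the sequence of terms. -/
theorem hasSum_shift {u v : ℕ → ℂ} {s x : ℂ} (hu : HasSum u s) (h0 : v 0 = u 0)
    (h1 : ∀ n, v (n + 1) = u (n + 1) + x * u n) : HasSum v (s * (1 + x)) := by
  rw [← hasSum_nat_add_iff' 1]
  have h2 := ((hasSum_nat_add_iff' 1).mpr hu).add (hu.mul_left x)
  simp only [← h1] at h2
  convert h2 using 1
  rw [Finset.sum_range_one, Finset.sum_range_one, h0]
  ring

theorem hasSum_completeSum {a b : ℂ} (ha : ‖a‖ < 1) (hb : ‖b‖ < 1) :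
    HasSum (completeSum a b) ((1 - a)⁻¹ * (1 - b)⁻¹) := by
  have hsa : Summable fun n : ℕ => ‖a ^ n‖ := by
    simpa only [norm_pow] using summable_geometric_of_lt_one (norm_nonneg a) ha
  have hsb : Summable fun n : ℕ => ‖b ^ n‖ := by
    simpa only [norm_pow] using summable_geometric_of_lt_one (norm_nonneg b) hb
  rw [← tsum_geometric_of_norm_lt_one ha, ← tsum_geometric_of_norm_lt_one hb,
    tsum_mul_tsum_eq_tsum_sum_range_of_summable_norm hsa hsb]
  exact (summable_norm_sum_mul_range_of_summable_norm hsa hsb).of_norm.hasSum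

theorem completeSum_mul (x α β : ℂ) (n : ℕ) :
    completeSum (α * x) (β * x) n = x ^ n * completeSum α β n := by
  unfold completeSum
  rw [Finset.mul_sum]
  refine Finset.sum_congr rfl fun i hi => ?_
  rw [mul_pow, mul_pow, ← Nat.add_sub_of_le (Nat.lt_succ_iff.mp (Finset.mem_range.mp hi)), pow_add]
  simp only [Nat.add_sub_cancel_left]
  ring

theorem heckeEigenvalue_two_mul (p : ℕ) (α β : ℂ) (n : ℕ) :
    heckeEigenvalue p α β (2 * n) = (p : ℂ) ^ n * completeSum α β (2 * n) := by
  unfold heckeEigenvalue completeSum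
  congr 1
  rw [pow_mul, ← Complex.ofReal_pow, Real.sq_sqrt (Nat.cast_nonneg p), Complex.ofReal_natCast]

variable {p : ℕ} [hp : Fact p.Prime]

/-- The generating series of the increments of the Hecke eigenvalues of even index, evaluated
at `p⁻²`. -/
theorem hasSum_heckeEigenvalue {α β : ℂ} (h : α * β = 1) (hα : ‖α‖ < Real.sqrt p)
    (hβ : ‖β‖ < Real.sqrt p) {v : ℕ → ℂ} (h0 : v 0 = heckeEigenvalue p α β 0)
    (h1 : ∀ n, v (n + 1) = ((p : ℂ)⁻¹ ^ 2) ^ (n + 1) *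
      (heckeEigenvalue p α β (2 * (n + 1)) - heckeEigenvalue p α β (2 * n))) :
    HasSum v ((1 - α ^ 2 * (p : ℂ)⁻¹)⁻¹ * (1 - β ^ 2 * (p : ℂ)⁻¹)⁻¹ * (1 + (p : ℂ)⁻¹) *
      (1 + -(p : ℂ)⁻¹ ^ 2)) := by
  have hp0 : (p : ℂ) ≠ 0 := Nat.cast_ne_zero.mpr hp.out.ne_zero
  have hlt : ∀ z : ℂ, ‖z‖ < Real.sqrt p → ‖z ^ 2 * (p : ℂ)⁻¹‖ < 1 := by
    intro z hz
    rw [norm_mul, norm_pow, norm_inv, Complex.norm_natCast, ← div_eq_mul_inv, div_lt_one p_pos,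
      ← Real.sq_sqrt (Nat.cast_nonneg p)]
    exact pow_lt_pow_left₀ hz (norm_nonneg z) two_ne_zero
  have hH := hasSum_completeSum (hlt α hα) (hlt β hβ)
  have hG : HasSum (fun n => (p : ℂ)⁻¹ ^ n * completeSum α β (2 * n))
      ((1 - α ^ 2 * (p : ℂ)⁻¹)⁻¹ * (1 - β ^ 2 * (p : ℂ)⁻¹)⁻¹ * (1 + (p : ℂ)⁻¹)) := by
    refine hasSum_shift hH (by simp [completeSum]) fun n => ?_
    rw [completeSum_mul, completeSum_mul, completeSum_two_mul_succ h]
    ring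
  refine hasSum_shift hG (by rw [h0, ← mul_zero 2, heckeEigenvalue_two_mul]; simp) fun n => ?_
  rw [h1, heckeEigenvalue_two_mul, heckeEigenvalue_two_mul]
  have e1 : ((p : ℂ)⁻¹ ^ 2) ^ (n + 1) * (p : ℂ) ^ (n + 1) = (p : ℂ)⁻¹ ^ (n + 1) := by
    rw [← mul_pow, pow_two, mul_assoc, inv_mul_cancel₀ hp0, mul_one]
  have e2 : ((p : ℂ)⁻¹ ^ 2) ^ (n + 1) * (p : ℂ) ^ n = (p : ℂ)⁻¹ ^ 2 * (p : ℂ)⁻¹ ^ n := by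
    rw [pow_succ, mul_right_comm, ← mul_pow, pow_two, mul_assoc, inv_mul_cancel₀ hp0, mul_one,
      mul_comm]
  linear_combination completeSum α β (2 * (n + 1)) * e1 - completeSum α β (2 * n) * e2

end Series

/-! ### The zeta integral -/

section Cosets

variable {G : Type*} [Group G] [MeasurableSpace G] [MeasurableMul G] (μ : Measure G)
  [μ.IsMulLeftInvariant] {U : Subgroup G}

/-- The integral of a right `U`-invariant function over a finite disjoint union of cosets of `U`. -/
theorem setIntegral_cosets (hU : MeasurableSet (U : Set G)) (hfin : μ U ≠ ⊤) {ι : Type*}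
    (J : Finset ι) (r : ι → G) (huniq : ∀ i ∈ J, ∀ j ∈ J, (r i)⁻¹ * r j ∈ U → i = j) {φ : G → ℂ}
    (hφ : ∀ g, ∀ u ∈ U, φ (g * u) = φ g) {S : Set G} (hS : ∀ h, h ∈ S ↔ ∃ j ∈ J, (r j)⁻¹ * h ∈ U) :
    IntegrableOn φ S μ ∧ ∫ h in S, φ h ∂μ = μ.real U * ∑ j ∈ J, φ (r j) := by
  have hSU : S = ⋃ j ∈ J, (fun h => (r j)⁻¹ * h) ⁻¹' (U : Set G) := by
    ext h
    simp [hS]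
  have hm : ∀ j ∈ J, MeasurableSet ((fun h => (r j)⁻¹ * h) ⁻¹' (U : Set G)) := fun j _ =>
    measurable_const_mul _ hU
  have hconst : ∀ j, ∀ h ∈ (fun h => (r j)⁻¹ * h) ⁻¹' (U : Set G), φ h = φ (r j) := fun j h hh => by
    rw [← hφ (r j) _ hh, mul_inv_cancel_left]
  have hint : ∀ j ∈ J, IntegrableOn φ ((fun h => (r j)⁻¹ * h) ⁻¹' (U : Set G)) μ := fun j hj =>
    (integrableOn_const (by rwa [measure_preimage_mul])).congr_fun
      (fun h hh => (hconst j h hh).symm) (hm j hj)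
  have hdisj : (J : Set ι).Pairwise
      (Function.onFun Disjoint fun j => (fun h => (r j)⁻¹ * h) ⁻¹' (U : Set G)) := by
    intro i hi j hj hij
    refine Set.disjoint_left.mpr fun h h1 h2 => hij (huniq i hi j hj ?_)
    have := U.mul_mem h1 (U.inv_mem h2)
    simpa [mul_assoc] using this
  rw [hSU]
  refine ⟨integrableOn_finset_iUnion.mpr hint, ?_⟩
  rw [integral_biUnion_finset J hm hdisj hint, Finset.mul_sum]
  refine Finset.sum_congr rfl fun j hj => ?_
  rw [setIntegral_congr_fun (hm j hj) (hconst j), setIntegral_const, Measure.real,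
    measure_preimage_mul, Complex.real_smul]
  rfl

/-- The norm of a function which is constant on a set integrates there to the norm of its
integral. -/
theorem setIntegral_norm_of_const {X : Type*} [MeasurableSpace X] (μ : Measure X) {S : Set X}
    (hS : MeasurableSet S) {φ : X → ℂ} {z : ℂ} (hφ : ∀ x ∈ S, φ x = z) :
    ∫ x in S, ‖φ x‖ ∂μ = ‖∫ x in S, φ x ∂μ‖ := by
  rw [setIntegral_congr_fun hS hφ, setIntegral_congr_fun hS (g := fun _ => ‖z‖)
    fun x hx => by rw [hφ x hx], setIntegral_const, setIntegral_const, norm_smul, smul_eq_mul,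
    Real.norm_of_nonneg measureReal_nonneg]

end Cosets

section Integral

variable {p : ℕ} [hp : Fact p.Prime] {F : Type*} [Field F] [NumberField F]
variable {c : F ≃ₐ[ℚ] F} (E : EisensteinGenerator p c)
variable {V : Type*} [AddCommGroup V] [Module ℂ V]
  {π : Representation ℂ (GL (Fin 2) (LocAlg p F)) V} (hπ : TrivialCentralChar p π)
  {B : V →ₗ[ℂ] V →ₗ⋆[ℂ] ℂ} {v : V}

theorem sigma_mk (a : GL (Fin 2) (LocAlg p F)) (α : ℚ_[p]ˣ) :
    sigma p π hπ (QuotientGroup.mk (a, α)) = π a := rfl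

theorem sigma_of_mem_integralH0 (hv : ∀ k ∈ integralGL p F, π k v = v) {k : H0 p F}
    (hk : k ∈ integralH0 p F) : sigma p π hπ k v = v := by
  obtain ⟨r, β, hr, -, rfl⟩ := mem_integralH0.mp hk
  exact hv r hr

theorem sigmaCoeff_mul_mul (hB : ∀ g v w, B (π g v) (π g w) = B v w)
    (hv : ∀ k ∈ integralGL p F, π k v = v) {k₁ k₂ : H0 p F}
    (hk₁ : k₁ ∈ integralH0 p F) (hk₂ : k₂ ∈ integralH0 p F) (g : H0 p F) :
    B (sigma p π hπ (k₁ * g * k₂) v) v = B (sigma p π hπ g v) v := by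
  obtain ⟨r₁, β₁, hr₁, -, rfl⟩ := mem_integralH0.mp hk₁
  obtain ⟨r₂, β₂, hr₂, -, rfl⟩ := mem_integralH0.mp hk₂
  obtain ⟨⟨a, α⟩, rfl⟩ := QuotientGroup.mk_surjective g
  exact matrixCoeff_mul_mul hB hv hr₁ hr₂ a

variable {μ ν : (LocAlg p F)ˣ →* ℂˣ} {e : V ≃ₗ[ℂ] principalSeriesSpace p μ ν}
  (dh : Measure (H01 p F)) [dh.IsHaarMeasure]

namespace EisensteinGenerator

/-- The integral of the matrix coefficient over `heckeBall p F n` is given by the Hecke eigenvalue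
of index `2 n`. -/
theorem setIntegral_heckeBall (he : ∀ g v, e (π g v) = principalSeries p μ ν g (e v))
    (hv : ∀ k ∈ integralGL p F, π k v = v) (hv0 : v ≠ 0) (hBv : B v v = 1) (n : ℕ) :
    IntegrableOn (fun h : H01 p F => B (sigma p π hπ h v) v) (heckeBall p F n) dh ∧
      ∫ h in heckeBall p F n, B (sigma p π hπ h v) v ∂dh =
        dh.real (openCompact p F) * heckeEigenvalue p (μ E.θu) (ν E.θu) (2 * n) := by
  have h := setIntegral_cosets dh E.isOpen_openCompactSubgroup.measurableSet
    E.isCompact_openCompactSubgroup.measure_lt_top.ne (E.heckeIndex (2 * n)) (E.ballRep n)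
    (fun i hi j hj => E.ballRep_unique hi hj)
    (φ := fun h : H01 p F => B (sigma p π hπ h v) v) (fun g u hu => by
      change B (sigma p π hπ ((g : H0 p F) * u) v) v = _
      rw [map_mul, Module.End.mul_apply, sigma_of_mem_integralH0 hπ hv (k := u) hu])
    (S := heckeBall p F n) (fun _ => E.mem_heckeBall_iff_ballRep)
  refine ⟨h.1, h.2.trans ?_⟩
  rw [coe_openCompactSubgroup]
  congr 1
  have h1 : ∑ j ∈ E.heckeIndex (2 * n), B (sigma p π hπ (E.ballRep n j : H0 p F) v) v =
      B (∑ j ∈ E.heckeIndex (2 * n), π (E.heckeRep (2 * n) j) v) v := by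
    rw [map_sum, LinearMap.sum_apply]
    refine Finset.sum_congr rfl fun j hj => ?_
    rw [coe_ballRep E hj, sigma_mk]
  rw [h1, hecke_eigenvector E he hv hv0, map_smul, LinearMap.smul_apply, hBv, smul_eq_mul, mul_one]

theorem heckeBall_zero : heckeBall p F 0 = E.doubleCoset 0 := by
  ext h
  rw [E.mem_heckeBall_iff]
  constructor
  · rintro ⟨m, hm, h1⟩
    rwa [Nat.le_zero.mp hm] at h1
  · exact fun h1 => ⟨0, le_rfl, h1⟩

theorem heckeBall_succ (n : ℕ) :
    heckeBall p F (n + 1) = heckeBall p F n ∪ E.doubleCoset (n + 1) := by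
  ext h
  rw [Set.mem_union, E.mem_heckeBall_iff, E.mem_heckeBall_iff]
  constructor
  · rintro ⟨m, hm, h1⟩
    rcases hm.lt_or_eq with hm | rfl
    · exact Or.inl ⟨m, Nat.lt_succ_iff.mp hm, h1⟩
    · exact Or.inr h1
  · rintro (⟨m, hm, h1⟩ | h1)
    · exact ⟨m, hm.trans n.le_succ, h1⟩
    · exact ⟨n + 1, le_rfl, h1⟩

theorem disjoint_heckeBall_doubleCoset (n : ℕ) :
    Disjoint (heckeBall p F n) (E.doubleCoset (n + 1)) := by
  refine Set.disjoint_left.mpr fun h h1 h2 => ?_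
  obtain ⟨m, hm, h1⟩ := E.mem_heckeBall_iff.mp h1
  exact Set.disjoint_left.mp (E.pairwise_disjoint_doubleCoset (show m ≠ n + 1 by omega)) h1 h2

theorem setIntegral_doubleCoset_succ (he : ∀ g v, e (π g v) = principalSeries p μ ν g (e v))
    (hv : ∀ k ∈ integralGL p F, π k v = v) (hv0 : v ≠ 0) (hBv : B v v = 1) (n : ℕ) :
    ∫ h in E.doubleCoset (n + 1), B (sigma p π hπ h v) v ∂dh =
      dh.real (openCompact p F) * (heckeEigenvalue p (μ E.θu) (ν E.θu) (2 * (n + 1)) -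
        heckeEigenvalue p (μ E.θu) (ν E.θu) (2 * n)) := by
  obtain ⟨h1, h2⟩ := E.setIntegral_heckeBall hπ dh he hv hv0 hBv n
  obtain ⟨h3, h4⟩ := E.setIntegral_heckeBall hπ dh he hv hv0 hBv (n + 1)
  rw [heckeBall_succ] at h3 h4
  rw [setIntegral_union (E.disjoint_heckeBall_doubleCoset n) (E.measurableSet_doubleCoset _)
    h1 (h3.mono_set Set.subset_union_right), h2] at h4
  linear_combination h4

theorem integrableOn_doubleCoset (he : ∀ g v, e (π g v) = principalSeries p μ ν g (e v))
    (hv : ∀ k ∈ integralGL p F, π k v = v) (hv0 : v ≠ 0) (hBv : B v v = 1) (n : ℕ) :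
    IntegrableOn (fun h : H01 p F => B (sigma p π hπ h v) v) (E.doubleCoset n) dh :=
  (E.setIntegral_heckeBall hπ dh he hv hv0 hBv n).1.mono_set fun _ h =>
    E.mem_heckeBall_of_mem_doubleCoset le_rfl h

/-- The zeta integral is the sum of the integrals over the double cosets of the group of integral
points, on each of which the integrand is constant. -/
theorem integrable_and_integral_zetaIntegrand (he : ∀ g v, e (π g v) = principalSeries p μ ν g (e v))
    (hμ : IsUnramified p μ) (hν : IsUnramified p ν) (hμν : IsRegularPair p μ ν)
    (hunit : IsUnitary p π) (hB : ∀ g v w, B (π g v) (π g w) = B v w)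
    (hv : ∀ k ∈ integralGL p F, π k v = v) (hv0 : v ≠ 0) (hBv : B v v = 1)
    (dx : Measure (quadSpace p c × quadSpace p c)) [dx.IsAddLeftInvariant] :
    Integrable (zetaIntegrand p c E.ne_one E.finrank_eq dx π hπ B v) dh ∧
      ∫ h, zetaIntegrand p c E.ne_one E.finrank_eq dx π hπ B v h ∂dh =
        dh.real (openCompact p F) *
          dx.real ((E.box 1 : Set (quadSpace p c)) ×ˢ (E.box 1 : Set (quadSpace p c))) *
          ((1 - (μ E.θu : ℂ) ^ 2 * (p : ℂ)⁻¹)⁻¹ * (1 - (ν E.θu : ℂ) ^ 2 * (p : ℂ)⁻¹)⁻¹ *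
            (1 + (p : ℂ)⁻¹) * (1 + -(p : ℂ)⁻¹ ^ 2)) := by
  set vol : ℂ := (dh.real (openCompact p F) : ℂ) with hvol
  set w : ℝ := dx.real ((E.box 1 : Set (quadSpace p c)) ×ˢ (E.box 1 : Set (quadSpace p c))) with hw
  set Z := zetaIntegrand p c E.ne_one E.finrank_eq dx π hπ B v with hZ
  obtain ⟨hα, hβ⟩ := norm_satake_lt E he hμ hν hμν hπ hunit hv hv0
  have hαβ := mul_eq_one_of_trivialCentralChar E he hv hv0 hπ E.θu
  have hZn : ∀ n, ∀ h ∈ E.doubleCoset n,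
      Z h = ((p : ℂ)⁻¹ ^ 2) ^ n * w * B (sigma p π hπ h v) v := by
    intro n h hn
    rw [hZ, zetaIntegrand, E.pairingOmega_eq dx hn, ← hw]
    push_cast
    rfl
  have hZconst : ∀ n, ∀ h ∈ E.doubleCoset n,
      Z h = ((p : ℂ)⁻¹ ^ 2) ^ n * w * B (sigma p π hπ (E.torusElt n) v) v := by
    intro n h hn
    rw [hZn n h hn]
    obtain ⟨k₁, hk₁, k₂, hk₂, hh⟩ := hn
    rw [hh, sigmaCoeff_mul_mul hπ hB hv hk₁ hk₂]
  have hZint : ∀ n, ∫ h in E.doubleCoset n, Z h ∂dh = ((p : ℂ)⁻¹ ^ 2) ^ n * w *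
      ∫ h in E.doubleCoset n, B (sigma p π hπ h v) v ∂dh := by
    intro n
    rw [setIntegral_congr_fun (E.measurableSet_doubleCoset n) (hZn n), integral_const_mul]
  have hZi : ∀ n, IntegrableOn Z (E.doubleCoset n) dh := by
    intro n
    have h1 : IntegrableOn (fun h : H01 p F => ((p : ℂ)⁻¹ ^ 2) ^ n * w * B (sigma p π hπ h v) v)
        (E.doubleCoset n) dh := (E.integrableOn_doubleCoset hπ dh he hv hv0 hBv n).const_mul _
    exact h1.congr_fun (fun h hn => (hZn n h hn).symm) (E.measurableSet_doubleCoset n)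
  let u : ℕ → ℂ
    | 0 => heckeEigenvalue p (μ E.θu) (ν E.θu) 0
    | n + 1 => ((p : ℂ)⁻¹ ^ 2) ^ (n + 1) * (heckeEigenvalue p (μ E.θu) (ν E.θu) (2 * (n + 1)) -
        heckeEigenvalue p (μ E.θu) (ν E.θu) (2 * n))
  have hu := hasSum_heckeEigenvalue hαβ hα hβ (v := u) rfl fun _ => rfl
  have hZu : ∀ n, ∫ h in E.doubleCoset n, Z h ∂dh = vol * w * u n := by
    intro n
    rw [hZint]
    cases n with
    | zero =>
      rw [← heckeBall_zero, (E.setIntegral_heckeBall hπ dh he hv hv0 hBv 0).2]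
      simp only [u]
      ring
    | succ n =>
      rw [E.setIntegral_doubleCoset_succ hπ dh he hv hv0 hBv n]
      simp only [u]
      ring
  have hsum := hu.mul_left (vol * w)
  simp only [← hZu] at hsum
  have hZI : IntegrableOn Z (⋃ n, E.doubleCoset n) dh := by
    refine integrableOn_iUnion_of_summable_integral_norm hZi ?_
    simp only [fun n => setIntegral_norm_of_const dh (E.measurableSet_doubleCoset n) (hZconst n)]
    exact hsum.summable.norm
  have h1 := hasSum_integral_iUnion E.measurableSet_doubleCoset E.pairwise_disjoint_doubleCoset hZI
  rw [iUnion_doubleCoset, setIntegral_univ] at h1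
  rw [iUnion_doubleCoset, integrableOn_univ] at hZI
  exact ⟨hZI, h1.unique hsum⟩

theorem apply_pUnit (hμ : IsUnramified p μ) : μ (pUnit p) = μ E.θu ^ 2 := by
  have h : absLoc p ((E.θu⁻¹ ^ 2 * pUnit p : (LocAlg p F)ˣ) : LocAlg p F) = 1 := by
    rw [Units.val_mul, absLoc_mul, Units.val_pow_eq_pow_val, absLoc_pow, absLoc_inv, E.absLoc_θu,
      inv_inv]
    change (p : ℝ) ^ 2 * absLoc p (algebraMap ℚ_[p] (LocAlg p F) (p : ℚ_[p])) = 1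
    rw [E.absLoc_algebraMap, Padic.norm_p, ← mul_pow, mul_inv_cancel₀ p_pos.ne', one_pow]
  have h1 := unramified_apply_eq_one E hμ h
  rw [map_mul, map_pow, map_inv, inv_pow, inv_mul_eq_one] at h1
  exact h1.symm

/-- The comparison of the sum of the series with the Asai `L`-factor. -/
theorem asaiL_div_zeta {ϖ : (LocAlg p F)ˣ} (hϖ : IsUniformizer p F ϖ) (hμ : IsUnramified p μ)
    (hν : IsUnramified p ν) (h1 : (μ ϖ : ℂ) * (ν ϖ : ℂ) = 1) :
    asaiL p ϖ μ ν 1 / (zetaP p 1 * zetaP p 2) =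
      (1 - (μ E.θu : ℂ) ^ 2 * (p : ℂ)⁻¹)⁻¹ * (1 - (ν E.θu : ℂ) ^ 2 * (p : ℂ)⁻¹)⁻¹ *
        (1 + -(p : ℂ)⁻¹ ^ 2) := by
  have hp1 : (1 : ℂ) - (p : ℂ)⁻¹ ≠ 0 := by
    rw [sub_ne_zero]
    intro h
    have h2 := congrArg norm h
    rw [norm_one, norm_inv, Complex.norm_natCast] at h2
    exact (inv_lt_one_of_one_lt₀ (one_lt_p (p := p))).ne' h2
  have e1 : (p : ℂ) ^ (-1 : ℂ) = (p : ℂ)⁻¹ := Complex.cpow_neg_one _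
  have e2 : (p : ℂ) ^ (-2 : ℂ) = (p : ℂ)⁻¹ ^ 2 := by
    rw [Complex.cpow_neg, inv_pow]
    congr 1
    exact_mod_cast Complex.cpow_natCast (p : ℂ) 2
  unfold asaiL heckeLQ heckeLF zetaP
  rw [MonoidHom.mul_apply, Units.val_mul, h1, E.absLoc_uniformizer hϖ, E.apply_pUnit hμ,
    E.apply_pUnit hν, e1, e2, Complex.cpow_one]
  push_cast
  rw [div_eq_mul_inv, mul_inv, inv_inv, inv_inv, one_mul]
  linear_combination (1 - (μ E.θu : ℂ) ^ 2 * (p : ℂ)⁻¹)⁻¹ * (1 - (ν E.θu : ℂ) ^ 2 * (p : ℂ)⁻¹)⁻¹ *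
    (1 + -(p : ℂ)⁻¹ ^ 2) * inv_mul_cancel₀ hp1

end EisensteinGenerator

end Integral

end RamifiedZeta

end

open RamifiedZeta MeasureTheory in
theorem propositionP (p : ℕ) [Fact p.Prime]
    (F : Type*) [Field F] [NumberField F] (hF : Module.finrank ℚ F = 2)
    (c : F ≃ₐ[ℚ] F) (hc : c ≠ 1) (hram : IsRamifiedIn p F)
    (ϖ : (LocAlg p F)ˣ) (hϖ : IsUniformizer p F ϖ)
    (dx : Measure (quadSpace p c × quadSpace p c)) [dx.IsAddHaarMeasure]
    (hdx : IsSelfDual p c dx)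
    (dh : Measure (H01 p F)) [dh.IsHaarMeasure]
    (μ ν : (LocAlg p F)ˣ →* ℂˣ) (hμ : IsUnramified p μ) (hν : IsUnramified p ν)
    (hμν : IsRegularPair p μ ν)
    (V : Type*) [AddCommGroup V] [Module ℂ V]
    (π : Representation ℂ (GL (Fin 2) (LocAlg p F)) V)
    (e : V ≃ₗ[ℂ] principalSeriesSpace p μ ν)
    (he : ∀ g v, e (π g v) = principalSeries p μ ν g (e v))
    (hπ : TrivialCentralChar p π) (hunit : IsUnitary p π)
    (f : V) (hf : ∀ k, IsIntegralGL p k → π k f = f)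
    (B : V →ₗ[ℂ] V →ₗ⋆[ℂ] ℂ)
    (hB : ∀ (h : H0 p F) (v w : V), B (sigma p π hπ h v) (sigma p π hπ h w) = B v w)
    (hBf : B f f = 1) :
    Integrable (zetaIntegrand p c hc hF dx π hπ B f) dh ∧
      ∫ h, zetaIntegrand p c hc hF dx π hπ B f h ∂dh =
        (dh.real (openCompact p F) : ℂ) *
          ((‖(2 : ℚ_[p]) ^ (-4 : ℤ) * (NumberField.discr F : ℚ_[p]) ^ 3‖ : ℝ) : ℂ) *
          (1 + (p : ℂ)⁻¹) * (asaiL p ϖ μ ν 1 / (zetaP p 1 * zetaP p 2)) := by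
  obtain ⟨E⟩ := nonempty_eisensteinGenerator p c hc hF hram
  have hv : ∀ k ∈ integralGL p F, π k f = f := fun k hk => hf k (mem_integralGL.mp hk)
  have hv0 : f ≠ 0 := by
    rintro rfl
    rw [map_zero] at hBf
    exact zero_ne_one hBf
  have hBπ : ∀ g v w, B (π g v) (π g w) = B v w := fun g v w => hB (QuotientGroup.mk (g, 1)) v w
  obtain ⟨h1, h2⟩ := E.integrable_and_integral_zetaIntegrand hπ dh he hμ hν hμν hunit hBπ hv hv0 hBf dx
  refine ⟨h1, h2.trans ?_⟩
  rw [E.measureReal_latticeL dx hdx, E.asaiL_div_zeta hϖ hμ hν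
    (mul_eq_one_of_trivialCentralChar E he hv hv0 hπ ϖ)]
  ring
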